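/- Let $\mathcal Y$ be a unitary fusion category, $\operatorname{Irr}(\mathcal Y)$ a (finite) set of representatives of its simple objects, and $Y:=\bigoplus_{x\in\operatorname{Irr}(\mathcal Y)}x$. Let $Z(\mathcal Y)$ be its Drinfeld center, $F:Z(\mathcal Y)\to\mathcal Y$ the forgetful functor, and let $A\in Z(\mathcal Y)$ be a connected étale algebra (commutative, separable, $\dim Z(\mathcal Y)(1\to A)=1$) with unit $i_A:1\to A$ and multiplication $m$. Let $Z(\mathcal Y)_A$ be the category of $A$-modules in $Z(\mathcal Y)$; for $z\in Z(\mathcal Y)$ let $Az=A\otimes z$ be the free $A$-module. The $A$-tube algebra is $$\operatorname{Tube}_A(\mathcal Y)=\bigoplus_{x\in\operatorname{Irr}(\mathcal Y)}\mathcal Y(x\otimes Y\to F(A)\otimes Y\otimes x).$$ For $f$ in the summand of $x$ and $g$ in the summand of $y$, let $f\ast g: x\otimes y\otimes Y\to F(A)\otimes Y\otimes x\otimes y$ be the composite that applies $g$, moves its $A$-string past $x$ by the half-braiding of $A$, applies $f$, and multiplies the two $A$-strings by $m$. Then the component of $f\cdot g$ at $w\in\operatorname{Irr}(\mathcal Y)$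 is $\sum_\alpha(\operatorname{id}_{F(A)\otimes Y}\otimes\alpha^*)\,(f\ast g)\,(\alpha\otimes\operatorname{id}_Y)$, where $\alpha$ runs through a basis of $\mathcal Y(w\to x\otimes y)$ and $\alpha^*$ through the dual basis of $\mathcal Y(x\otimes y\to w)$, so that $\alpha^*\beta=\delta_{\alpha\beta}\operatorname{id}_w$. Write $\operatorname{Tube}(\mathcal Y):=\operatorname{Tube}_1(\mathcal Y)$; it embeds in $\operatorname{Tube}_A(\mathcal Y)$ by $q\mapsto i_A\otimes q$. For $K\in Z(\mathcal Y)_A$ the space $\mathcal Y(Y\to F(K))$ is a right $\operatorname{Tube}_A(\mathcal Y)$-module: for $\eta:Y\to F(K)$ and $f:x\otimes Y\to F(A)\otimes Y\otimes x$, $\eta\lhd f$ is the left partial trace over $x$, with respect to the canonical spherical structure of $\mathcal Y$, of the composite $$x\otimes Y\xrightarrow{f}F(A)\otimes Y\otimes x\xrightarrow{\eta}F(A)\otimes F(K)\otimes x\to F(K)\otimes x\to x\otimes F(K)$$ of $f$, $\eta$, the action of $A$ on $K$ and the half-braiding of $K$. Let $z\in Z(\mathcal Y)$ be simple and let $q_z\in\operatorname{Tube}(\mathcal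 Y)$ be a minimal idempotent corresponding to $z$, i.e. one that acts non-trivially on $\mathcal Y(Y\to F(z))$. Let $M\in Z(\mathcal Y)_A$ be simple. Then there is a unique minimal central idempotent $P_M\in\operatorname{Tube}_A(\mathcal Y)$ that acts as the identity on $\mathcal Y(Y\to F(M))$; its block $P_M\operatorname{Tube}_A(\mathcal Y)$ is isomorphic to a matrix algebra $M_n(\mathbb C)$; and, under any such isomorphism, the matrix $P_M(i_A\otimes q_z)$ satisfies $$\operatorname{rank}\bigl(P_M(i_A\otimes q_z)\bigr)=\dim Z(\mathcal Y)_A(M\to Az).$$ -/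

import Mathlib

open CategoryTheory MonoidalCategory MonObj

universe u v w

set_option linter.unusedSectionVars false
set_option linter.style.haveILetI false

namespace CategoryTheory

/-! ### The Drinfeld center and categories of modules are linear -/

section CenterLinear
variable {C : Type u} [Category.{v} C] [Preadditive C] [MonoidalCategory C]
  [MonoidalPreadditive C]

theorem HalfBraiding.comm_zero {X Y : C} (a : HalfBraiding X) (b : HalfBraiding Y) (U : C) :
    ((0 : X ⟶ Y) ▷ U) ≫ (b.β U).hom = (a.β U).hom ≫ (U ◁ (0 : X ⟶ Y)) := by simp

theorem HalfBraiding.comm_add {X Y : C} (a : HalfBraiding X) (b : HalfBraiding Y) {f g : X ⟶ Y}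
    (U : C) (hf : (f ▷ U) ≫ (b.β U).hom = (a.β U).hom ≫ (U ◁ f))
    (hg : (g ▷ U) ≫ (b.β U).hom = (a.β U).hom ≫ (U ◁ g)) :
    ((f + g) ▷ U) ≫ (b.β U).hom = (a.β U).hom ≫ (U ◁ (f + g)) := by simp [hf, hg]

theorem whiskerRight_neg' {X Y : C} (f : X ⟶ Y) (U : C) : (-f) ▷ U = -(f ▷ U) :=
  (tensorRight U).map_neg

theorem whiskerLeft_neg' {X Y : C} (f : X ⟶ Y) (U : C) : U ◁ (-f) = -(U ◁ f) :=
  (tensorLeft U).map_neg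

theorem HalfBraiding.comm_neg {X Y : C} (a : HalfBraiding X) (b : HalfBraiding Y) {f : X ⟶ Y}
    (U : C) (hf : (f ▷ U) ≫ (b.β U).hom = (a.β U).hom ≫ (U ◁ f)) :
    ((-f) ▷ U) ≫ (b.β U).hom = (a.β U).hom ≫ (U ◁ (-f)) := by
  simp [whiskerRight_neg', whiskerLeft_neg', hf]

namespace Center

/-- The morphisms of the Drinfeld center form a subgroup of the morphisms of `C`. -/
def homAddSubgroup (X Y : Center C) : AddSubgroup (X.1 ⟶ Y.1) where
  carrier := {f | ∀ U, (f ▷ U) ≫ (Y.2.β U).hom = (X.2.β U).hom ≫ (U ◁ f)}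
  zero_mem' := fun U => HalfBraiding.comm_zero X.2 Y.2 U
  add_mem' := fun hf hg U => HalfBraiding.comm_add X.2 Y.2 U (hf U) (hg U)
  neg_mem' := fun hf U => HalfBraiding.comm_neg X.2 Y.2 U (hf U)

/-- Morphisms of the Drinfeld center, as morphisms of `C` compatible with half-braidings. -/
def homEquiv (X Y : Center C) : (X ⟶ Y) ≃ homAddSubgroup X Y where
  toFun f := ⟨f.f, f.comm⟩
  invFun f := ⟨f.1, f.2⟩

noncomputable instance : Preadditive (Center C) where
  homGroup X Y := (homEquiv X Y).addCommGroup
  add_comp _ _ _ f g h := Center.ext _ _ (Preadditive.add_comp _ _ _ f.f g.f h.f)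
  comp_add _ _ _ f g h := Center.ext _ _ (Preadditive.comp_add _ _ _ f.f g.f h.f)

theorem add_f {X Y : Center C} (f g : X ⟶ Y) : (f + g).f = f.f + g.f := rfl

instance : MonoidalPreadditive (Center C) where
  whiskerLeft_zero := Center.ext _ _ MonoidalPreadditive.whiskerLeft_zero
  zero_whiskerRight := Center.ext _ _ MonoidalPreadditive.zero_whiskerRight
  whiskerLeft_add f g := Center.ext _ _ (MonoidalPreadditive.whiskerLeft_add f.f g.f)
  add_whiskerRight f g := Center.ext _ _ (MonoidalPreadditive.add_whiskerRight f.f g.f)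

variable {k : Type w} [Field k] [Linear k C] [MonoidalLinear k C]

theorem comm_smul {X Y : C} (a : HalfBraiding X) (b : HalfBraiding Y) {f : X ⟶ Y}
    (U : C) (r : k) (hf : (f ▷ U) ≫ (b.β U).hom = (a.β U).hom ≫ (U ◁ f)) :
    ((r • f) ▷ U) ≫ (b.β U).hom = (a.β U).hom ≫ (U ◁ (r • f)) := by
  simp [hf]

noncomputable instance : Linear k (Center C) where
  homModule X Y :=
    letI : SMul k (X ⟶ Y) :=
      ⟨fun r f => { f := r • f.f, comm := fun U => comm_smul X.2 Y.2 U r (f.comm U) }⟩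
    Function.Injective.module k
    (⟨⟨fun f => f.f, rfl⟩, fun _ _ => rfl⟩ : (X ⟶ Y) →+ (X.1 ⟶ Y.1))
    (fun f g h => Center.ext f g h) (fun _ _ => rfl)
  smul_comp _ _ _ r f g := Center.ext _ _ (Linear.smul_comp _ _ _ r f.f g.f)
  comp_smul _ _ _ f r g := Center.ext _ _ (Linear.comp_smul _ _ _ f.f r g.f)

instance : MonoidalLinear k (Center C) where
  whiskerLeft_smul X _ _ r f := Center.ext _ _ (MonoidalLinear.whiskerLeft_smul X.1 r f.f)
  smul_whiskerRight r _ _ f X := Center.ext _ _ (MonoidalLinear.smul_whiskerRight r f.f X.1)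

end Center
end CenterLinear

section ModLinear
variable {E : Type u} [Category.{v} E] [Preadditive E] [MonoidalCategory E]
  [MonoidalPreadditive E] {A : E} [MonObj A]
open scoped MonoidalLeftAction

namespace Mod

/-- The module morphisms form a subgroup of the morphisms of `E`. -/
def homAddSubgroup (M N : Mod E A) : AddSubgroup (M.X ⟶ N.X) where
  carrier := {f | γ[A, M.X] ≫ f = A ◁ f ≫ γ[A, N.X]}
  zero_mem' := by simp
  add_mem' := fun {f g} hf hg => by
    simp only [Set.mem_ofPred_eq] at *
    simp [hf, hg]
  neg_mem' := fun {f} hf => by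
    simp only [Set.mem_ofPred_eq] at *
    simp [hf, whiskerLeft_neg']

/-- Morphisms of modules, as morphisms compatible with the actions. -/
def homEquiv (M N : Mod E A) : (M ⟶ N) ≃ homAddSubgroup M N where
  toFun f := ⟨f.hom, IsModHom.smul_hom⟩
  invFun f := Mod.Hom.mk' f.1 f.2

noncomputable instance : Preadditive (Mod E A) where
  homGroup M N := (homEquiv M N).addCommGroup
  add_comp _ _ _ f g h := Mod.hom_ext _ _ (Preadditive.add_comp _ _ _ f.hom g.hom h.hom)
  comp_add _ _ _ f g h := Mod.hom_ext _ _ (Preadditive.comp_add _ _ _ f.hom g.hom h.hom)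

variable {k : Type w} [Field k] [Linear k E] [MonoidalLinear k E]

theorem smul_mem {M N : Mod E A} (r : k) {f : M.X ⟶ N.X} (hf : γ[A, M.X] ≫ f = A ◁ f ≫ γ[A, N.X]) :
   γ[A, M.X] ≫ (r • f) = A ◁ (r • f) ≫ γ[A, N.X] := by simp [hf]

noncomputable instance : Linear k (Mod E A) where
  homModule M N :=
    letI : SMul k (M ⟶ N) :=
      ⟨fun r f => Mod.Hom.mk' (r • f.hom) (smul_mem r (homEquiv M N f).2)⟩
    Function.Injective.module k
    (⟨⟨fun f => f.hom, rfl⟩, fun _ _ => rfl⟩ : (M ⟶ N) →+ (M.X ⟶ N.X))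
    (fun f g h => Mod.hom_ext f g h) (fun _ _ => rfl)
  smul_comp _ _ _ r f g := Mod.hom_ext _ _ (Linear.smul_comp _ _ _ r f.hom g.hom)
  comp_smul _ _ _ f r g := Mod.hom_ext _ _ (Linear.comp_smul _ _ _ f.hom r g.hom)

/-- The free left `A`-module `A ⊗ z`. -/
@[simps]
noncomputable def free (A : E) [MonObj A] (z : E) : Mod E A :=
  letI : ModObj A (A ⊗ z) :=
    { smul := (α_ A A z).inv ≫ μ[A] ▷ z
      one_smul := by
        simp [← comp_whiskerRight]
      mul_smul := by
        have h : (α_ (A ⊗ A) A z).inv ≫ (μ[A] ▷ A ≫ μ[A]) ▷ z =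
            (α_ A A (A ⊗ z)).hom ≫ A ◁ ((α_ A A z).inv ≫ μ[A] ▷ z) ≫
              (α_ A A z).inv ≫ μ[A] ▷ z := by
          rw [MonObj.mul_assoc]
          monoidal
        simpa [-MonObj.mul_assoc] using h }
  ⟨A ⊗ z⟩
end Mod
end ModLinear
/-! ### Composition of tube diagrams -/

section TubeComposition
variable {C : Type u} [Category.{v} C] [MonoidalCategory C]

/-- Stacking of two tube diagrams: `g` below, `f` on top. The `A`-string of `g` crosses the string
`c` through the half-braiding of `A`, and is then multiplied with the `A`-string of `f`. -/
def tubeComp {A : C} (b : HalfBraiding A) (m : A ⊗ A ⟶ A) {Y c c' d d' : C}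
    (f : c ⊗ Y ⟶ A ⊗ (Y ⊗ c')) (g : d ⊗ Y ⟶ A ⊗ (Y ⊗ d')) :
    (c ⊗ d) ⊗ Y ⟶ A ⊗ (Y ⊗ (c' ⊗ d')) :=
  (α_ c d Y).hom ≫ c ◁ g ≫ (α_ c A (Y ⊗ d')).inv ≫ (b.β c).inv ▷ (Y ⊗ d') ≫
    (α_ A c (Y ⊗ d')).hom ≫ A ◁ (α_ c Y d').inv ≫ A ◁ (f ▷ d') ≫
    A ◁ (α_ A (Y ⊗ c') d').hom ≫ (α_ A A ((Y ⊗ c') ⊗ d')).inv ≫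
    m ▷ ((Y ⊗ c') ⊗ d') ≫ A ◁ (α_ Y c' d').hom

theorem HalfBraiding.inv_tensor {A : C} (b : HalfBraiding A) (c d : C) :
    (b.β (c ⊗ d)).inv = (α_ c d A).hom ≫ c ◁ (b.β d).inv ≫ (α_ c A d).inv ≫
      (b.β c).inv ▷ d ≫ (α_ A c d).hom := by
  rw [← cancel_mono (b.β (c ⊗ d)).hom, Iso.inv_hom_id, b.monoidal]
  simp

theorem HalfBraiding.inv_nat {A : C} (b : HalfBraiding A) {c d : C} (u : c ⟶ d) :
    u ▷ A ≫ (b.β d).inv = (b.β c).inv ≫ A ◁ u := by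
  rw [Iso.comp_inv_eq, Category.assoc, b.naturality, Iso.inv_hom_id_assoc]

theorem HalfBraiding.inv_unit {A : C} (b : HalfBraiding A) :
    (b.β (𝟙_ C)).inv = (λ_ A).hom ≫ (ρ_ A).inv := by
  have h : (b.β (𝟙_ C)).hom = (ρ_ A).hom ≫ (λ_ A).inv := by
    have h1 := b.naturality (λ_ (𝟙_ C)).hom
    rw [b.monoidal] at h1
    have h2 : (A ◁ (λ_ (𝟙_ C)).hom) ≫ (b.β (𝟙_ C)).hom =
        ((α_ _ _ _).inv ≫ (b.β (𝟙_ C)).hom ▷ 𝟙_ C ≫ (ρ_ _).hom ≫ (λ_ _).hom ≫ (ρ_ _).inv) ≫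
           (b.β (𝟙_ C)).hom := by
      rw [h1]
      simp only [Category.assoc]
      have : 𝟙_ C ◁ (b.β (𝟙_ C)).hom = (λ_ _).hom ≫ (b.β (𝟙_ C)).hom ≫ (λ_ _).inv := by simp
      rw [this]
      have e : (ρ_ (𝟙_ C ⊗ A)).hom ≫ (λ_ A).hom ≫ (ρ_ A).inv =
         (α_ (𝟙_ C) A (𝟙_ C)).hom ≫ (λ_ (A ⊗ 𝟙_ C)).hom := by monoidal
      rw [reassoc_of% e]
      simp
    rw [cancel_mono] at h2
    have h3 : (b.β (𝟙_ C)).hom ▷ 𝟙_ C = (ρ_ _).hom ≫ (b.β (𝟙_ C)).hom ≫ (ρ_ _).inv := by simp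
    rw [h3] at h2
    have h4 : (b.β (𝟙_ C)).hom = ((ρ_ _).inv ≫ (α_ _ _ _).hom ≫ (A ◁ (λ_ (𝟙_ C)).hom)) ≫
        (ρ_ _).hom ≫ (λ_ _).inv := by
      rw [Category.assoc, Category.assoc, h2]
      simp
    rw [h4]
    monoidal
  rw [← cancel_mono (b.β (𝟙_ C)).hom, Iso.inv_hom_id, h]
  simp

theorem tubeComp_nat_left {A : C} (b : HalfBraiding A) (m : A ⊗ A ⟶ A) {Y c₁ c₂ c₃ c₄ d d' : C}
    (u : c₁ ⟶ c₂) (f : c₂ ⊗ Y ⟶ A ⊗ (Y ⊗ c₃)) (u' : c₃ ⟶ c₄) (g : d ⊗ Y ⟶ A ⊗ (Y ⊗ d')) :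
    tubeComp b m (u ▷ Y ≫ f ≫ A ◁ (Y ◁ u')) g =
      (u ▷ d) ▷ Y ≫ tubeComp b m f g ≫ A ◁ (Y ◁ (u' ▷ d')) := by
  calc
    _ = 𝟙 _ ⊗≫ c₁ ◁ g ⊗≫ ((b.β c₁).inv ≫ A ◁ u) ▷ (Y ⊗ d') ⊗≫ A ◁ f ▷ d' ⊗≫
          ((A ⊗ A) ◁ ((Y ◁ u') ▷ d') ≫ m ▷ ((Y ⊗ c₄) ⊗ d')) ⊗≫ 𝟙 _ := by
      unfold tubeComp
      monoidal
    _ = 𝟙 _ ⊗≫ (c₁ ◁ g ≫ u ▷ (A ⊗ (Y ⊗ d'))) ⊗≫ (b.β c₂).inv ▷ (Y ⊗ d') ⊗≫ A ◁ f ▷ d' ⊗≫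
          m ▷ ((Y ⊗ c₃) ⊗ d') ⊗≫ A ◁ ((Y ◁ u') ▷ d') ⊗≫ 𝟙 _ := by
      rw [← b.inv_nat, whisker_exchange m]
      monoidal
    _ = _ := by
      rw [whisker_exchange]
      unfold tubeComp
      monoidal

theorem tubeComp_nat_right {A : C} (b : HalfBraiding A) (m : A ⊗ A ⟶ A) {Y c c' d₁ d₂ d₃ d₄ : C}
    (f : c ⊗ Y ⟶ A ⊗ (Y ⊗ c')) (w : d₁ ⟶ d₂) (g : d₂ ⊗ Y ⟶ A ⊗ (Y ⊗ d₃)) (w' : d₃ ⟶ d₄) :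
    tubeComp b m f (w ▷ Y ≫ g ≫ A ◁ (Y ◁ w')) =
      (c ◁ w) ▷ Y ≫ tubeComp b m f g ≫ A ◁ (Y ◁ (c' ◁ w')) := by
  calc
    _ = 𝟙 _ ⊗≫ c ◁ w ▷ Y ⊗≫ c ◁ g ⊗≫ ((c ⊗ A) ◁ (Y ◁ w') ≫ (b.β c).inv ▷ (Y ⊗ d₄)) ⊗≫
          A ◁ f ▷ d₄ ⊗≫ m ▷ ((Y ⊗ c') ⊗ d₄) ⊗≫ 𝟙 _ := by
      unfold tubeComp
      monoidal
    _ = 𝟙 _ ⊗≫ c ◁ w ▷ Y ⊗≫ c ◁ g ⊗≫ (b.β c).inv ▷ (Y ⊗ d₃) ⊗≫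
          A ◁ ((c ⊗ Y) ◁ w' ≫ f ▷ d₄) ⊗≫ m ▷ ((Y ⊗ c') ⊗ d₄) ⊗≫ 𝟙 _ := by
      rw [whisker_exchange]
      monoidal
    _ = 𝟙 _ ⊗≫ c ◁ w ▷ Y ⊗≫ c ◁ g ⊗≫ (b.β c).inv ▷ (Y ⊗ d₃) ⊗≫
          A ◁ f ▷ d₃ ⊗≫ ((A ⊗ A) ◁ ((Y ⊗ c') ◁ w') ≫ m ▷ ((Y ⊗ c') ⊗ d₄)) ⊗≫ 𝟙 _ := by
      rw [whisker_exchange f]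
      monoidal
    _ = _ := by
      rw [whisker_exchange m]
      unfold tubeComp
      monoidal

theorem tubeComp_assoc {A : C} (b : HalfBraiding A) (m : A ⊗ A ⟶ A) 
    (hm : m ▷ A ≫ m = (α_ A A A).hom ≫ A ◁ m ≫ m)
    (hb : ∀ c, c ◁ m ≫ (b.β c).inv = (α_ c A A).inv ≫ (b.β c).inv ▷ A ≫ (α_ A c A).hom ≫
       A ◁ (b.β c).inv ≫ (α_ A A c).inv ≫ m ▷ c)
    {Y c d e c' d' e' : C}
    (f : c ⊗ Y ⟶ A ⊗ (Y ⊗ c')) (g : d ⊗ Y ⟶ A ⊗ (Y ⊗ d')) (h : e ⊗ Y ⟶ A ⊗ (Y ⊗ e')) :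
    tubeComp b m (tubeComp b m f g) h ≫ A ◁ (Y ◁ (α_ c' d' e').hom) =
     (α_ c d e).hom ▷ Y ≫ tubeComp b m f (tubeComp b m g h) := by
  calc
    _ = 𝟙 _ ⊗≫ (c ⊗ d) ◁ h ⊗≫ c ◁ (b.β d).inv ▷ (Y ⊗ e') ⊗≫
        ((b.β c).inv ▷ (d ⊗ Y) ≫ (A ⊗ c) ◁ g) ▷ e' ⊗≫
        A ◁ (b.β c).inv ▷ ((Y ⊗ d') ⊗ e') ⊗≫
        A ◁ A ◁ (f ▷ d') ▷ e' ⊗≫ (A ◁ m ≫ m) ▷ (Y ⊗ (c' ⊗ (d' ⊗ e'))) ⊗≫ 𝟙 _ := by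
      unfold tubeComp
      rw [b.inv_tensor]
      monoidal
    _ = 𝟙 _ ⊗≫ (c ⊗ d) ◁ h ⊗≫ c ◁ (b.β d).inv ▷ (Y ⊗ e') ⊗≫
        ((c ⊗ A) ◁ g ≫ (b.β c).inv ▷ _) ▷ e' ⊗≫
        A ◁ (b.β c).inv ▷ ((Y ⊗ d') ⊗ e') ⊗≫
        (A ⊗ A) ◁ (f ▷ (d' ⊗ e')) ⊗≫ (m ▷ A ≫ m) ▷ (Y ⊗ (c' ⊗ (d' ⊗ e'))) ⊗≫ 𝟙 _ := by
      rw [whisker_exchange, hm]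
      monoidal
    _ = 𝟙 _ ⊗≫ (c ⊗ d) ◁ h ⊗≫ c ◁ (b.β d).inv ▷ (Y ⊗ e') ⊗≫
        ((c ⊗ A) ◁ g ≫ (b.β c).inv ▷ _) ▷ e' ⊗≫
        A ◁ (b.β c).inv ▷ ((Y ⊗ d') ⊗ e') ⊗≫
        ((A ⊗ A) ◁ (f ▷ (d' ⊗ e')) ≫ m ▷ ((A ⊗ (Y ⊗ c')) ⊗ (d' ⊗ e'))) ⊗≫
          m ▷ (Y ⊗ (c' ⊗ (d' ⊗ e'))) ⊗≫ 𝟙 _ := by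
      monoidal
    _ = 𝟙 _ ⊗≫ (c ⊗ d) ◁ h ⊗≫ c ◁ (b.β d).inv ▷ (Y ⊗ e') ⊗≫ (c ⊗ A) ◁ (g ▷ e') ⊗≫ 
        ((α_ c A A).inv ≫ (b.β c).inv ▷ A ≫ (α_ A c A).hom ≫
         A ◁ (b.β c).inv ≫ (α_ A A c).inv ≫ m ▷ c) ▷ (Y ⊗ (d' ⊗ e')) ⊗≫
        A ◁ (f ▷ (d' ⊗ e')) ⊗≫ m ▷ (Y ⊗ (c' ⊗ (d' ⊗ e'))) ⊗≫ 𝟙 _ := by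
      rw [whisker_exchange m]
      monoidal
    _ = 𝟙 _ ⊗≫ (c ⊗ d) ◁ h ⊗≫ c ◁ (b.β d).inv ▷ (Y ⊗ e') ⊗≫
        c ◁ (A ◁ (g ▷ e') ⊗≫ m ▷ (Y ⊗ (d' ⊗ e'))) ⊗≫ (b.β c).inv ▷ (Y ⊗ (d' ⊗ e')) ⊗≫
        A ◁ (f ▷ (d' ⊗ e')) ⊗≫ m ▷ (Y ⊗ (c' ⊗ (d' ⊗ e'))) ⊗≫ 𝟙 _ := by
      rw [← hb]
      monoidal
    _ = _ := by
      unfold tubeComp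
      monoidal

/-- The tube diagram with no string around the tube and the `A`-string created by `i`. -/
def tubeUnit {A : C} (i : 𝟙_ C ⟶ A) (Y : C) : 𝟙_ C ⊗ Y ⟶ A ⊗ (Y ⊗ 𝟙_ C) :=
  i ▷ Y ≫ A ◁ (ρ_ Y).inv

theorem tubeUnit_comp {A : C} (b : HalfBraiding A) (m : A ⊗ A ⟶ A) (i : 𝟙_ C ⟶ A)
    (hi : A ◁ i ≫ m = (ρ_ A).hom) {Y d d' : C} (g : d ⊗ Y ⟶ A ⊗ (Y ⊗ d')) :
    tubeComp b m (tubeUnit i Y) g ≫ A ◁ (Y ◁ (λ_ d').hom) = (λ_ d).hom ▷ Y ≫ g := by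
  calc
    _ = 𝟙 _ ⊗≫ g ⊗≫ (A ◁ i ≫ m) ▷ (Y ⊗ d') ⊗≫ 𝟙 _ := by
      unfold tubeComp tubeUnit
      rw [b.inv_unit]
      monoidal
    _ = _ := by rw [hi]; monoidal

theorem tubeComp_unit {A : C} (b : HalfBraiding A) (m : A ⊗ A ⟶ A) (i : 𝟙_ C ⟶ A)
    (hi : i ▷ A ≫ m = (λ_ A).hom)
    (hb : ∀ c, c ◁ i ≫ (b.β c).inv = (ρ_ c).hom ≫ (λ_ c).inv ≫ i ▷ c)
    {Y c c' : C} (f : c ⊗ Y ⟶ A ⊗ (Y ⊗ c')) :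
    tubeComp b m f (tubeUnit i Y) ≫ A ◁ (Y ◁ (ρ_ c').hom) = (ρ_ c).hom ▷ Y ≫ f := by
  calc
    _ = 𝟙 _ ⊗≫ (c ◁ i ≫ (b.β c).inv) ▷ Y ⊗≫ A ◁ f ⊗≫ m ▷ (Y ⊗ c') ⊗≫ 𝟙 _ := by
      unfold tubeComp tubeUnit
      monoidal
    _ = 𝟙 _ ⊗≫ (i ▷ (c ⊗ Y) ≫ A ◁ f) ⊗≫ m ▷ (Y ⊗ c') ⊗≫ 𝟙 _ := by
      rw [hb]; monoidal
    _ = 𝟙 _ ⊗≫ f ⊗≫ (i ▷ A ≫ m) ▷ (Y ⊗ c') ⊗≫ 𝟙 _ := by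
      rw [← whisker_exchange]; monoidal
    _ = _ := by rw [hi]; monoidal

theorem tubeComp_nat {A : C} (b : HalfBraiding A) (m : A ⊗ A ⟶ A) {Y c₁ c₂ c₃ c₄ d₁ d₂ d₃ d₄ : C}
    (u : c₁ ⟶ c₂) (f : c₂ ⊗ Y ⟶ A ⊗ (Y ⊗ c₃)) (u' : c₃ ⟶ c₄)
    (w : d₁ ⟶ d₂) (g : d₂ ⊗ Y ⟶ A ⊗ (Y ⊗ d₃)) (w' : d₃ ⟶ d₄) :
    tubeComp b m (u ▷ Y ≫ f ≫ A ◁ (Y ◁ u')) (w ▷ Y ≫ g ≫ A ◁ (Y ◁ w')) =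
      (u ⊗ₘ w) ▷ Y ≫ tubeComp b m f g ≫ A ◁ (Y ◁ (u' ⊗ₘ w')) := by
  rw [tubeComp_nat_left, tubeComp_nat_right, MonoidalCategory.tensorHom_def u w,
    MonoidalCategory.tensorHom_def' u' w']
  simp only [comp_whiskerRight, MonoidalCategory.whiskerLeft_comp, Category.assoc]

theorem comm_inv_aux {A : C} (b : HalfBraiding A) {m : A ⊗ A ⟶ A} (c : C)
    (h : m ▷ c ≫ (b.β c).hom = ((α_ A A c).hom ≫ A ◁ (b.β c).hom ≫
      (α_ A c A).inv ≫ (b.β c).hom ▷ A ≫ (α_ c A A).hom) ≫ c ◁ m) :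
    c ◁ m ≫ (b.β c).inv = (α_ c A A).inv ≫ (b.β c).inv ▷ A ≫ (α_ A c A).hom ≫
       A ◁ (b.β c).inv ≫ (α_ A A c).inv ≫ m ▷ c := by
  rw [Iso.comp_inv_eq]
  simp only [Category.assoc, h, Iso.inv_hom_id_assoc]
  simp

theorem comm_inv_aux' {A : C} (b : HalfBraiding A) {i : 𝟙_ C ⟶ A} (c : C)
    (h : i ▷ c ≫ (b.β c).hom = ((λ_ c).hom ≫ (ρ_ c).inv) ≫ c ◁ i) :
    c ◁ i ≫ (b.β c).inv = (ρ_ c).hom ≫ (λ_ c).inv ≫ i ▷ c := by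
  rw [Iso.comp_inv_eq]
  simp [h]

section Linear

variable [Preadditive C] [MonoidalPreadditive C]

theorem tubeComp_add {A : C} (b : HalfBraiding A) (m : A ⊗ A ⟶ A) {Y c c' d d' : C}
    (f : c ⊗ Y ⟶ A ⊗ (Y ⊗ c')) (g h : d ⊗ Y ⟶ A ⊗ (Y ⊗ d')) :
    tubeComp b m f (g + h) = tubeComp b m f g + tubeComp b m f h := by
  simp [tubeComp]

theorem add_tubeComp {A : C} (b : HalfBraiding A) (m : A ⊗ A ⟶ A) {Y c c' d d' : C}
    (f g : c ⊗ Y ⟶ A ⊗ (Y ⊗ c')) (h : d ⊗ Y ⟶ A ⊗ (Y ⊗ d')) :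
    tubeComp b m (f + g) h = tubeComp b m f h + tubeComp b m g h := by
  simp [tubeComp]

variable {k : Type w} [Field k] [Linear k C] [MonoidalLinear k C]

theorem tubeComp_smul {A : C} (b : HalfBraiding A) (m : A ⊗ A ⟶ A) {Y c c' d d' : C} (r : k)
    (f : c ⊗ Y ⟶ A ⊗ (Y ⊗ c')) (g : d ⊗ Y ⟶ A ⊗ (Y ⊗ d')) :
    tubeComp b m f (r • g) = r • tubeComp b m f g := by
  simp [tubeComp]

theorem smul_tubeComp {A : C} (b : HalfBraiding A) (m : A ⊗ A ⟶ A) {Y c c' d d' : C} (r : k)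
    (f : c ⊗ Y ⟶ A ⊗ (Y ⊗ c')) (g : d ⊗ Y ⟶ A ⊗ (Y ⊗ d')) :
    tubeComp b m (r • f) g = r • tubeComp b m f g := by
  simp [tubeComp]

end Linear

end TubeComposition

/-! ### Unitary fusion categories -/

/-- A dagger structure on a category. -/
class DaggerCategory (C : Type u) [Category.{v} C] where
  /-- The adjoint of a morphism. -/
  dag : ∀ {X Y : C}, (X ⟶ Y) → (Y ⟶ X)
  dag_dag : ∀ {X Y : C} (f : X ⟶ Y), dag (dag f) = f
  dag_id : ∀ X : C, dag (𝟙 X) = 𝟙 X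
  dag_comp : ∀ {X Y Z : C} (f : X ⟶ Y) (g : Y ⟶ Z), dag (f ≫ g) = dag g ≫ dag f

open DaggerCategory

/-- A unitary fusion category: a semisimple rigid `ℂ`-linear monoidal category with
finite-dimensional morphism spaces, finitely many isomorphism classes of simple objects and simple
unit object, equipped with a conjugate-linear monoidal dagger structure which makes it a
C*-category. As morphism spaces are finite-dimensional, the C*-condition amounts to the conditions
`dag_definite` (`f† f = 0` implies `f = 0`) and `dag_positive` (`f† f` is a positive element of the
endomorphism algebra of the source of `f`). -/
class UnitaryFusionCategory (C : Type u) [Category.{v} C] [Abelian C] [Linear ℂ C]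
    [MonoidalCategory C] [MonoidalPreadditive C] [MonoidalLinear ℂ C] [RigidCategory C]
    [DaggerCategory C] : Prop where
  finite_hom : ∀ X Y : C, Module.Finite ℂ (X ⟶ Y)
  simple_unit : Simple (𝟙_ C)
  semisimple : haveI := Abelian.hasFiniteBiproducts (C := C)
    ∀ X : C, ∃ (n : ℕ) (S : Fin n → C), (∀ k, Simple (S k)) ∧ Nonempty (X ≅ ⨁ S)
  finite_simple : ∃ (n : ℕ) (S : Fin n → C), ∀ X : C, Simple X → ∃ k, Nonempty (X ≅ S k)
  dag_add : ∀ {X Y : C} (f g : X ⟶ Y), dag (f + g) = dag f + dag g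
  dag_smul : ∀ {X Y : C} (r : ℂ) (f : X ⟶ Y), dag (r • f) = (starRingEnd ℂ r) • dag f
  dag_definite : ∀ {X Y : C} (f : X ⟶ Y), f ≫ dag f = 0 → f = 0
  dag_positive : ∀ {X Y : C} (f : X ⟶ Y), ∃ g : X ⟶ X, f ≫ dag f = g ≫ dag g
  dag_tensor : ∀ {X₁ Y₁ X₂ Y₂ : C} (f : X₁ ⟶ Y₁) (g : X₂ ⟶ Y₂), dag (f ⊗ₘ g) = dag f ⊗ₘ dag g
  dag_associator : ∀ X Y Z : C, dag (α_ X Y Z).hom = (α_ X Y Z).inv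
  dag_leftUnitor : ∀ X : C, dag (λ_ X).hom = (λ_ X).inv
  dag_rightUnitor : ∀ X : C, dag (ρ_ X).hom = (ρ_ X).inv

/-- A set of representatives of the isomorphism classes of simple objects. -/
structure SimpleReps (C : Type u) [Category.{v} C] [Abelian C] (J : Type w) where
  /-- The representatives. -/
  obj : J → C
  simple : ∀ i, Simple (obj i)
  eq_of_iso : ∀ i j, Nonempty (obj i ≅ obj j) → i = j
  exists_iso : ∀ X : C, Simple X → ∃ i, Nonempty (X ≅ obj i)

/-- The direct sum of all representatives of simple objects. -/
noncomputable def SimpleReps.sum {C : Type u} [Category.{v} C] [Abelian C] {J : Type w}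
    [Fintype J] (irr : SimpleReps C J) : C :=
  haveI := Abelian.hasFiniteBiproducts (C := C)
  ⨁ irr.obj

/-- The unitary dual of a simple object `x`: a dual object `x̄` with duality morphisms
`𝟙 ⟶ x̄ ⊗ x` and `x ⊗ x̄ ⟶ 𝟙` normalized so that both loops have the same value
(which is then the quantum dimension of `x`). -/
structure BalancedDual {C : Type u} [Category.{v} C] [MonoidalCategory C] [DaggerCategory C]
    (x : C) where
  /-- The dual object. -/
  dual : C
  /-- The duality morphisms. -/
  pairing : ExactPairing dual x
  balanced : η_ dual x ≫ dag (η_ dual x) = dag (ε_ dual x) ≫ ε_ dual x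

/-- The partial trace of a morphism `x ⊗ y ⟶ x ⊗ k`, closing up the string `x` on the left. -/
noncomputable def BalancedDual.partialTrace {C : Type u} [Category.{v} C] [MonoidalCategory C]
    [DaggerCategory C] {x : C} (D : BalancedDual x) {y k : C} (h : x ⊗ y ⟶ x ⊗ k) : y ⟶ k :=
  letI := D.pairing
  (λ_ y).inv ≫ (η_ D.dual x) ▷ y ≫ (α_ D.dual x y).hom ≫ D.dual ◁ h ≫
    (α_ D.dual x k).inv ≫ (dag (η_ D.dual x)) ▷ k ≫ (λ_ k).hom

section Fusion

variable {C : Type u} [Category.{v} C] [Abelian C] {J : Type w}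

/-- A resolution of the identity of an object `c` by simple objects: morphisms
`a k : x ⟶ c` and `b k : c ⟶ x`, with `x` running through the representatives of simple objects,
such that `∑ k, a k ∘ b k = 𝟙 c` and `b k ∘ a l = δ_{kl}`. Thus, for every `x`, the `b k` with
target `x` form a basis of `c ⟶ x`, and the corresponding `a k` form the dual basis of `x ⟶ c`
(in a unitary category one can take an orthonormal basis and its adjoint). -/
structure Resolution (irr : SimpleReps C J) (c : C) where
  /-- The number of summands. -/
  n : ℕ
  /-- The types of the summands. -/
  t : Fin n → J
  /-- The inclusions of the summands. -/
  a : ∀ k, irr.obj (t k) ⟶ c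
  /-- The projections on the summands. -/
  b : ∀ k, c ⟶ irr.obj (t k)
  complete : ∑ k, b k ≫ a k = 𝟙 c
  orthonormal : ∀ k, a k ≫ b k = 𝟙 _
  orthogonal : ∀ k l, k ≠ l → a k ≫ b l = 0

variable [Linear ℂ C] [MonoidalCategory C] [MonoidalPreadditive C] [MonoidalLinear ℂ C]
  [RigidCategory C] [DaggerCategory C] [UnitaryFusionCategory C]

theorem Resolution.nonempty (irr : SimpleReps C J) (c : C) : Nonempty (Resolution irr c) := by
  have := Abelian.hasFiniteBiproducts (C := C)
  obtain ⟨n, S, hS, ⟨e⟩⟩ := UnitaryFusionCategory.semisimple c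
  choose t ht using fun k => irr.exists_iso (S k) (hS k)
  let i : ∀ k, S k ≅ irr.obj (t k) := fun k => (ht k).some
  refine ⟨⟨n, t, fun k => (i k).inv ≫ Limits.biproduct.ι S k ≫ e.inv,
    fun k => e.hom ≫ Limits.biproduct.π S k ≫ (i k).hom, ?_, ?_, ?_⟩⟩
  · have h : ∀ k, (e.hom ≫ Limits.biproduct.π S k ≫ (i k).hom) ≫
        (i k).inv ≫ Limits.biproduct.ι S k ≫ e.inv =
        e.hom ≫ (Limits.biproduct.π S k ≫ Limits.biproduct.ι S k) ≫ e.inv := by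
      intro k; simp
    simp only [h, ← Preadditive.comp_sum, ← Preadditive.sum_comp, Limits.biproduct.total]
    simp
  · intro k; simp
  · intro k l hkl
    simp [Limits.biproduct.ι_π_ne_assoc S hkl]

/-- A chosen resolution of the identity of `c`. -/
noncomputable def resolution (irr : SimpleReps C J) (c : C) : Resolution irr c :=
  (Resolution.nonempty irr c).some

variable [Fintype J]

/-- The underlying vector space of the `A`-tube algebra:
`⨁_{x ∈ Irr} C(x ⊗ Y → A ⊗ Y ⊗ x)`, where `Y = ⨁_{x ∈ Irr} x`. -/
def Tube (irr : SimpleReps C J) (A : Center C) : Type (max v w) :=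
  ∀ i : J, irr.obj i ⊗ irr.sum ⟶ A.1 ⊗ (irr.sum ⊗ irr.obj i)

namespace Tube

variable {irr : SimpleReps C J} {A : Center C}

noncomputable instance : AddCommGroup (Tube irr A) :=
  inferInstanceAs (AddCommGroup (∀ i : J, irr.obj i ⊗ irr.sum ⟶ A.1 ⊗ (irr.sum ⊗ irr.obj i)))

noncomputable instance : Module ℂ (Tube irr A) :=
  inferInstanceAs (Module ℂ (∀ i : J, irr.obj i ⊗ irr.sum ⟶ A.1 ⊗ (irr.sum ⊗ irr.obj i)))

open Classical in
/-- The element of the tube algebra concentrated in the summand of a simple object. -/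
noncomputable def single (i : J) (f : irr.obj i ⊗ irr.sum ⟶ A.1 ⊗ (irr.sum ⊗ irr.obj i)) :
    Tube irr A := Pi.single i f

/-- The element of the tube algebra given by a tube diagram with a string labelled by an
arbitrary object `c` around the tube: resolve the string into simple objects. -/
noncomputable def of (c : C) (f : c ⊗ irr.sum ⟶ A.1 ⊗ (irr.sum ⊗ c)) : Tube irr A :=
  ∑ k, single ((resolution irr c).t k)
    ((resolution irr c).a k ▷ irr.sum ≫ f ≫ A.1 ◁ (irr.sum ◁ (resolution irr c).b k))

theorem single_add (i : J) (f g : irr.obj i ⊗ irr.sum ⟶ A.1 ⊗ (irr.sum ⊗ irr.obj i)) :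
    (single i (f + g) : Tube irr A) = single i f + single i g := by
  classical exact map_add (LinearMap.single ℂ
    (fun i : J => (irr.obj i ⊗ irr.sum ⟶ A.1 ⊗ (irr.sum ⊗ irr.obj i))) i) f g

theorem single_smul (i : J) (r : ℂ) (f : irr.obj i ⊗ irr.sum ⟶ A.1 ⊗ (irr.sum ⊗ irr.obj i)) :
    (single i (r • f) : Tube irr A) = r • single i f := by
  classical exact map_smul (LinearMap.single ℂ
    (fun i : J => (irr.obj i ⊗ irr.sum ⟶ A.1 ⊗ (irr.sum ⊗ irr.obj i))) i) r f

theorem single_zero (i : J) :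
    (single i (0 : irr.obj i ⊗ irr.sum ⟶ A.1 ⊗ (irr.sum ⊗ irr.obj i)) : Tube irr A) = 0 := by
  classical exact Pi.single_zero i

/-- `single` as a linear map. -/
noncomputable def singleHom (i : J) :
    (irr.obj i ⊗ irr.sum ⟶ A.1 ⊗ (irr.sum ⊗ irr.obj i)) →ₗ[ℂ] Tube irr A where
  toFun := single i
  map_add' := single_add i
  map_smul' r f := single_smul i r f

theorem single_sum (i : J) {κ : Type*} (s : Finset κ)
    (f : κ → (irr.obj i ⊗ irr.sum ⟶ A.1 ⊗ (irr.sum ⊗ irr.obj i))) :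
    (single i (∑ k ∈ s, f k) : Tube irr A) = ∑ k ∈ s, single i (f k) :=
  map_sum (singleHom i) f s

theorem sum_single (f : Tube irr A) : ∑ i, single i (f i) = f := by
  classical exact Finset.univ_sum_single f

theorem single_cyc (i j : J) (s : irr.obj i ⟶ irr.obj j)
    (h : irr.obj j ⊗ irr.sum ⟶ A.1 ⊗ (irr.sum ⊗ irr.obj i)) :
    (single i (s ▷ irr.sum ≫ h) : Tube irr A) = single j (h ≫ A.1 ◁ (irr.sum ◁ s)) := by
  have := irr.simple i
  have := irr.simple j
  by_cases hij : i = j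
  · subst hij
    have : FiniteDimensional ℂ (irr.obj i ⟶ irr.obj i) := UnitaryFusionCategory.finite_hom _ _
    obtain ⟨r, hr⟩ := endomorphism_simple_eq_smul_id ℂ s
    subst hr
    simp
  · have hs : s = 0 := by
      by_contra hs
      have := isIso_of_hom_simple hs
      exact hij (irr.eq_of_iso i j ⟨asIso s⟩)
    subst hs
    simp [single_zero]

theorem of_cyc {c d : C} (s : d ⟶ c) (f : c ⊗ irr.sum ⟶ A.1 ⊗ (irr.sum ⊗ d)) :
    (of d (s ▷ irr.sum ≫ f) : Tube irr A) = of c (f ≫ A.1 ◁ (irr.sum ◁ s)) := by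
  unfold of
  set R := resolution irr c
  set S := resolution irr d
  have h1 : ∀ k, S.a k ▷ irr.sum ≫ (s ▷ irr.sum ≫ f) ≫ A.1 ◁ (irr.sum ◁ S.b k) =
      ∑ l, (S.a k ≫ s ≫ R.b l) ▷ irr.sum ≫
        (R.a l ▷ irr.sum ≫ f ≫ A.1 ◁ (irr.sum ◁ S.b k)) := by
    intro k
    have : s ▷ irr.sum = ∑ l, (s ≫ R.b l) ▷ irr.sum ≫ R.a l ▷ irr.sum := by
      simp only [← comp_whiskerRight, ← sum_whiskerRight, Category.assoc, ← Preadditive.comp_sum,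
        R.complete, Category.comp_id]
    rw [this]
    simp [Preadditive.sum_comp, Preadditive.comp_sum]
  have h2 : ∀ l, R.a l ▷ irr.sum ≫ (f ≫ A.1 ◁ (irr.sum ◁ s)) ≫ A.1 ◁ (irr.sum ◁ R.b l) =
      ∑ k, (R.a l ▷ irr.sum ≫ f ≫ A.1 ◁ (irr.sum ◁ S.b k)) ≫
        A.1 ◁ (irr.sum ◁ (S.a k ≫ s ≫ R.b l)) := by
    intro l
    have : A.1 ◁ (irr.sum ◁ s) = ∑ k, A.1 ◁ (irr.sum ◁ S.b k) ≫ A.1 ◁ (irr.sum ◁ (S.a k ≫ s)) := by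
      simp only [← MonoidalCategory.whiskerLeft_comp, ← whiskerLeft_sum, ← Category.assoc,
        ← Preadditive.sum_comp, S.complete, Category.id_comp]
    rw [this]
    simp [Preadditive.sum_comp, Preadditive.comp_sum]
  simp only [h1, h2, single_sum, single_cyc]
  rw [Finset.sum_comm]

theorem of_add {c : C} (f g : c ⊗ irr.sum ⟶ A.1 ⊗ (irr.sum ⊗ c)) :
    (of c (f + g) : Tube irr A) = of c f + of c g := by
  unfold of
  simp only [Preadditive.comp_add, Preadditive.add_comp, single_add, Finset.sum_add_distrib]

theorem of_smul {c : C} (r : ℂ) (f : c ⊗ irr.sum ⟶ A.1 ⊗ (irr.sum ⊗ c)) :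
    (of c (r • f) : Tube irr A) = r • of c f := by
  unfold of
  simp only [Linear.comp_smul, Linear.smul_comp, single_smul, Finset.smul_sum]

/-- `of` as a linear map. -/
noncomputable def ofHom (c : C) :
    (c ⊗ irr.sum ⟶ A.1 ⊗ (irr.sum ⊗ c)) →ₗ[ℂ] Tube irr A where
  toFun := of c
  map_add' := of_add
  map_smul' r f := of_smul r f

theorem of_sum {c : C} {κ : Type*} (s : Finset κ)
    (f : κ → (c ⊗ irr.sum ⟶ A.1 ⊗ (irr.sum ⊗ c))) :
    (of c (∑ k ∈ s, f k) : Tube irr A) = ∑ k ∈ s, of c (f k) :=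
  map_sum (ofHom c) f s

theorem of_single (i : J) (f : irr.obj i ⊗ irr.sum ⟶ A.1 ⊗ (irr.sum ⊗ irr.obj i)) :
    (of (irr.obj i) f : Tube irr A) = single i f := by
  unfold of
  set R := resolution irr (irr.obj i)
  simp only [single_cyc, Category.assoc, ← MonoidalCategory.whiskerLeft_comp]
  rw [← single_sum, ← Preadditive.comp_sum, ← whiskerLeft_sum, ← whiskerLeft_sum, R.complete]
  simp

theorem of_iso {c d : C} (s : c ≅ d) (f : c ⊗ irr.sum ⟶ A.1 ⊗ (irr.sum ⊗ c))
    (g : d ⊗ irr.sum ⟶ A.1 ⊗ (irr.sum ⊗ d))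
    (h : f ≫ A.1 ◁ (irr.sum ◁ s.hom) = s.hom ▷ irr.sum ≫ g) :
    (of c f : Tube irr A) = of d g := by
  have : f = s.hom ▷ irr.sum ≫ g ≫ A.1 ◁ (irr.sum ◁ s.inv) := by
    rw [← reassoc_of% h, ← MonoidalCategory.whiskerLeft_comp,
      ← MonoidalCategory.whiskerLeft_comp]
    simp
  rw [this, of_cyc]
  simp [← MonoidalCategory.whiskerLeft_comp]

variable [MonObj A]

/-- The multiplication of the algebra `A`, as a morphism of `C`. -/
def mulMap (A : Center C) [MonObj A] : A.1 ⊗ A.1 ⟶ A.1 := (μ[A]).f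

/-- The unit of the algebra `A`, as a morphism of `C`. -/
def oneMap (A : Center C) [MonObj A] : 𝟙_ C ⟶ A.1 := (η[A]).f


/-- Multiplication in the tube algebra: stack the tube diagrams, and resolve the two parallel
strings around the tube into simple objects. -/
noncomputable instance : Mul (Tube irr A) where
  mul f g := ∑ i, ∑ j, of (irr.obj i ⊗ irr.obj j) (tubeComp A.2 (mulMap A) (f i) (g j))

noncomputable instance : One (Tube irr A) where
  one := of (𝟙_ C) (tubeUnit (oneMap A) irr.sum)

theorem mul_def (f g : Tube irr A) :
    f * g = ∑ i, ∑ j, of (irr.obj i ⊗ irr.obj j) (tubeComp A.2 (mulMap A) (f i) (g j)) := rfl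

theorem one_def : (1 : Tube irr A) = of (𝟙_ C) (tubeUnit (oneMap A) irr.sum) := rfl

theorem add_apply (f g : Tube irr A) (i : J) : (f + g) i = f i + g i := rfl
theorem zero_apply (i : J) : (0 : Tube irr A) i = 0 := rfl
theorem smul_apply (r : ℂ) (f : Tube irr A) (i : J) : (r • f) i = r • f i := rfl

theorem mul_add' (f g h : Tube irr A) : f * (g + h) = f * g + f * h := by
  simp only [mul_def, add_apply, tubeComp_add, of_add, Finset.sum_add_distrib]

theorem add_mul' (f g h : Tube irr A) : (f + g) * h = f * h + g * h := by
  simp only [mul_def, add_apply, add_tubeComp, of_add, Finset.sum_add_distrib]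

theorem mul_smul' (r : ℂ) (f g : Tube irr A) : f * (r • g) = r • (f * g) := by
  simp only [mul_def, smul_apply, tubeComp_smul, of_smul, Finset.smul_sum]

theorem smul_mul' (r : ℂ) (f g : Tube irr A) : (r • f) * g = r • (f * g) := by
  simp only [mul_def, smul_apply, smul_tubeComp, of_smul, Finset.smul_sum]

theorem zero_mul' (f : Tube irr A) : 0 * f = 0 := by
  simpa using smul_mul' (0 : ℂ) 0 f

theorem mul_zero' (f : Tube irr A) : f * 0 = 0 := by
  simpa using mul_smul' (0 : ℂ) f 0

theorem single_mul_single (i j : J)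
    (f : irr.obj i ⊗ irr.sum ⟶ A.1 ⊗ (irr.sum ⊗ irr.obj i))
    (g : irr.obj j ⊗ irr.sum ⟶ A.1 ⊗ (irr.sum ⊗ irr.obj j)) :
    (single i f : Tube irr A) * single j g =
      of (irr.obj i ⊗ irr.obj j) (tubeComp A.2 (mulMap A) f g) := by
  classical
  have h0 : ∀ (i' j' : J) (g' : irr.obj j' ⊗ irr.sum ⟶ A.1 ⊗ (irr.sum ⊗ irr.obj j')), 
      (of (irr.obj i' ⊗ irr.obj j') (tubeComp A.2 (mulMap A) 0 g') : Tube irr A) = 0 := by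
    intro i' j' g'
    have := smul_tubeComp A.2 (mulMap A) (0 : ℂ)
      (0 : irr.obj i' ⊗ irr.sum ⟶ A.1 ⊗ (irr.sum ⊗ irr.obj i')) g'
    rw [zero_smul, zero_smul] at this
    rw [this]; exact map_zero (ofHom _)
  have h1 : ∀ (i' j' : J) (f' : irr.obj i' ⊗ irr.sum ⟶ A.1 ⊗ (irr.sum ⊗ irr.obj i')), 
      (of (irr.obj i' ⊗ irr.obj j') (tubeComp A.2 (mulMap A) f' 0) : Tube irr A) = 0 := by
    intro i' j' f'
    have := tubeComp_smul A.2 (mulMap A) (0 : ℂ) f'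
      (0 : irr.obj j' ⊗ irr.sum ⟶ A.1 ⊗ (irr.sum ⊗ irr.obj j'))
    rw [zero_smul, zero_smul] at this
    rw [this]; exact map_zero (ofHom _)
  have hs : ∀ (i' : J) (f' : irr.obj i' ⊗ irr.sum ⟶ A.1 ⊗ (irr.sum ⊗ irr.obj i')),
      (single i' f' : Tube irr A) i' = f' := fun i' f' =>
    Pi.single_eq_same (M := fun i : J => (irr.obj i ⊗ irr.sum ⟶ A.1 ⊗ (irr.sum ⊗ irr.obj i))) i' f'
  have hn : ∀ (i' j' : J) (f' : irr.obj i' ⊗ irr.sum ⟶ A.1 ⊗ (irr.sum ⊗ irr.obj i')), j' ≠ i' →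
      (single i' f' : Tube irr A) j' = 0 := fun i' j' f' h =>
    Pi.single_eq_of_ne (M := fun i : J => (irr.obj i ⊗ irr.sum ⟶ A.1 ⊗ (irr.sum ⊗ irr.obj i))) h f'
  rw [mul_def, Finset.sum_eq_single i, Finset.sum_eq_single j, hs, hs]
  · intro k _ hk; rw [hn _ _ _ hk, h1]
  · simp
  · intro k _ hk; rw [hn _ _ _ hk]; simp only [h0, Finset.sum_const_zero]
  · simp

/-- `Tube irr A` as a non-associative ring. -/
noncomputable instance : NonUnitalNonAssocRing (Tube irr A) where
  left_distrib := mul_add'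
  right_distrib := add_mul'
  zero_mul := zero_mul'
  mul_zero := mul_zero'

theorem of_mul_of {c d : C} (f : c ⊗ irr.sum ⟶ A.1 ⊗ (irr.sum ⊗ c))
    (g : d ⊗ irr.sum ⟶ A.1 ⊗ (irr.sum ⊗ d)) :
    (of c f : Tube irr A) * of d g = of (c ⊗ d) (tubeComp A.2 (mulMap A) f g) := by
  have h : tubeComp A.2 (mulMap A) f g = ∑ k, ∑ l, tubeComp A.2 (mulMap A) f g ≫ 
      A.1 ◁ (irr.sum ◁ ((resolution irr c).b k ⊗ₘ (resolution irr d).b l)) ≫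
      A.1 ◁ (irr.sum ◁ ((resolution irr c).a k ⊗ₘ (resolution irr d).a l)) := by
    simp only [← MonoidalCategory.whiskerLeft_comp, tensorHom_comp_tensorHom,
      ← Preadditive.comp_sum, ← whiskerLeft_sum, ← tensor_sum, ← sum_tensor,
      (resolution irr c).complete, (resolution irr d).complete, id_tensorHom_id,
      whiskerLeft_id, Category.comp_id]
  conv_rhs => rw [h]
  simp only [of_sum]
  conv_lhs => unfold of
  simp only [Finset.sum_mul, Finset.mul_sum]
  rw [Finset.sum_comm]
  refine Finset.sum_congr rfl fun k _ => Finset.sum_congr rfl fun l _ => ?_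
  rw [single_mul_single, tubeComp_nat, of_cyc]
  simp only [Category.assoc]

theorem mulMap_comm (c : C) : c ◁ (mulMap A) ≫ (A.2.β c).inv =
    (α_ c A.1 A.1).inv ≫ (A.2.β c).inv ▷ A.1 ≫ (α_ A.1 c A.1).hom ≫
       A.1 ◁ (A.2.β c).inv ≫ (α_ A.1 A.1 c).inv ≫ (mulMap A) ▷ c := by
  have h : mulMap A ▷ c ≫ (A.2.β c).hom = ((α_ A.1 A.1 c).hom ≫ A.1 ◁ (A.2.β c).hom ≫
      (α_ A.1 c A.1).inv ≫ (A.2.β c).hom ▷ A.1 ≫ (α_ c A.1 A.1).hom) ≫ c ◁ mulMap A :=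
    (μ[A]).comm c
  exact comm_inv_aux A.2 _ h

theorem oneMap_comm (c : C) : c ◁ (oneMap A) ≫ (A.2.β c).inv =
    (ρ_ c).hom ≫ (λ_ c).inv ≫ (oneMap A) ▷ c := by
  have h : oneMap A ▷ c ≫ (A.2.β c).hom = ((λ_ c).hom ≫ (ρ_ c).inv) ≫ c ◁ oneMap A :=
    (η[A]).comm c
  exact comm_inv_aux' A.2 _ h

theorem mulMap_assoc : mulMap A ▷ A.1 ≫ mulMap A =
    (α_ A.1 A.1 A.1).hom ≫ A.1 ◁ mulMap A ≫ mulMap A :=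
  congrArg Center.Hom.f (MonObj.mul_assoc A)

theorem oneMap_mul : oneMap A ▷ A.1 ≫ mulMap A = (λ_ A.1).hom :=
  congrArg Center.Hom.f (MonObj.one_mul A)

theorem mul_oneMap : A.1 ◁ oneMap A ≫ mulMap A = (ρ_ A.1).hom :=
  congrArg Center.Hom.f (MonObj.mul_one A)

theorem one_mul' (f : Tube irr A) : 1 * f = f := by
  rw [← sum_single f, Finset.mul_sum]
  refine Finset.sum_congr rfl fun i _ => ?_
  rw [← of_single, one_def, of_mul_of]
  exact of_iso (λ_ _) _ _ (tubeUnit_comp A.2 (mulMap A) (oneMap A) mul_oneMap (f i))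

theorem mul_one' (f : Tube irr A) : f * 1 = f := by
  rw [← sum_single f, Finset.sum_mul]
  refine Finset.sum_congr rfl fun i _ => ?_
  rw [← of_single, one_def, of_mul_of]
  exact of_iso (ρ_ _) _ _
    (tubeComp_unit A.2 (mulMap A) (oneMap A) oneMap_mul oneMap_comm (f i))

theorem mul_assoc' (f g h : Tube irr A) : f * g * h = f * (g * h) := by
  have key : ∀ i j k, (single i (f i) * single j (g j)) * single k (h k) =
      (single i (f i) : Tube irr A) * (single j (g j) * single k (h k)) := by
    intro i j k
    simp only [← of_single, of_mul_of]
    exact of_iso (α_ _ _ _) _ _ (tubeComp_assoc A.2 (mulMap A) mulMap_assoc mulMap_comm _ _ _)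
  calc
    _ = (∑ i, single i (f i)) * (∑ j, single j (g j)) * (∑ k, single k (h k)) := by
      simp only [sum_single]
    _ = (∑ i, single i (f i)) * ((∑ j, single j (g j)) * (∑ k, single k (h k))) := by
      simp only [Finset.sum_mul, Finset.mul_sum, key]
    _ = _ := by simp only [sum_single]

noncomputable instance : Ring (Tube irr A) where
  __ := (inferInstance : NonUnitalNonAssocRing (Tube irr A))
  one_mul := one_mul'
  mul_one := mul_one'
  mul_assoc := mul_assoc'
  neg_add_cancel := neg_add_cancel
  zsmul := fun n f => n • f
  zsmul_zero' := SubNegMonoid.zsmul_zero'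
  zsmul_succ' := SubNegMonoid.zsmul_succ'
  zsmul_neg' := SubNegMonoid.zsmul_neg'

noncomputable instance : Algebra ℂ (Tube irr A) :=
  Algebra.ofModule smul_mul' mul_smul'

/-- The inclusion `i_A ⊗ -` of the tube algebra `Tube irr (𝟙_ (Center C))` of `C` into the `A`-tube
algebra: create an additional `A`-string by the unit of `A`. -/
noncomputable def incl (A : Center C) [MonObj A] (f : Tube irr (𝟙_ (Center C))) : Tube irr A :=
  fun i => f i ≫ oneMap A ▷ (irr.sum ⊗ irr.obj i)

open scoped MonoidalLeftAction in
/-- The right action of the `A`-tube algebra on `C(Y → K)`, for an `A`-module `K` in the center: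
apply the tube diagram below `h : Y ⟶ K`, let `A` act on `K`, move the string around the tube
across `K` with the half-braiding, and close it up. -/
noncomputable def act (dual : ∀ i, BalancedDual (irr.obj i)) (K : Center C) [ModObj A K]
    (h : irr.sum ⟶ K.1) (f : Tube irr A) : irr.sum ⟶ K.1 :=
  ∑ i, (dual i).partialTrace (f i ≫ A.1 ◁ (h ▷ irr.obj i) ≫ (α_ A.1 K.1 (irr.obj i)).inv ≫
    (show A.1 ⊗ K.1 ⟶ K.1 from (γ[A, K] : A ⊗ K ⟶ K).f) ▷ irr.obj i ≫ (K.2.β (irr.obj i)).hom)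

end Tube

end Fusion

/-! ### Étale algebras -/

/-- A connected étale (that is, commutative and separable) algebra in a braided
`ℂ`-linear category. -/
structure IsConnectedEtale {E : Type u} [Category.{v} E] [Preadditive E] [Linear ℂ E]
    [MonoidalCategory E] [BraidedCategory E] (A : E) [MonObj A] : Prop where
  comm : IsCommMonObj A
  /-- The multiplication splits as a morphism of bimodules. -/
  separable : ∃ s : A ⟶ A ⊗ A, s ≫ μ[A] = 𝟙 A ∧
    μ[A] ≫ s = A ◁ s ≫ (α_ A A A).inv ≫ μ[A] ▷ A ∧
    μ[A] ≫ s = s ▷ A ≫ (α_ A A A).hom ≫ A ◁ μ[A]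
  connected : Module.finrank ℂ (𝟙_ E ⟶ A) = 1

/-! ### Idempotents -/

/-- A minimal idempotent of a ring: a nonzero idempotent without proper nonzero subidempotents. -/
def IsMinimalIdempotent {R : Type*} [Ring R] (q : R) : Prop :=
  IsIdempotentElem q ∧ q ≠ 0 ∧
    ∀ p : R, IsIdempotentElem p → p * q = p → q * p = p → p = 0 ∨ p = q

/-- A minimal central idempotent of a ring. -/
def IsMinimalCentralIdempotent {R : Type*} [Ring R] (P : R) : Prop :=
  P ∈ Set.center R ∧ IsIdempotentElem P ∧ P ≠ 0 ∧
    ∀ Q ∈ Set.center R, IsIdempotentElem Q → Q * P = Q → Q = 0 ∨ Q = P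

/-- The algebra homomorphism `φ` identifies the block `P R` of the algebra `R` with the algebra of
`n × n`-matrices and vanishes on the complementary summand `(1 - P) R`. -/
structure IsMatrixBlock {R : Type*} [Ring R] [Algebra ℂ R] (P : R) {n : ℕ}
    (φ : R →ₐ[ℂ] Matrix (Fin n) (Fin n) ℂ) : Prop where
  surjective : Function.Surjective φ
  map_eq_zero_iff : ∀ a, φ a = 0 ↔ P * a = 0

end CategoryTheory

/-!
An `A`-module `K` in the Drinfeld center `Z(C)` gives a right `Tube_A`-module `C(Y → K)`, here called
`Tube.Rep`. The theorem follows from two facts about this functor: it is fully faithful, and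
`Tube_A` is a semisimple algebra.

That the tubes act at all (`Tube.act_mul`) rests on the cyclicity of the partial trace
(`SphericalDual.partialTrace_cyc`), which allows the string around a tube to be closed up before it is
resolved into simple objects. Cyclicity is the statement that the two transposes of a morphism agree
(`SphericalDual.transpose_eq`). For duals whose left and right traces coincide, the double transpose
is an involution, and the positivity of the dagger structure excludes the eigenvalue `-1`. Balanced
duals of simple objects have coinciding traces, and the property passes to tensor products.

Fullness (`Tube.Rep.exists_hom`) comes from linearity under tubes and from the nondegeneracy of the
partial trace. The same argument shows that a submodule of `C(Y → K)` is given by a subobject of `K` in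
`C` that is stable under the action of `A` and the half-braiding. A projection in `C` onto such a
subobject is averaged twice: over the half-braiding, where the handle slide (`handle_slide`) shows that
the sum of all conjugates, weighted by quantum dimensions, is a morphism of the center, and over `A`,
by separability (`averageAction_comm`). The result is an `A`-module projection with the same image
(`exists_module_projection`). So every `C(Y → K)` is semisimple, and it is simple when `K` is.

The regular representation of `Tube_A` embeds into `C(Y → K)`, where `K` is the free `A`-module on the
object of the center induced from `Y`, that is on the sum of the `x̄ ⊗ Y ⊗ x` (`indCenter`,
`Tube.act_generator_injective`). Hence `Tube_A` is semisimple (`Tube.isSemisimpleRing`), and the simple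
module `C(Y → M)` belongs to exactly one block, a matrix algebra whose module of row vectors it is.

The rank of `P_M (i_A ⊗ q_z)` is therefore the rank of `i_A ⊗ q_z` on `C(Y → M)`
(`IsMatrixBlock.rank_eq`), where it acts as `q_z`. As `q_z` is a minimal idempotent acting nontrivially
on the simple module `C(Y → z)`, this rank is the dimension of the space of `Tube_1`-linear maps from
`C(Y → z)` to `C(Y → M)` (`IsMinimalIdempotent.finrank_linearMap`). By full faithfulness this is
`dim Z(C)(z → M)`, by the adjunction for free modules (`Mod.freeHomEquiv`) it is `dim Z(C)_A(Az → M)`,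
and by semisimplicity (`finrank_linearMap_comm`) it is `dim Z(C)_A(M → Az)`.
-/

/-! ### Unitary duals and partial traces -/

namespace CategoryTheory

open DaggerCategory

variable {C : Type u} [Category.{v} C] [Abelian C] [Linear ℂ C] [MonoidalCategory C]
  [MonoidalPreadditive C] [MonoidalLinear ℂ C] [RigidCategory C] [DaggerCategory C]
  [UnitaryFusionCategory C]

theorem dag_whiskerLeft (X : C) {Y Z : C} (f : Y ⟶ Z) : dag (X ◁ f) = X ◁ dag f := by
  rw [← id_tensorHom, UnitaryFusionCategory.dag_tensor, dag_id, id_tensorHom]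

theorem dag_whiskerRight {Y Z : C} (f : Y ⟶ Z) (X : C) : dag (f ▷ X) = dag f ▷ X := by
  rw [← tensorHom_id, UnitaryFusionCategory.dag_tensor, dag_id, tensorHom_id]

theorem dag_associator_inv (X Y Z : C) : dag (α_ X Y Z).inv = (α_ X Y Z).hom := by
  rw [← UnitaryFusionCategory.dag_associator, dag_dag]

theorem dag_leftUnitor_inv (X : C) : dag (λ_ X).inv = (λ_ X).hom := by
  rw [← UnitaryFusionCategory.dag_leftUnitor, dag_dag]

theorem dag_rightUnitor_inv (X : C) : dag (ρ_ X).inv = (ρ_ X).hom := by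
  rw [← UnitaryFusionCategory.dag_rightUnitor, dag_dag]

/-- Every scalar of the form `f† f` is a nonnegative real number. -/
theorem exists_norm_sq {X : C} (f : 𝟙_ C ⟶ X) :
    ∃ r : ℝ, 0 ≤ r ∧ f ≫ dag f = (r : ℂ) • 𝟙 (𝟙_ C) := by
  have : Simple (𝟙_ C) := UnitaryFusionCategory.simple_unit
  have : FiniteDimensional ℂ (𝟙_ C ⟶ 𝟙_ C) := UnitaryFusionCategory.finite_hom _ _
  obtain ⟨g, hg⟩ := UnitaryFusionCategory.dag_positive f
  obtain ⟨c, hc⟩ := endomorphism_simple_eq_smul_id ℂ g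
  refine ⟨Complex.normSq c, Complex.normSq_nonneg c, ?_⟩
  rw [hg, ← hc, UnitaryFusionCategory.dag_smul, dag_id, Complex.normSq_eq_conj_mul_self]
  simp [smul_smul]

/-- Positivity of the dagger structure, for a sum of two terms. -/
theorem eq_zero_of_norm_sq_add {X Y : C} (f : 𝟙_ C ⟶ X) (g : 𝟙_ C ⟶ Y)
    (h : f ≫ dag f + g ≫ dag g = 0) : f = 0 := by
  have : Simple (𝟙_ C) := UnitaryFusionCategory.simple_unit
  obtain ⟨r, hr, hf⟩ := exists_norm_sq f
  obtain ⟨s, hs, hg⟩ := exists_norm_sq g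
  rw [hf, hg, ← add_smul, smul_eq_zero] at h
  have h0 : (r : ℂ) + s = 0 := h.resolve_right (id_nonzero _)
  have h1 : r + s = 0 := by exact_mod_cast h0
  have : r = 0 := by linarith
  apply UnitaryFusionCategory.dag_definite
  simp [hf, this]

namespace BalancedDual

variable {X : C} (D : BalancedDual X)

/-- The coevaluation `𝟙 ⟶ X̄ ⊗ X`. Unprimed `coev` and `ev` belong to the exact pairing that is part
of the data; their adjoints `ev'` and `coev'` are the primed versions. -/
def coev : 𝟙_ C ⟶ D.dual ⊗ X := letI := D.pairing; η_ D.dual X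

/-- The evaluation `X ⊗ X̄ ⟶ 𝟙`. -/
def ev : X ⊗ D.dual ⟶ 𝟙_ C := letI := D.pairing; ε_ D.dual X

/-- The coevaluation `𝟙 ⟶ X ⊗ X̄`, the adjoint of the evaluation. -/
def coev' : 𝟙_ C ⟶ X ⊗ D.dual := dag D.ev

/-- The evaluation `X̄ ⊗ X ⟶ 𝟙`, the adjoint of the coevaluation. -/
def ev' : D.dual ⊗ X ⟶ 𝟙_ C := dag D.coev

theorem dag_coev' : dag D.coev' = D.ev := dag_dag _
theorem dag_ev' : dag D.ev' = D.coev := dag_dag _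

theorem zigzag : X ◁ D.coev ⊗≫ D.ev ▷ X = ⊗𝟙.hom :=
  letI := D.pairing; ExactPairing.coevaluation_evaluation'' (X := D.dual) (Y := X)

theorem zigzag_dual : D.coev ▷ D.dual ⊗≫ D.dual ◁ D.ev = ⊗𝟙.hom :=
  letI := D.pairing; ExactPairing.evaluation_coevaluation'' (X := D.dual) (Y := X)

theorem zigzag' : D.coev' ▷ X ⊗≫ X ◁ D.ev' = ⊗𝟙.hom := by
  letI := D.pairing
  have h := congrArg dag (ExactPairing.coevaluation_evaluation (X := D.dual) (Y := X))
  simp only [dag_comp, dag_whiskerLeft, dag_whiskerRight, dag_associator_inv,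
    dag_leftUnitor_inv, UnitaryFusionCategory.dag_rightUnitor, Category.assoc] at h
  calc
    _ = D.coev' ▷ X ≫ (α_ X D.dual X).hom ≫ X ◁ D.ev' := by monoidal
    _ = _ := h
    _ = _ := by monoidal

theorem zigzag_dual' : D.dual ◁ D.coev' ⊗≫ D.ev' ▷ D.dual = ⊗𝟙.hom := by
  letI := D.pairing
  have h := congrArg dag (ExactPairing.evaluation_coevaluation (X := D.dual) (Y := X))
  simp only [dag_comp, dag_whiskerLeft, dag_whiskerRight,
    UnitaryFusionCategory.dag_associator, UnitaryFusionCategory.dag_leftUnitor,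
    dag_rightUnitor_inv, Category.assoc] at h
  calc
    _ = D.dual ◁ D.coev' ≫ (α_ D.dual X D.dual).inv ≫ D.ev' ▷ D.dual := by monoidal
    _ = _ := h
    _ = _ := by monoidal

theorem partialTrace_eq {y k : C} (h : X ⊗ y ⟶ X ⊗ k) :
    D.partialTrace h = 𝟙 _ ⊗≫ D.coev ▷ y ⊗≫ D.dual ◁ h ⊗≫ D.ev' ▷ k ⊗≫ 𝟙 _ := by
  have : D.partialTrace h = (λ_ y).inv ≫ D.coev ▷ y ≫ (α_ D.dual X y).hom ≫ D.dual ◁ h ≫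
    (α_ D.dual X k).inv ≫ D.ev' ▷ k ≫ (λ_ k).hom := rfl
  rw [this]
  monoidal

theorem partialTrace_add {y k : C} (h h' : X ⊗ y ⟶ X ⊗ k) :
    D.partialTrace (h + h') = D.partialTrace h + D.partialTrace h' := by
  simp [partialTrace]

theorem partialTrace_smul {y k : C} (r : ℂ) (h : X ⊗ y ⟶ X ⊗ k) :
    D.partialTrace (r • h) = r • D.partialTrace h := by
  simp [partialTrace]

/-- The partial trace as a linear map. -/
noncomputable def partialTraceHom (y k : C) : (X ⊗ y ⟶ X ⊗ k) →ₗ[ℂ] (y ⟶ k) where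
  toFun := D.partialTrace
  map_add' := D.partialTrace_add
  map_smul' := D.partialTrace_smul

theorem partialTrace_sum {y k : C} {κ : Type*} (s : Finset κ) (h : κ → (X ⊗ y ⟶ X ⊗ k)) :
    D.partialTrace (∑ i ∈ s, h i) = ∑ i ∈ s, D.partialTrace (h i) :=
  map_sum (D.partialTraceHom y k) h s

theorem partialTrace_zero {y k : C} : D.partialTrace (0 : X ⊗ y ⟶ X ⊗ k) = 0 :=
  map_zero (D.partialTraceHom y k)

theorem comp_partialTrace {y y' k : C} (s : y ⟶ y') (h : X ⊗ y' ⟶ X ⊗ k) :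
    s ≫ D.partialTrace h = D.partialTrace (X ◁ s ≫ h) := by
  rw [partialTrace_eq, partialTrace_eq]
  calc
    _ = 𝟙 _ ⊗≫ (𝟙_ C ◁ s ≫ D.coev ▷ y') ⊗≫ D.dual ◁ h ⊗≫ D.ev' ▷ k ⊗≫ 𝟙 _ := by monoidal
    _ = _ := by rw [whisker_exchange]; monoidal

theorem partialTrace_comp {y k k' : C} (h : X ⊗ y ⟶ X ⊗ k) (s : k ⟶ k') :
    D.partialTrace h ≫ s = D.partialTrace (h ≫ X ◁ s) := by
  rw [partialTrace_eq, partialTrace_eq]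
  calc
    _ = 𝟙 _ ⊗≫ D.coev ▷ y ⊗≫ D.dual ◁ h ⊗≫ (D.ev' ▷ k ≫ 𝟙_ C ◁ s) ⊗≫ 𝟙 _ := by monoidal
    _ = _ := by rw [← whisker_exchange]; monoidal

/-- Bending the string `X` in the source of a morphism to its target. -/
def bend {y z : C} (g : X ⊗ y ⟶ z) : y ⟶ D.dual ⊗ z :=
  (λ_ y).inv ≫ D.coev ▷ y ≫ (α_ _ _ _).hom ≫ D.dual ◁ g

/-- The inverse of `bend`. -/
def unbend {y z : C} (g : y ⟶ D.dual ⊗ z) : X ⊗ y ⟶ z :=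
  X ◁ g ≫ (α_ _ _ _).inv ≫ D.ev ▷ z ≫ (λ_ z).hom

theorem unbend_bend {y z : C} (g : X ⊗ y ⟶ z) : D.unbend (D.bend g) = g := by
  unfold bend unbend
  calc
    _ = 𝟙 _ ⊗≫ (X ◁ D.coev) ▷ y ⊗≫ ((X ⊗ D.dual) ◁ g ≫ D.ev ▷ z) ⊗≫ 𝟙 _ := by monoidal
    _ = 𝟙 _ ⊗≫ (X ◁ D.coev ⊗≫ D.ev ▷ X) ▷ y ⊗≫ g ⊗≫ 𝟙 _ := by rw [whisker_exchange]; monoidal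
    _ = _ := by rw [zigzag]; monoidal

theorem bend_unbend {y z : C} (g : y ⟶ D.dual ⊗ z) : D.bend (D.unbend g) = g := by
  unfold bend unbend
  calc
    _ = 𝟙 _ ⊗≫ (D.coev ▷ y ≫ (D.dual ⊗ X) ◁ g) ⊗≫ D.dual ◁ D.ev ▷ z ⊗≫ 𝟙 _ := by monoidal
    _ = 𝟙 _ ⊗≫ g ⊗≫ (D.coev ▷ D.dual ⊗≫ D.dual ◁ D.ev) ▷ z ⊗≫ 𝟙 _ := by
      rw [← whisker_exchange]; monoidal
    _ = _ := by rw [zigzag_dual]; monoidal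

/-- Bending the string `X` in the target of a morphism to its source. -/
def bend' {y z : C} (g : y ⟶ X ⊗ z) : D.dual ⊗ y ⟶ z :=
  D.dual ◁ g ≫ (α_ _ _ _).inv ≫ D.ev' ▷ z ≫ (λ_ z).hom

/-- The inverse of `bend'`. -/
def unbend' {y z : C} (g : D.dual ⊗ y ⟶ z) : y ⟶ X ⊗ z :=
  (λ_ y).inv ≫ D.coev' ▷ y ≫ (α_ _ _ _).hom ≫ X ◁ g

theorem unbend'_bend' {y z : C} (g : y ⟶ X ⊗ z) : D.unbend' (D.bend' g) = g := by
  unfold bend' unbend'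
  calc
    _ = 𝟙 _ ⊗≫ (D.coev' ▷ y ≫ (X ⊗ D.dual) ◁ g) ⊗≫ X ◁ D.ev' ▷ z ⊗≫ 𝟙 _ := by monoidal
    _ = 𝟙 _ ⊗≫ g ⊗≫ (D.coev' ▷ X ⊗≫ X ◁ D.ev') ▷ z ⊗≫ 𝟙 _ := by
      rw [← whisker_exchange]; monoidal
    _ = _ := by rw [zigzag']; monoidal

theorem bend'_unbend' {y z : C} (g : D.dual ⊗ y ⟶ z) : D.bend' (D.unbend' g) = g := by
  unfold bend' unbend'
  calc
    _ = 𝟙 _ ⊗≫ (D.dual ◁ D.coev') ▷ y ⊗≫ ((D.dual ⊗ X) ◁ g ≫ D.ev' ▷ z) ⊗≫ 𝟙 _ := by monoidal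
    _ = 𝟙 _ ⊗≫ (D.dual ◁ D.coev' ⊗≫ D.ev' ▷ D.dual) ▷ y ⊗≫ g ⊗≫ 𝟙 _ := by
      rw [whisker_exchange]; monoidal
    _ = _ := by rw [zigzag_dual']; monoidal

theorem partialTrace_comp_eq {y z k : C} (g : X ⊗ y ⟶ z) (h : z ⟶ X ⊗ k) :
    D.partialTrace (g ≫ h) = D.bend g ≫ D.bend' h := by
  rw [partialTrace_eq]
  unfold bend bend'
  monoidal

end BalancedDual

end CategoryTheory

/-! ### Transposes, traces and spherical duals -/

namespace CategoryTheory

open DaggerCategory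

variable {C : Type u} [Category.{v} C] [Abelian C] [Linear ℂ C] [MonoidalCategory C]
  [MonoidalPreadditive C] [MonoidalLinear ℂ C] [RigidCategory C] [DaggerCategory C]
  [UnitaryFusionCategory C]

namespace BalancedDual

/-- The trace that closes a string on the left. -/
def leftTrace {X : C} (D : BalancedDual X) (f : X ⟶ X) : 𝟙_ C ⟶ 𝟙_ C :=
  D.coev ≫ D.dual ◁ f ≫ D.ev'

/-- The trace that closes a string on the right. -/
def rightTrace {X : C} (D : BalancedDual X) (f : X ⟶ X) : 𝟙_ C ⟶ 𝟙_ C :=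
  D.coev' ≫ f ▷ D.dual ≫ D.ev

section Transpose

variable {X W : C} (D : BalancedDual X) (E : BalancedDual W)

/-- The transpose of `a` with respect to `coev` and `ev`. -/
def transpose (a : W ⟶ X) : D.dual ⟶ E.dual :=
  (λ_ _).inv ≫ E.coev ▷ D.dual ≫ (α_ _ _ _).hom ≫ E.dual ◁ (a ▷ D.dual ≫ D.ev) ≫ (ρ_ _).hom

/-- The transpose of `a` with respect to `coev'` and `ev'`. -/
def transpose' (a : W ⟶ X) : D.dual ⟶ E.dual :=
  (ρ_ _).inv ≫ D.dual ◁ E.coev' ≫ (α_ _ _ _).inv ≫ (D.dual ◁ a ≫ D.ev') ▷ E.dual ≫ (λ_ _).hom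

theorem coev_transpose (a : W ⟶ X) :
    D.coev ≫ D.transpose E a ▷ X = E.coev ≫ E.dual ◁ a := by
  unfold transpose
  calc
    _ = 𝟙 _ ⊗≫ (𝟙_ C ◁ D.coev ≫ E.coev ▷ (D.dual ⊗ X)) ⊗≫ E.dual ◁ (a ▷ D.dual ≫ D.ev) ▷ X ⊗≫
          𝟙 _ := by monoidal
    _ = 𝟙 _ ⊗≫ E.coev ⊗≫ E.dual ◁ (W ◁ D.coev ≫ a ▷ (D.dual ⊗ X)) ⊗≫ E.dual ◁ D.ev ▷ X ⊗≫
          𝟙 _ := by rw [whisker_exchange]; monoidal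
    _ = 𝟙 _ ⊗≫ E.coev ⊗≫ E.dual ◁ a ⊗≫ E.dual ◁ (X ◁ D.coev ⊗≫ D.ev ▷ X) ⊗≫ 𝟙 _ := by
      rw [whisker_exchange]; monoidal
    _ = _ := by rw [zigzag]; monoidal

theorem transpose_ev (a : W ⟶ X) :
    W ◁ D.transpose E a ≫ E.ev = a ▷ D.dual ≫ D.ev := by
  unfold transpose
  calc
    _ = 𝟙 _ ⊗≫ W ◁ E.coev ▷ D.dual ⊗≫ ((W ⊗ E.dual) ◁ (a ▷ D.dual ≫ D.ev) ≫ E.ev ▷ 𝟙_ C) ⊗≫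
          𝟙 _ := by monoidal
    _ = 𝟙 _ ⊗≫ (W ◁ E.coev ⊗≫ E.ev ▷ W) ▷ D.dual ⊗≫ (a ▷ D.dual ≫ D.ev) ⊗≫ 𝟙 _ := by
      rw [whisker_exchange]; monoidal
    _ = _ := by rw [zigzag]; monoidal

theorem coev'_transpose' (a : W ⟶ X) :
    D.coev' ≫ X ◁ D.transpose' E a = E.coev' ≫ a ▷ E.dual := by
  unfold transpose'
  calc
    _ = 𝟙 _ ⊗≫ (D.coev' ▷ 𝟙_ C ≫ (X ⊗ D.dual) ◁ E.coev') ⊗≫ X ◁ (D.dual ◁ a ≫ D.ev') ▷ E.dual ⊗≫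
          𝟙 _ := by monoidal
    _ = 𝟙 _ ⊗≫ E.coev' ⊗≫ (D.coev' ▷ W ≫ (X ⊗ D.dual) ◁ a) ▷ E.dual ⊗≫ X ◁ D.ev' ▷ E.dual ⊗≫
          𝟙 _ := by rw [← whisker_exchange]; monoidal
    _ = 𝟙 _ ⊗≫ E.coev' ⊗≫ a ▷ E.dual ⊗≫ (D.coev' ▷ X ⊗≫ X ◁ D.ev') ▷ E.dual ⊗≫ 𝟙 _ := by
      rw [← whisker_exchange]; monoidal
    _ = _ := by rw [zigzag']; monoidal

theorem transpose'_ev' (a : W ⟶ X) :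
    D.transpose' E a ▷ W ≫ E.ev' = D.dual ◁ a ≫ D.ev' := by
  unfold transpose'
  calc
    _ = 𝟙 _ ⊗≫ D.dual ◁ E.coev' ▷ W ⊗≫ ((D.dual ◁ a ≫ D.ev') ▷ (E.dual ⊗ W) ≫ 𝟙_ C ◁ E.ev') ⊗≫
          𝟙 _ := by monoidal
    _ = 𝟙 _ ⊗≫ D.dual ◁ (E.coev' ▷ W ⊗≫ W ◁ E.ev') ⊗≫ (D.dual ◁ a ≫ D.ev') ⊗≫ 𝟙 _ := by
      rw [← whisker_exchange]; monoidal
    _ = _ := by rw [zigzag']; monoidal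

/-- The inverse of `transpose`. -/
def untranspose (m : D.dual ⟶ E.dual) : W ⟶ X :=
  (ρ_ _).inv ≫ W ◁ (D.coev ≫ m ▷ X) ≫ (α_ _ _ _).inv ≫ E.ev ▷ X ≫ (λ_ _).hom

/-- The inverse of `transpose'`. -/
def untranspose' (m : D.dual ⟶ E.dual) : W ⟶ X :=
  (λ_ _).inv ≫ (D.coev' ≫ X ◁ m) ▷ W ≫ (α_ _ _ _).hom ≫ X ◁ E.ev' ≫ (ρ_ _).hom

theorem coev_untranspose (m : D.dual ⟶ E.dual) :
    E.coev ≫ E.dual ◁ D.untranspose E m = D.coev ≫ m ▷ X := by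
  unfold untranspose
  calc
    _ = 𝟙 _ ⊗≫ (E.coev ▷ 𝟙_ C ≫ (E.dual ⊗ W) ◁ (D.coev ≫ m ▷ X)) ⊗≫ E.dual ◁ E.ev ▷ X ⊗≫
          𝟙 _ := by monoidal
    _ = 𝟙 _ ⊗≫ D.coev ⊗≫ m ▷ X ⊗≫ (E.coev ▷ E.dual ⊗≫ E.dual ◁ E.ev) ▷ X ⊗≫ 𝟙 _ := by
      rw [← whisker_exchange]; monoidal
    _ = _ := by rw [zigzag_dual]; monoidal

theorem coev'_untranspose' (m : D.dual ⟶ E.dual) :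
    E.coev' ≫ D.untranspose' E m ▷ E.dual = D.coev' ≫ X ◁ m := by
  unfold untranspose'
  calc
    _ = 𝟙 _ ⊗≫ (𝟙_ C ◁ E.coev' ≫ (D.coev' ≫ X ◁ m) ▷ (W ⊗ E.dual)) ⊗≫ X ◁ E.ev' ▷ E.dual ⊗≫
          𝟙 _ := by monoidal
    _ = 𝟙 _ ⊗≫ D.coev' ⊗≫ X ◁ m ⊗≫ X ◁ (E.dual ◁ E.coev' ⊗≫ E.ev' ▷ E.dual) ⊗≫ 𝟙 _ := by
      rw [whisker_exchange]; monoidal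
    _ = _ := by rw [zigzag_dual']; monoidal

theorem eq_of_coev {Y : C} {a b : W ⟶ Y} (h : E.coev ≫ E.dual ◁ a = E.coev ≫ E.dual ◁ b) :
    a = b := by
  have key : ∀ c : W ⟶ Y, c = 𝟙 _ ⊗≫ W ◁ (E.coev ≫ E.dual ◁ c) ⊗≫ E.ev ▷ Y ⊗≫ 𝟙 _ := by
    intro c
    symm
    calc
      _ = 𝟙 _ ⊗≫ W ◁ E.coev ⊗≫ ((W ⊗ E.dual) ◁ c ≫ E.ev ▷ Y) ⊗≫ 𝟙 _ := by monoidal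
      _ = 𝟙 _ ⊗≫ (W ◁ E.coev ⊗≫ E.ev ▷ W) ⊗≫ c ⊗≫ 𝟙 _ := by
        rw [whisker_exchange]; monoidal
      _ = _ := by rw [zigzag]; monoidal
  rw [key a, key b, h]

theorem eq_of_coev_dual {Y : C} {a b : D.dual ⟶ Y} (h : D.coev ≫ a ▷ X = D.coev ≫ b ▷ X) :
    a = b := by
  have key : ∀ c : D.dual ⟶ Y, c = 𝟙 _ ⊗≫ (D.coev ≫ c ▷ X) ▷ D.dual ⊗≫ Y ◁ D.ev ⊗≫ 𝟙 _ := by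
    intro c
    symm
    calc
      _ = 𝟙 _ ⊗≫ D.coev ▷ D.dual ⊗≫ (c ▷ (X ⊗ D.dual) ≫ Y ◁ D.ev) ⊗≫ 𝟙 _ := by monoidal
      _ = 𝟙 _ ⊗≫ (D.coev ▷ D.dual ⊗≫ D.dual ◁ D.ev) ⊗≫ c ⊗≫ 𝟙 _ := by
        rw [← whisker_exchange]; monoidal
      _ = _ := by rw [zigzag_dual]; monoidal
  rw [key a, key b, h]

theorem eq_of_coev'_dual {Y : C} {a b : D.dual ⟶ Y} (h : D.coev' ≫ X ◁ a = D.coev' ≫ X ◁ b) :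
    a = b := by
  have key : ∀ c : D.dual ⟶ Y, c = 𝟙 _ ⊗≫ D.dual ◁ (D.coev' ≫ X ◁ c) ⊗≫ D.ev' ▷ Y ⊗≫ 𝟙 _ := by
    intro c
    symm
    calc
      _ = 𝟙 _ ⊗≫ D.dual ◁ D.coev' ⊗≫ ((D.dual ⊗ X) ◁ c ≫ D.ev' ▷ Y) ⊗≫ 𝟙 _ := by monoidal
      _ = 𝟙 _ ⊗≫ (D.dual ◁ D.coev' ⊗≫ D.ev' ▷ D.dual) ⊗≫ c ⊗≫ 𝟙 _ := by
        rw [whisker_exchange]; monoidal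
      _ = _ := by rw [zigzag_dual']; monoidal
  rw [key a, key b, h]

theorem transpose_untranspose (m : D.dual ⟶ E.dual) :
    D.transpose E (D.untranspose E m) = m :=
  D.eq_of_coev_dual (by rw [coev_transpose, coev_untranspose])

theorem transpose'_untranspose' (m : D.dual ⟶ E.dual) :
    D.transpose' E (D.untranspose' E m) = m :=
  D.eq_of_coev'_dual (by rw [coev'_transpose', coev'_untranspose'])

theorem untranspose_transpose (a : W ⟶ X) : D.untranspose E (D.transpose E a) = a :=
  E.eq_of_coev (by rw [coev_untranspose, coev_transpose])

theorem untranspose_sub (m n : D.dual ⟶ E.dual) :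
    D.untranspose E (m - n) = D.untranspose E m - D.untranspose E n := by
  have : ∀ m, D.untranspose E m = (ρ_ _).inv ≫ W ◁ (D.coev ≫ m ▷ X) ≫ (α_ _ _ _).inv ≫
    E.ev ▷ X ≫ (λ_ _).hom := fun _ => rfl
  rw [eq_sub_iff_add_eq, this, this, this]
  simp only [← Preadditive.comp_add, ← Preadditive.add_comp, ← MonoidalPreadditive.whiskerLeft_add,
    ← MonoidalPreadditive.add_whiskerRight, sub_add_cancel]

theorem transpose'_sub (a b : W ⟶ X) :
    D.transpose' E (a - b) = D.transpose' E a - D.transpose' E b := by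
  have : ∀ a, D.transpose' E a = (ρ_ _).inv ≫ D.dual ◁ E.coev' ≫ (α_ _ _ _).inv ≫
    (D.dual ◁ a ≫ D.ev') ▷ E.dual ≫ (λ_ _).hom := fun _ => rfl
  rw [eq_sub_iff_add_eq, this, this, this]
  simp only [← Preadditive.comp_add, ← Preadditive.add_comp, ← MonoidalPreadditive.whiskerLeft_add,
    ← MonoidalPreadditive.add_whiskerRight, sub_add_cancel]

/-- The left trace is cyclic up to a double transpose. -/
theorem leftTrace_comp (a : W ⟶ X) (b : X ⟶ W) :
    D.leftTrace (b ≫ a) = E.leftTrace (D.untranspose E (D.transpose' E a) ≫ b) := by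
  unfold leftTrace
  rw [MonoidalCategory.whiskerLeft_comp, MonoidalCategory.whiskerLeft_comp, Category.assoc,
    Category.assoc, reassoc_of% D.coev_untranspose E, ← whisker_exchange_assoc,
    transpose'_ev']

/-- The right trace is cyclic up to the double transpose in the other direction. -/
theorem rightTrace_comp (a : W ⟶ X) (b : X ⟶ W) :
    D.rightTrace (b ≫ a) = E.rightTrace (D.untranspose' E (D.transpose E a) ≫ b) := by
  unfold rightTrace
  rw [comp_whiskerRight, comp_whiskerRight, Category.assoc,
    Category.assoc, reassoc_of% D.coev'_untranspose' E, whisker_exchange_assoc,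
    transpose_ev]

end Transpose

theorem leftTrace_comp_dag {X W : C} (E : BalancedDual W) (f : W ⟶ X) :
    E.leftTrace (f ≫ dag f) = (E.coev ≫ E.dual ◁ f) ≫ dag (E.coev ≫ E.dual ◁ f) := by
  simp [leftTrace, dag_comp, dag_whiskerLeft, ev']

theorem leftTrace_sub {W : C} (E : BalancedDual W) (f g : W ⟶ W) :
    E.leftTrace (f - g) = E.leftTrace f - E.leftTrace g := by
  rw [eq_sub_iff_add_eq]
  unfold leftTrace
  rw [← Preadditive.comp_add, ← Preadditive.add_comp, ← MonoidalPreadditive.whiskerLeft_add,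
    sub_add_cancel]

theorem eq_zero_of_coev {X W : C} (E : BalancedDual W) {f : W ⟶ X}
    (h : E.coev ≫ E.dual ◁ f = 0) : f = 0 :=
  E.eq_of_coev (by rw [h]; simp)

end BalancedDual

/-- A unitary dual of an object for which the left and the right trace agree on all endomorphisms
(a standard solution of the conjugate equations). -/
structure SphericalDual (X : C) extends BalancedDual X where
  /-- The left trace is the right trace. -/
  spherical : ∀ f : X ⟶ X, toBalancedDual.leftTrace f = toBalancedDual.rightTrace f

namespace SphericalDual

variable {X W : C} (D : SphericalDual X) (E : SphericalDual W)

/-- The unitary pivotal structure: the two transposes of a morphism agree. The double transpose `r`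
satisfies `r = r⁻¹` because the left and right traces agree, and it is positive. -/
theorem transpose_eq (a : W ⟶ X) :
    D.transpose E.toBalancedDual a = D.transpose' E.toBalancedDual a := by
  set D' := D.toBalancedDual
  set E' := E.toBalancedDual
  -- Both double transposes are determined by pairing with all `b` under the trace.
  have h1 : ∀ a, D'.untranspose E' (D'.transpose' E' a) =
      D'.untranspose' E' (D'.transpose E' a) := by
    intro a
    rw [← sub_eq_zero]
    apply E'.eq_zero_of_coev
    apply UnitaryFusionCategory.dag_definite
    rw [← BalancedDual.leftTrace_comp_dag]
    generalize dag (D'.untranspose E' (D'.transpose' E' a) -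
      D'.untranspose' E' (D'.transpose E' a)) = b
    rw [Preadditive.sub_comp, BalancedDual.leftTrace_sub, ← BalancedDual.leftTrace_comp,
      E.spherical, ← BalancedDual.rightTrace_comp, D.spherical, sub_self]
  set r : (W ⟶ X) → (W ⟶ X) := fun a => D'.untranspose E' (D'.transpose' E' a) with hr
  have h2 : ∀ a, r (r a) = a := by
    intro a
    have : D'.transpose' E' (r a) = D'.transpose E' a := by
      rw [hr]
      simp only [h1, BalancedDual.transpose'_untranspose']
    change D'.untranspose E' (D'.transpose' E' (r a)) = a
    rw [this, BalancedDual.untranspose_transpose]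
  have h3 : r (r a - a) = -(r a - a) := by
    have : r (r a - a) = r (r a) - r a := by
      simp only [hr, BalancedDual.transpose'_sub, BalancedDual.untranspose_sub]
    rw [this, h2, neg_sub]
  -- If `r v = -v`, then the squared norms of `v†` and `v` add up to zero.
  have h4 : r a - a = 0 := by
    generalize r a - a = v at h3
    have h := D'.leftTrace_comp E' v (dag v)
    change _ = E'.leftTrace (r v ≫ dag v) at h
    have h5 : D'.leftTrace (dag v ≫ v) + E'.leftTrace (v ≫ dag v) = 0 := by
      rw [h, h3, Preadditive.neg_comp, ← zero_sub, BalancedDual.leftTrace_sub]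
      simp [BalancedDual.leftTrace]
    have h6 := D'.leftTrace_comp_dag (dag v)
    rw [dag_dag] at h6
    rw [h6, BalancedDual.leftTrace_comp_dag, add_comm] at h5
    exact E'.eq_zero_of_coev (eq_zero_of_norm_sq_add _ _ h5)
  have h5 : D'.untranspose E' (D'.transpose' E' a) = a := sub_eq_zero.1 h4
  conv_lhs => rw [← h5]
  rw [BalancedDual.transpose_untranspose]

/-- The partial trace is cyclic, because a morphism can be pulled around the closed string in either
direction with the same result. -/
theorem partialTrace_cyc {y k : C} (a : W ⟶ X) (F : X ⊗ y ⟶ W ⊗ k) :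
    E.partialTrace (a ▷ y ≫ F) = D.partialTrace (F ≫ a ▷ k) := by
  rw [BalancedDual.partialTrace_eq, BalancedDual.partialTrace_eq]
  calc
    _ = 𝟙 _ ⊗≫ (E.coev ≫ E.dual ◁ a) ▷ y ⊗≫ E.dual ◁ F ⊗≫ E.ev' ▷ k ⊗≫ 𝟙 _ := by monoidal
    _ = 𝟙 _ ⊗≫ D.coev ▷ y ⊗≫ (D.transpose' E.toBalancedDual a ▷ (X ⊗ y) ≫ E.dual ◁ F) ⊗≫
          E.ev' ▷ k ⊗≫ 𝟙 _ := by
      rw [← D.coev_transpose, transpose_eq]; monoidal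
    _ = 𝟙 _ ⊗≫ D.coev ▷ y ⊗≫ D.dual ◁ F ⊗≫
          (D.transpose' E.toBalancedDual a ▷ W ≫ E.ev') ▷ k ⊗≫ 𝟙 _ := by
      rw [← whisker_exchange]; monoidal
    _ = _ := by rw [D.transpose'_ev']; monoidal

theorem leftTrace_cyc (a : W ⟶ X) (b : X ⟶ W) : E.leftTrace (a ≫ b) = D.leftTrace (b ≫ a) := by
  rw [BalancedDual.leftTrace_comp _ E.toBalancedDual, ← transpose_eq,
    BalancedDual.untranspose_transpose]

end SphericalDual

end CategoryTheory

/-! ### Constructions of spherical duals -/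

namespace CategoryTheory

open DaggerCategory

variable {C : Type u} [Category.{v} C] [Abelian C] [Linear ℂ C] [MonoidalCategory C]
  [MonoidalPreadditive C] [MonoidalLinear ℂ C] [RigidCategory C] [DaggerCategory C]
  [UnitaryFusionCategory C]

namespace BalancedDual

theorem leftTrace_smul {W : C} (E : BalancedDual W) (r : ℂ) (f : W ⟶ W) :
    E.leftTrace (r • f) = r • E.leftTrace f := by
  simp [leftTrace]

theorem rightTrace_smul {W : C} (E : BalancedDual W) (r : ℂ) (f : W ⟶ W) :
    E.rightTrace (r • f) = r • E.rightTrace f := by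
  simp [rightTrace]

theorem leftTrace_id_eq_rightTrace_id {X : C} (D : BalancedDual X) :
    D.leftTrace (𝟙 X) = D.rightTrace (𝟙 X) := by
  have h : D.coev ≫ D.ev' = D.coev' ≫ D.ev := D.balanced
  simpa [leftTrace, rightTrace] using h

/-- The partial trace of a morphism `x ⊗ c ⟶ z ⊗ c`, closing up the string `c` on the right. -/
def rightPartialTrace {c : C} (D : BalancedDual c) {x z : C} (h : x ⊗ c ⟶ z ⊗ c) : x ⟶ z :=
  𝟙 _ ⊗≫ x ◁ D.coev' ⊗≫ h ▷ D.dual ⊗≫ z ◁ D.ev ⊗≫ 𝟙 _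

end BalancedDual

namespace SphericalDual

/-- A balanced dual of a simple object is spherical: all endomorphisms are scalars. -/
def ofSimple {X : C} (hX : Simple X) (D : BalancedDual X) : SphericalDual X where
  __ := D
  spherical f := by
    have : FiniteDimensional ℂ (X ⟶ X) := UnitaryFusionCategory.finite_hom _ _
    obtain ⟨r, rfl⟩ := endomorphism_simple_eq_smul_id ℂ f
    rw [BalancedDual.leftTrace_smul, BalancedDual.rightTrace_smul,
      BalancedDual.leftTrace_id_eq_rightTrace_id]

/-- The dual of a spherical dual, with the roles of the two pairings exchanged. -/
def symm {X : C} (D : SphericalDual X) : SphericalDual D.dual where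
  dual := X
  pairing :=
    { coevaluation' := D.coev'
      evaluation' := D.ev'
      coevaluation_evaluation' := by
        calc
          _ = D.dual ◁ D.coev' ⊗≫ D.ev' ▷ D.dual := by monoidal
          _ = _ := by rw [D.zigzag_dual']; monoidal
      evaluation_coevaluation' := by
        calc
          _ = D.coev' ▷ X ⊗≫ X ◁ D.ev' := by monoidal
          _ = _ := by rw [D.zigzag']; monoidal }
  balanced := by
    change D.coev' ≫ dag D.coev' = dag D.ev' ≫ D.ev'
    rw [D.dag_coev', D.dag_ev']
    simpa [BalancedDual.leftTrace, BalancedDual.rightTrace] using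
      D.leftTrace_id_eq_rightTrace_id.symm
  spherical f := by
    change D.coev' ≫ X ◁ f ≫ dag D.coev' = dag D.ev' ≫ f ▷ X ≫ D.ev'
    rw [D.dag_coev', D.dag_ev']
    have h := D.spherical (D.untranspose D.toBalancedDual f)
    have h1 := D.transpose_untranspose D.toBalancedDual f
    unfold BalancedDual.leftTrace BalancedDual.rightTrace at h
    rw [← D.transpose_ev D.toBalancedDual, h1, reassoc_of% D.coev_untranspose D.toBalancedDual] at h
    exact h.symm

theorem symm_ev' {X : C} (D : SphericalDual X) : D.symm.ev' = D.ev := dag_dag _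

end SphericalDual

namespace BalancedDual

variable {X Z : C} (D : BalancedDual X) (E : BalancedDual Z)

/-- The nested evaluation of a tensor product. -/
def tensorEv : (X ⊗ Z) ⊗ (E.dual ⊗ D.dual) ⟶ 𝟙_ C :=
  (α_ X Z _).hom ≫ X ◁ (α_ Z E.dual D.dual).inv ≫ X ◁ (E.ev ▷ D.dual) ≫
    X ◁ (λ_ D.dual).hom ≫ D.ev

/-- The nested coevaluation of a tensor product. -/
def tensorCoev : 𝟙_ C ⟶ (E.dual ⊗ D.dual) ⊗ (X ⊗ Z) :=
  E.coev ≫ E.dual ◁ (λ_ Z).inv ≫ E.dual ◁ (D.coev ▷ Z) ≫ E.dual ◁ (α_ D.dual X Z).hom ≫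
    (α_ E.dual D.dual _).inv

theorem dag_tensorEv : dag (D.tensorEv E) =
    D.coev' ⊗≫ X ◁ (E.coev' ▷ D.dual) ⊗≫ 𝟙 _ := by
  have : dag (D.tensorEv E) = D.coev' ≫ X ◁ (λ_ D.dual).inv ≫ X ◁ (E.coev' ▷ D.dual) ≫
      X ◁ (α_ Z E.dual D.dual).hom ≫ (α_ X Z _).inv := by
    simp only [tensorEv, dag_comp, dag_whiskerLeft, dag_whiskerRight, dag_associator_inv,
      UnitaryFusionCategory.dag_associator, UnitaryFusionCategory.dag_leftUnitor, Category.assoc]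
    rfl
  rw [this]
  monoidal

theorem dag_tensorCoev : dag (D.tensorCoev E) =
    𝟙 _ ⊗≫ E.dual ◁ (D.ev' ▷ Z) ⊗≫ E.ev' := by
  have : dag (D.tensorCoev E) = (α_ E.dual D.dual _).hom ≫ E.dual ◁ (α_ D.dual X Z).inv ≫
      E.dual ◁ (D.ev' ▷ Z) ≫ E.dual ◁ (λ_ Z).hom ≫ E.ev' := by
    simp only [tensorCoev, dag_comp, dag_whiskerLeft, dag_whiskerRight, dag_associator_inv,
      UnitaryFusionCategory.dag_associator, dag_leftUnitor_inv, Category.assoc]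
    rfl
  rw [this]
  monoidal

theorem tensor_zigzag :
    (X ⊗ Z) ◁ D.tensorCoev E ≫ (α_ _ _ _).inv ≫ D.tensorEv E ▷ (X ⊗ Z) =
      (ρ_ _).hom ≫ (λ_ _).inv := by
  unfold tensorCoev tensorEv
  calc
    _ = (X ⊗ Z) ◁ E.coev ⊗≫ X ◁ ((Z ⊗ E.dual) ◁ D.coev ≫ E.ev ▷ (D.dual ⊗ X)) ▷ Z ⊗≫
          D.ev ▷ (X ⊗ Z) ⊗≫ 𝟙 _ := by monoidal
    _ = 𝟙 _ ⊗≫ X ◁ (Z ◁ E.coev ⊗≫ E.ev ▷ Z) ⊗≫ (X ◁ D.coev ⊗≫ D.ev ▷ X) ▷ Z ⊗≫ 𝟙 _ := by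
      rw [whisker_exchange]; monoidal
    _ = _ := by rw [zigzag, zigzag]; monoidal

theorem tensor_zigzag_dual :
    D.tensorCoev E ▷ (E.dual ⊗ D.dual) ≫ (α_ _ _ _).hom ≫ (E.dual ⊗ D.dual) ◁ D.tensorEv E =
      (λ_ _).hom ≫ (ρ_ _).inv := by
  unfold tensorCoev tensorEv
  calc
    _ = E.coev ▷ (E.dual ⊗ D.dual) ⊗≫
          E.dual ◁ (D.coev ▷ (Z ⊗ E.dual) ≫ (D.dual ⊗ X) ◁ E.ev) ▷ D.dual ⊗≫
          (E.dual ⊗ D.dual) ◁ D.ev ⊗≫ 𝟙 _ := by monoidal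
    _ = 𝟙 _ ⊗≫ (E.coev ▷ E.dual ⊗≫ E.dual ◁ E.ev) ▷ D.dual ⊗≫
          E.dual ◁ (D.coev ▷ D.dual ⊗≫ D.dual ◁ D.ev) ⊗≫ 𝟙 _ := by
      rw [← whisker_exchange]; monoidal
    _ = _ := by rw [zigzag_dual, zigzag_dual]; monoidal

theorem tensor_leftTrace (f : X ⊗ Z ⟶ X ⊗ Z) :
    D.tensorCoev E ≫ (E.dual ⊗ D.dual) ◁ f ≫ dag (D.tensorCoev E) =
      E.leftTrace (D.partialTrace f) := by
  rw [dag_tensorCoev, leftTrace, partialTrace_eq]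
  unfold tensorCoev
  monoidal

theorem tensor_rightTrace (f : X ⊗ Z ⟶ X ⊗ Z) :
    dag (D.tensorEv E) ≫ f ▷ (E.dual ⊗ D.dual) ≫ D.tensorEv E =
      D.rightTrace (E.rightPartialTrace f) := by
  rw [dag_tensorEv, rightTrace, rightPartialTrace]
  unfold tensorEv
  monoidal

theorem rightTrace_partialTrace (f : X ⊗ Z ⟶ X ⊗ Z) :
    E.rightTrace (D.partialTrace f) = D.leftTrace (E.rightPartialTrace f) := by
  rw [leftTrace, rightTrace, partialTrace_eq, rightPartialTrace]
  calc
    _ = 𝟙 _ ⊗≫ (𝟙_ C ◁ E.coev' ≫ D.coev ▷ (Z ⊗ E.dual)) ⊗≫ D.dual ◁ f ▷ E.dual ⊗≫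
          (D.ev' ▷ (Z ⊗ E.dual) ≫ 𝟙_ C ◁ E.ev) ⊗≫ 𝟙 _ := by monoidal
    _ = _ := by rw [whisker_exchange D.coev, ← whisker_exchange D.ev']; monoidal

end BalancedDual

namespace SphericalDual

variable {X Z : C} (D : SphericalDual X) (E : SphericalDual Z)

/-- The tensor product of spherical duals is spherical. -/
def tensor : SphericalDual (X ⊗ Z) where
  dual := E.dual ⊗ D.dual
  pairing :=
    { coevaluation' := D.tensorCoev E.toBalancedDual
      evaluation' := D.tensorEv E.toBalancedDual
      coevaluation_evaluation' := D.tensor_zigzag E.toBalancedDual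
      evaluation_coevaluation' := D.tensor_zigzag_dual E.toBalancedDual }
  balanced := by
    have h1 := D.tensor_leftTrace E.toBalancedDual (𝟙 _)
    have h2 := D.tensor_rightTrace E.toBalancedDual (𝟙 _)
    rw [E.spherical, BalancedDual.rightTrace_partialTrace, D.spherical, ← h2] at h1
    simp only [whiskerLeft_id, id_whiskerRight, Category.id_comp] at h1
    exact h1
  spherical f := by
    have h1 := D.tensor_leftTrace E.toBalancedDual f
    have h2 := D.tensor_rightTrace E.toBalancedDual f
    rw [E.spherical, BalancedDual.rightTrace_partialTrace, D.spherical, ← h2] at h1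
    exact h1

theorem tensor_partialTrace {y k : C} (h : (X ⊗ Z) ⊗ y ⟶ (X ⊗ Z) ⊗ k) :
    (D.tensor E).partialTrace h =
      E.partialTrace (D.partialTrace ((α_ X Z y).inv ≫ h ≫ (α_ X Z k).hom)) := by
  have h1 : (D.tensor E).partialTrace h = (λ_ y).inv ≫ D.tensorCoev E.toBalancedDual ▷ y ≫
    (α_ (E.dual ⊗ D.dual) (X ⊗ Z) y).hom ≫ (E.dual ⊗ D.dual) ◁ h ≫
    (α_ (E.dual ⊗ D.dual) (X ⊗ Z) k).inv ≫ dag (D.tensorCoev E.toBalancedDual) ▷ k ≫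
    (λ_ k).hom := rfl
  rw [h1, BalancedDual.dag_tensorCoev, BalancedDual.partialTrace_eq, BalancedDual.partialTrace_eq]
  unfold BalancedDual.tensorCoev
  monoidal

theorem leftTrace_tensor (f : X ⊗ Z ⟶ X ⊗ Z) :
    (D.tensor E).leftTrace f = D.leftTrace (E.rightPartialTrace f) := by
  rw [← BalancedDual.rightTrace_partialTrace, ← E.spherical]
  exact D.tensor_leftTrace E.toBalancedDual f

/-- The spherical dual of the unit object. -/
def unit : SphericalDual (𝟙_ C) where
  dual := 𝟙_ C
  pairing :=
    { coevaluation' := (λ_ (𝟙_ C)).inv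
      evaluation' := (λ_ (𝟙_ C)).hom
      coevaluation_evaluation' := by monoidal
      evaluation_coevaluation' := by monoidal }
  balanced := by
    change (λ_ (𝟙_ C)).inv ≫ dag (λ_ (𝟙_ C)).inv = dag (λ_ (𝟙_ C)).hom ≫ (λ_ (𝟙_ C)).hom
    rw [dag_leftUnitor_inv, UnitaryFusionCategory.dag_leftUnitor]
  spherical f := by
    change (λ_ (𝟙_ C)).inv ≫ (𝟙_ C) ◁ f ≫ dag (λ_ (𝟙_ C)).inv =
      dag (λ_ (𝟙_ C)).hom ≫ f ▷ (𝟙_ C) ≫ (λ_ (𝟙_ C)).hom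
    rw [dag_leftUnitor_inv, UnitaryFusionCategory.dag_leftUnitor]
    monoidal

theorem unit_partialTrace {y k : C} (h : 𝟙_ C ⊗ y ⟶ 𝟙_ C ⊗ k) :
    (unit (C := C)).partialTrace h = (λ_ y).inv ≫ h ≫ (λ_ k).hom := by
  have h1 : (unit (C := C)).partialTrace h = (λ_ y).inv ≫ (λ_ (𝟙_ C)).inv ▷ y ≫
    (α_ (𝟙_ C) (𝟙_ C) y).hom ≫ (𝟙_ C) ◁ h ≫ (α_ (𝟙_ C) (𝟙_ C) k).inv ≫
    dag (λ_ (𝟙_ C)).inv ▷ k ≫ (λ_ k).hom := rfl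
  rw [h1, dag_leftUnitor_inv]
  monoidal

end SphericalDual

end CategoryTheory

/-! ### Strings that slide through half-braidings, and the composition of tubes -/

namespace CategoryTheory

open DaggerCategory

section Slide

variable {C : Type u} [Category.{v} C] [MonoidalCategory C]

/-- A cup passes through a half-braiding. -/
theorem HalfBraiding.cup_slide {A : C} (b : HalfBraiding A) {c d : C} (s : 𝟙_ C ⟶ c ⊗ d) :
    s ▷ A ⊗≫ c ◁ (b.β d).inv = 𝟙 _ ⊗≫ A ◁ s ⊗≫ (b.β c).hom ▷ d ⊗≫ 𝟙 _ := by
  have h := b.inv_nat s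
  rw [b.inv_tensor, b.inv_unit] at h
  calc
    _ = (s ▷ A ≫ (α_ c d A).hom ≫ c ◁ (b.β d).inv ≫ (α_ c A d).inv ≫
          (b.β c).inv ▷ d ≫ (α_ A c d).hom) ⊗≫ (b.β c).hom ▷ d ⊗≫ 𝟙 _ := by
      have : (b.β c).inv ▷ d ⊗≫ (b.β c).hom ▷ d = 𝟙 _ := by
        rw [monoidalComp]; simp [← comp_whiskerRight]
      calc
        _ = s ▷ A ⊗≫ c ◁ (b.β d).inv ⊗≫ 𝟙 ((c ⊗ A) ⊗ d) ⊗≫ 𝟙 _ := by monoidal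
        _ = _ := by rw [← this]; monoidal
    _ = _ := by rw [h]; monoidal

theorem HalfBraiding.hom_unit {A : C} (b : HalfBraiding A) :
    (b.β (𝟙_ C)).hom = (ρ_ A).hom ≫ (λ_ A).inv := by
  rw [← cancel_epi (b.β (𝟙_ C)).inv, Iso.inv_hom_id, b.inv_unit]
  simp

/-- A cap passes through a half-braiding. -/
theorem HalfBraiding.cap_slide {A : C} (b : HalfBraiding A) {c d : C} (e : c ⊗ d ⟶ 𝟙_ C) :
    c ◁ (b.β d).hom ⊗≫ e ▷ A = 𝟙 _ ⊗≫ (b.β c).inv ▷ d ⊗≫ A ◁ e ⊗≫ 𝟙 _ := by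
  have h : (b.β (c ⊗ d)).hom ≫ e ▷ A = A ◁ e ≫ (ρ_ A).hom ≫ (λ_ A).inv := by
    rw [← b.naturality]
    rw [b.hom_unit]
  rw [b.monoidal] at h
  calc
    _ = 𝟙 _ ⊗≫ (b.β c).inv ▷ d ⊗≫ ((α_ _ _ _).inv ≫
        ((b.β c).hom ▷ d) ≫ (α_ _ _ _).hom ≫ (c ◁ (b.β d).hom) ≫ (α_ _ _ _).inv) ≫ e ▷ A := by
      have : (b.β c).inv ▷ d ⊗≫ (b.β c).hom ▷ d = 𝟙 _ := by
        rw [monoidalComp]; simp [← comp_whiskerRight]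
      calc
        _ = 𝟙 _ ⊗≫ 𝟙 ((c ⊗ A) ⊗ d) ⊗≫ c ◁ (b.β d).hom ⊗≫ e ▷ A := by monoidal
        _ = _ := by rw [← this]; monoidal
    _ = _ := by rw [h]; monoidal

end Slide

variable {C : Type u} [Category.{v} C] [Abelian C] [Linear ℂ C] [MonoidalCategory C]
  [MonoidalPreadditive C] [MonoidalLinear ℂ C] [RigidCategory C] [DaggerCategory C]
  [UnitaryFusionCategory C]

/-- A closed string may be pulled off a string with a half-braiding. -/
theorem BalancedDual.partialTrace_slide {A c : C} (D : BalancedDual c) (b : HalfBraiding A)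
    {y k : C} (N : c ⊗ y ⟶ c ⊗ k) :
    D.partialTrace ((α_ c A y).inv ≫ (b.β c).inv ▷ y ≫ (α_ A c y).hom ≫ A ◁ N ≫
      (α_ A c k).inv ≫ (b.β c).hom ▷ k ≫ (α_ c A k).hom) = A ◁ D.partialTrace N := by
  rw [partialTrace_eq, partialTrace_eq]
  calc
    _ = 𝟙 _ ⊗≫ (D.coev ▷ A ⊗≫ D.dual ◁ (b.β c).inv) ▷ y ⊗≫ D.dual ◁ A ◁ N ⊗≫
          (D.dual ◁ (b.β c).hom ⊗≫ D.ev' ▷ A) ▷ k ⊗≫ 𝟙 _ := by monoidal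
    _ = 𝟙 _ ⊗≫ A ◁ D.coev ▷ y ⊗≫ ((b.β D.dual).hom ▷ (c ⊗ y) ≫ (D.dual ⊗ A) ◁ N) ⊗≫
          (b.β D.dual).inv ▷ (c ⊗ k) ⊗≫ A ◁ D.ev' ▷ k ⊗≫ 𝟙 _ := by
      rw [b.cup_slide, b.cap_slide]; monoidal
    _ = 𝟙 _ ⊗≫ A ◁ D.coev ▷ y ⊗≫ (A ⊗ D.dual) ◁ N ⊗≫
          ((b.β D.dual).hom ≫ (b.β D.dual).inv) ▷ (c ⊗ k) ⊗≫ A ◁ D.ev' ▷ k ⊗≫ 𝟙 _ := by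
      rw [← whisker_exchange]; monoidal
    _ = _ := by rw [Iso.hom_inv_id]; monoidal

section TubeAct

variable {A : Center C} [MonObj A] (K : Center C) [ModObj A K]

open scoped MonoidalLeftAction

/-- The action of `A` on `K`, as a morphism of `C`. -/
def smulMap (A K : Center C) [MonObj A] [ModObj A K] : A.1 ⊗ K.1 ⟶ K.1 :=
  (γ[A, K] : A ⊗ K ⟶ K).f

theorem one_smulMap : Tube.oneMap A ▷ K.1 ≫ smulMap A K = (λ_ K.1).hom :=
  congrArg Center.Hom.f (ModObj.one_smul_self A K)

theorem mul_smulMap : Tube.mulMap A ▷ K.1 ≫ smulMap A K =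
    (α_ A.1 A.1 K.1).hom ≫ A.1 ◁ smulMap A K ≫ smulMap A K :=
  congrArg Center.Hom.f (ModObj.mul_smul_self A K)

theorem smulMap_comm (c : C) : smulMap A K ▷ c ≫ (K.2.β c).hom =
    (α_ A.1 K.1 c).hom ≫ A.1 ◁ (K.2.β c).hom ≫ (α_ A.1 c K.1).inv ≫ (A.2.β c).hom ▷ K.1 ≫
      (α_ c A.1 K.1).hom ≫ c ◁ smulMap A K := by
  have h : smulMap A K ▷ c ≫ (K.2.β c).hom = ((α_ A.1 K.1 c).hom ≫ A.1 ◁ (K.2.β c).hom ≫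
    (α_ A.1 c K.1).inv ≫ (A.2.β c).hom ▷ K.1 ≫ (α_ c A.1 K.1).hom) ≫ c ◁ smulMap A K :=
    (γ[A, K] : A ⊗ K ⟶ K).comm c
  simpa only [Category.assoc] using h

/-- A tube diagram below `h : y ⟶ K`, with the action of `A` on `K` and the half-braiding of `K`
applied, before the string around the tube is closed up. -/
def tubeAct {y c c' : C} (h : y ⟶ K.1) (f : c ⊗ y ⟶ A.1 ⊗ (y ⊗ c')) : c ⊗ y ⟶ c' ⊗ K.1 :=
  f ≫ A.1 ◁ (h ▷ c') ≫ (α_ A.1 K.1 c').inv ≫ smulMap A K ▷ c' ≫ (K.2.β c').hom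

/-- Morphisms slide off both ends of the string around the tube. -/
theorem tubeAct_nat {y c₁ c₂ c₃ c₄ : C} (h : y ⟶ K.1) (s : c₁ ⟶ c₂)
    (f : c₂ ⊗ y ⟶ A.1 ⊗ (y ⊗ c₃)) (t : c₃ ⟶ c₄) :
    tubeAct K h (s ▷ y ≫ f ≫ A.1 ◁ (y ◁ t)) = s ▷ y ≫ tubeAct K h f ≫ t ▷ K.1 := by
  unfold tubeAct
  simp only [Category.assoc]
  rw [← K.2.naturality, ← whisker_exchange_assoc (smulMap A K) t]
  simp only [← MonoidalCategory.whiskerLeft_comp_assoc, whisker_exchange]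
  monoidal

/-- Acting by a composite of tube diagrams is acting by one after the other. -/
theorem partialTrace_tubeAct_tubeComp {y c d d' : C} (D : BalancedDual c) (h : y ⟶ K.1)
    (f : c ⊗ y ⟶ A.1 ⊗ (y ⊗ c)) (g : d ⊗ y ⟶ A.1 ⊗ (y ⊗ d')) :
    D.partialTrace ((α_ c d y).inv ≫ tubeAct K h (tubeComp A.2 (Tube.mulMap A) f g) ≫
      (α_ c d' K.1).hom) = tubeAct K (D.partialTrace (tubeAct K h f)) g := by
  have key : (α_ c d y).inv ≫ tubeAct K h (tubeComp A.2 (Tube.mulMap A) f g) ≫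
      (α_ c d' K.1).hom = c ◁ g ≫ ((α_ c A.1 (y ⊗ d')).inv ≫ (A.2.β c).inv ▷ (y ⊗ d') ≫
        (α_ A.1 c (y ⊗ d')).hom ≫ A.1 ◁ ((α_ c y d').inv ≫ tubeAct K h f ▷ d' ≫
          (α_ c K.1 d').hom) ≫ (α_ A.1 c (K.1 ⊗ d')).inv ≫ (A.2.β c).hom ▷ (K.1 ⊗ d') ≫
          (α_ c A.1 (K.1 ⊗ d')).hom) ≫
        c ◁ ((α_ A.1 K.1 d').inv ≫ smulMap A K ▷ d' ≫ (K.2.β d').hom) := by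
    calc
      _ = 𝟙 _ ⊗≫ c ◁ g ⊗≫ (A.2.β c).inv ▷ (y ⊗ d') ⊗≫ A.1 ◁ (f ▷ d') ⊗≫
            (Tube.mulMap A ▷ ((y ⊗ c) ⊗ d') ≫ A.1 ◁ (h ▷ c ▷ d')) ⊗≫
            smulMap A K ▷ (c ⊗ d') ⊗≫ (K.2.β c).hom ▷ d' ⊗≫ c ◁ (K.2.β d').hom ⊗≫ 𝟙 _ := by
        unfold tubeAct tubeComp
        rw [K.2.monoidal]
        monoidal
      _ = 𝟙 _ ⊗≫ c ◁ g ⊗≫ (A.2.β c).inv ▷ (y ⊗ d') ⊗≫ A.1 ◁ (f ▷ d') ⊗≫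
            (A.1 ⊗ A.1) ◁ (h ▷ c ▷ d') ⊗≫
            (Tube.mulMap A ▷ K.1 ≫ smulMap A K) ▷ (c ⊗ d') ⊗≫ (K.2.β c).hom ▷ d' ⊗≫
            c ◁ (K.2.β d').hom ⊗≫ 𝟙 _ := by
        rw [← whisker_exchange]; monoidal
      _ = 𝟙 _ ⊗≫ c ◁ g ⊗≫ (A.2.β c).inv ▷ (y ⊗ d') ⊗≫ A.1 ◁ (f ▷ d') ⊗≫
            (A.1 ⊗ A.1) ◁ (h ▷ c ▷ d') ⊗≫ A.1 ◁ smulMap A K ▷ c ▷ d' ⊗≫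
            (smulMap A K ▷ c ≫ (K.2.β c).hom) ▷ d' ⊗≫ c ◁ (K.2.β d').hom ⊗≫ 𝟙 _ := by
        rw [mul_smulMap]; monoidal
      _ = _ := by
        rw [smulMap_comm]
        unfold tubeAct
        monoidal
  rw [key, ← BalancedDual.comp_partialTrace, ← BalancedDual.partialTrace_comp,
    BalancedDual.partialTrace_slide]
  have h2 : D.partialTrace ((α_ c y d').inv ≫ tubeAct K h f ▷ d' ≫ (α_ c K.1 d').hom) =
      D.partialTrace (tubeAct K h f) ▷ d' := by
    rw [BalancedDual.partialTrace_eq, BalancedDual.partialTrace_eq]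
    monoidal
  rw [h2]
  rfl

end TubeAct

end CategoryTheory

/-! ### Representations of the tube algebra -/

namespace CategoryTheory

open DaggerCategory

variable {C : Type u} [Category.{v} C] [Abelian C] [Linear ℂ C] [MonoidalCategory C]
  [MonoidalPreadditive C] [MonoidalLinear ℂ C] [RigidCategory C] [DaggerCategory C]
  [UnitaryFusionCategory C] {J : Type w} [Fintype J] {irr : SimpleReps C J}

section

variable {A : Center C} [MonObj A] (K : Center C) [ModObj A K]

theorem tubeAct_add {y c c' : C} (h : y ⟶ K.1) (f g : c ⊗ y ⟶ A.1 ⊗ (y ⊗ c')) :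
    tubeAct K h (f + g) = tubeAct K h f + tubeAct K h g := by
  simp [tubeAct]

theorem tubeAct_smul {y c c' : C} (r : ℂ) (h : y ⟶ K.1) (f : c ⊗ y ⟶ A.1 ⊗ (y ⊗ c')) :
    tubeAct K h (r • f) = r • tubeAct K h f := by
  simp [tubeAct]

theorem add_tubeAct {y c c' : C} (h h' : y ⟶ K.1) (f : c ⊗ y ⟶ A.1 ⊗ (y ⊗ c')) :
    tubeAct K (h + h') f = tubeAct K h f + tubeAct K h' f := by
  simp [tubeAct]

theorem smul_tubeAct {y c c' : C} (r : ℂ) (h : y ⟶ K.1) (f : c ⊗ y ⟶ A.1 ⊗ (y ⊗ c')) :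
    tubeAct K (r • h) f = r • tubeAct K h f := by
  simp [tubeAct]

theorem tubeAct_tubeUnit {y : C} (h : y ⟶ K.1) :
    tubeAct K h (tubeUnit (Tube.oneMap A) y) = (λ_ y).hom ≫ h ≫ (λ_ K.1).inv := by
  unfold tubeAct tubeUnit
  rw [K.2.hom_unit]
  calc
    _ = 𝟙 _ ⊗≫ (Tube.oneMap A ▷ y ≫ A.1 ◁ h) ⊗≫ smulMap A K ⊗≫ 𝟙 _ := by monoidal
    _ = 𝟙 _ ⊗≫ h ⊗≫ (Tube.oneMap A ▷ K.1 ≫ smulMap A K) ⊗≫ 𝟙 _ := by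
      rw [← whisker_exchange]; monoidal
    _ = _ := by rw [one_smulMap]; monoidal

end

namespace Tube

variable (dual : ∀ i, BalancedDual (irr.obj i))

/-- The chosen duals of the simple objects are spherical. -/
def sphericalDual (i : J) : SphericalDual (irr.obj i) :=
  SphericalDual.ofSimple (irr.simple i) (dual i)

variable {A : Center C} [MonObj A] (K : Center C) [ModObj A K]

theorem act_def (h : irr.sum ⟶ K.1) (f : Tube irr A) :
    act dual K h f = ∑ i, (dual i).partialTrace (tubeAct K h (f i)) := rfl

theorem act_add (h : irr.sum ⟶ K.1) (f g : Tube irr A) :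
    act dual K h (f + g) = act dual K h f + act dual K h g := by
  simp only [act_def, add_apply, tubeAct_add, BalancedDual.partialTrace_add,
    Finset.sum_add_distrib]

theorem act_smul (r : ℂ) (h : irr.sum ⟶ K.1) (f : Tube irr A) :
    act dual K h (r • f) = r • act dual K h f := by
  simp only [act_def, smul_apply, tubeAct_smul, BalancedDual.partialTrace_smul, Finset.smul_sum]

theorem add_act (h h' : irr.sum ⟶ K.1) (f : Tube irr A) :
    act dual K (h + h') f = act dual K h f + act dual K h' f := by
  simp only [act_def, add_tubeAct, BalancedDual.partialTrace_add, Finset.sum_add_distrib]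

theorem smul_act (r : ℂ) (h : irr.sum ⟶ K.1) (f : Tube irr A) :
    act dual K (r • h) f = r • act dual K h f := by
  simp only [act_def, smul_tubeAct, BalancedDual.partialTrace_smul, Finset.smul_sum]

/-- The action of the tube algebra on `C(Y → K)`, as a bilinear map. -/
noncomputable def actHom : (irr.sum ⟶ K.1) →ₗ[ℂ] Tube irr A →ₗ[ℂ] (irr.sum ⟶ K.1) :=
  LinearMap.mk₂ ℂ (act dual K) (add_act dual K) (smul_act dual K) (act_add dual K)
    (fun r h f => act_smul dual K r h f)

theorem act_sum {κ : Type*} (s : Finset κ) (h : irr.sum ⟶ K.1) (f : κ → Tube irr A) :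
    act dual K h (∑ i ∈ s, f i) = ∑ i ∈ s, act dual K h (f i) :=
  map_sum (actHom dual K h) f s

theorem sum_act {κ : Type*} (s : Finset κ) (h : κ → (irr.sum ⟶ K.1)) (f : Tube irr A) :
    act dual K (∑ i ∈ s, h i) f = ∑ i ∈ s, act dual K (h i) f :=
  map_sum ((actHom dual K).flip f) h s

theorem act_single (h : irr.sum ⟶ K.1) (i : J)
    (f : irr.obj i ⊗ irr.sum ⟶ A.1 ⊗ (irr.sum ⊗ irr.obj i)) :
    act dual K h (single i f) = (dual i).partialTrace (tubeAct K h f) := by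
  classical
  rw [act_def, Finset.sum_eq_single i]
  · congr 2
    exact Pi.single_eq_same (M := fun i : J => (irr.obj i ⊗ irr.sum ⟶
      A.1 ⊗ (irr.sum ⊗ irr.obj i))) i f
  · intro j _ hj
    have : (single i f : Tube irr A) j = 0 :=
      Pi.single_eq_of_ne (M := fun i : J => (irr.obj i ⊗ irr.sum ⟶
        A.1 ⊗ (irr.sum ⊗ irr.obj i))) hj f
    rw [this]
    simp [tubeAct, BalancedDual.partialTrace]
  · simp

/-- Acting by a tube diagram whose string is labelled by an arbitrary object: the string can be
closed up without resolving it. -/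
theorem act_of {c : C} (D : SphericalDual c) (h : irr.sum ⟶ K.1)
    (f : c ⊗ irr.sum ⟶ A.1 ⊗ (irr.sum ⊗ c)) :
    act dual K h (of c f) = D.partialTrace (tubeAct K h f) := by
  unfold of
  set R := resolution irr c
  have h1 : ∀ k, (dual (R.t k)).partialTrace (R.a k ▷ irr.sum ≫ tubeAct K h f ≫ R.b k ▷ K.1) =
      D.partialTrace (tubeAct K h f ≫ (R.b k ≫ R.a k) ▷ K.1) := by
    intro k
    have := D.partialTrace_cyc (sphericalDual dual (R.t k)) (R.a k) (tubeAct K h f ≫ R.b k ▷ K.1)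
    rw [comp_whiskerRight, ← Category.assoc (tubeAct K h f)]
    exact this
  simp only [act_sum, act_single, tubeAct_nat, h1]
  rw [← BalancedDual.partialTrace_sum, ← Preadditive.comp_sum, ← sum_whiskerRight, R.complete,
    id_whiskerRight, Category.comp_id]

/-- The right action is multiplicative: a tube around two parallel strings is a tube around a tube.
-/
theorem act_mul (h : irr.sum ⟶ K.1) (f g : Tube irr A) :
    act dual K h (f * g) = act dual K (act dual K h f) g := by
  have key : ∀ i j, act dual K h
      (of (irr.obj i ⊗ irr.obj j) (tubeComp A.2 (mulMap A) (f i) (g j))) =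
      act dual K (act dual K h (single i (f i))) (single j (g j)) := by
    intro i j
    rw [act_of dual K ((sphericalDual dual i).tensor (sphericalDual dual j)),
      SphericalDual.tensor_partialTrace, partialTrace_tubeAct_tubeComp, act_single, act_single]
    rfl
  rw [mul_def]
  simp only [act_sum, key]
  simp only [← sum_act, ← act_sum, sum_single]

theorem act_one (h : irr.sum ⟶ K.1) : act dual K h (1 : Tube irr A) = h := by
  rw [one_def, act_of dual K SphericalDual.unit, SphericalDual.unit_partialTrace,
    tubeAct_tubeUnit]
  simp

/-- An endomorphism of `Y` as an element of the tube algebra: the string around the tube is the unit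
object, and the strand in `A` is the unit of `A`. -/
noncomputable def ofEnd (A : Center C) [MonObj A] (u : irr.sum ⟶ irr.sum) : Tube irr A :=
  of (𝟙_ C) (𝟙_ C ◁ u ≫ tubeUnit (oneMap A) irr.sum)

theorem act_ofEnd (h : irr.sum ⟶ K.1) (u : irr.sum ⟶ irr.sum) :
    act dual K h (ofEnd A u) = u ≫ h := by
  have : tubeAct K h (𝟙_ C ◁ u ≫ tubeUnit (oneMap A) irr.sum) =
      𝟙_ C ◁ u ≫ tubeAct K h (tubeUnit (oneMap A) irr.sum) := by
    simp [tubeAct]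
  rw [ofEnd, act_of dual K SphericalDual.unit, this, SphericalDual.unit_partialTrace,
    tubeAct_tubeUnit]
  simp

/-- The vector space `C(Y → K)` for an `A`-module `K` in the center, as a representation of the
`A`-tube algebra. The right action is encoded as a module structure over the opposite algebra. The
duals, on which the action depends, are kept as an argument so that it can be found by unification.
-/
@[nolint unusedArguments]
def Rep (_dual : ∀ i, BalancedDual (irr.obj i)) (A : Center C) [MonObj A] (K : Center C)
    [ModObj A K] : Type v := irr.sum ⟶ K.1

namespace Rep

noncomputable instance : AddCommGroup (Rep dual A K) :=
  inferInstanceAs (AddCommGroup (irr.sum ⟶ K.1))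

noncomputable instance : Module ℂ (Rep dual A K) :=
  inferInstanceAs (Module ℂ (irr.sum ⟶ K.1))

noncomputable instance : Module (Tube irr A)ᵐᵒᵖ (Rep dual A K) where
  smul f h := act dual K h f.unop
  one_smul h := act_one dual K h
  mul_smul f g h := act_mul dual K h g.unop f.unop
  smul_zero f := map_zero ((actHom dual K).flip f.unop)
  smul_add f h h' := add_act dual K h h' f.unop
  add_smul f g h := act_add dual K h f.unop g.unop
  zero_smul h := map_zero (actHom dual K h)

instance : IsScalarTower ℂ (Tube irr A)ᵐᵒᵖ (Rep dual A K) where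
  smul_assoc r f h := act_smul dual K r h f.unop

instance : Module.Finite ℂ (Rep dual A K) :=
  UnitaryFusionCategory.finite_hom irr.sum K.1

end Rep

instance : Module.Finite ℂ (Tube irr A) :=
  haveI : ∀ i, Module.Finite ℂ (irr.obj i ⊗ irr.sum ⟶ A.1 ⊗ (irr.sum ⊗ irr.obj i)) :=
    fun _ => UnitaryFusionCategory.finite_hom _ _
  inferInstanceAs
    (Module.Finite ℂ (∀ i : J, irr.obj i ⊗ irr.sum ⟶ A.1 ⊗ (irr.sum ⊗ irr.obj i)))

end Tube

end CategoryTheory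

/-! ### Modules in the center embed fully faithfully into representations -/

namespace CategoryTheory

open DaggerCategory

section

variable {C : Type u} [Category.{v} C] [Abelian C] {J : Type w} [Fintype J]

namespace SimpleReps

variable (irr : SimpleReps C J)

/-- The inclusion of a simple object into `Y`. -/
noncomputable def incl (i : J) : irr.obj i ⟶ irr.sum :=
  haveI := Abelian.hasFiniteBiproducts (C := C)
  Limits.biproduct.ι irr.obj i

/-- The projection of `Y` onto a simple object. -/
noncomputable def proj (i : J) : irr.sum ⟶ irr.obj i :=
  haveI := Abelian.hasFiniteBiproducts (C := C)
  Limits.biproduct.π irr.obj i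

theorem incl_proj (i : J) : irr.incl i ≫ irr.proj i = 𝟙 _ :=
  haveI := Abelian.hasFiniteBiproducts (C := C)
  Limits.biproduct.ι_π_self irr.obj i

theorem incl_proj_ne {i j : J} (h : i ≠ j) : irr.incl i ≫ irr.proj j = 0 :=
  haveI := Abelian.hasFiniteBiproducts (C := C)
  Limits.biproduct.ι_π_ne irr.obj h

theorem sum_proj_incl : ∑ i, irr.proj i ≫ irr.incl i = 𝟙 irr.sum := by
  have := Abelian.hasFiniteBiproducts (C := C)
  refine Limits.biproduct.hom_ext _ _ fun j => ?_
  change _ ≫ irr.proj j = 𝟙 irr.sum ≫ irr.proj j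
  rw [Preadditive.sum_comp, Finset.sum_eq_single j, Category.assoc, incl_proj]
  · simp
  · intro i _ hij
    rw [Category.assoc, irr.incl_proj_ne hij, Limits.comp_zero]
  · simp

end SimpleReps

end

variable {C : Type u} [Category.{v} C] [Abelian C] [Linear ℂ C] [MonoidalCategory C]
  [MonoidalPreadditive C] [MonoidalLinear ℂ C] [RigidCategory C] [DaggerCategory C]
  [UnitaryFusionCategory C] {J : Type w} [Fintype J] (irr : SimpleReps C J)

namespace SimpleReps

/-- Morphisms are determined by their values on simple objects. -/
theorem hom_ext_obj {c d : C} {f g : c ⟶ d} (h : ∀ i (s : irr.obj i ⟶ c), s ≫ f = s ≫ g) :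
    f = g := by
  have key : ∀ f : c ⟶ d, f = ∑ k, (resolution irr c).b k ≫ (resolution irr c).a k ≫ f := by
    intro f
    simp only [← Category.assoc, ← Preadditive.sum_comp, (resolution irr c).complete,
      Category.id_comp]
  rw [key f, key g]
  simp only [h]

/-- The object `Y` is a generator. -/
theorem hom_ext_sum {c d : C} {f g : c ⟶ d} (h : ∀ s : irr.sum ⟶ c, s ≫ f = s ≫ g) :
    f = g := by
  refine irr.hom_ext_obj fun i s => ?_
  have := congrArg (irr.incl i ≫ ·) (h (irr.proj i ≫ s))
  simpa only [← Category.assoc, incl_proj, Category.id_comp] using this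

/-- A linear map `C(Y → c) → C(Y → d)` that commutes with precomposition by endomorphisms of `Y`
is postcomposition by a morphism. -/
theorem exists_comp_eq {c d : C} (T : (irr.sum ⟶ c) →ₗ[ℂ] (irr.sum ⟶ d))
    (hT : ∀ (u : irr.sum ⟶ irr.sum) h, T (u ≫ h) = u ≫ T h) :
    ∃ t : c ⟶ d, ∀ h, T h = h ≫ t := by
  set R := resolution irr c
  refine ⟨∑ k, R.b k ≫ irr.incl _ ≫ T (irr.proj _ ≫ R.a k), fun h => ?_⟩
  have h1 : h = ∑ k, (h ≫ R.b k ≫ irr.incl _) ≫ irr.proj _ ≫ R.a k := by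
    have : ∀ k, (h ≫ R.b k ≫ irr.incl _) ≫ irr.proj _ ≫ R.a k = h ≫ R.b k ≫ R.a k := by
      intro k
      simp only [Category.assoc]
      rw [← Category.assoc (irr.incl _), incl_proj, Category.id_comp]
    simp only [this, ← Preadditive.comp_sum, R.complete, Category.comp_id]
  conv_lhs => rw [h1]
  simp only [map_sum, hT, Preadditive.comp_sum]
  simp only [Category.assoc]

end SimpleReps

/-- The partial trace is nondegenerate: a morphism into `x ⊗ k` is determined by the partial traces
of its composites with all morphisms from `x ⊗ Y`. -/
theorem BalancedDual.partialTrace_ext {x z k : C} (D : BalancedDual x) {P Q : z ⟶ x ⊗ k}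
    (h : ∀ g : x ⊗ irr.sum ⟶ z, D.partialTrace (g ≫ P) = D.partialTrace (g ≫ Q)) : P = Q := by
  rw [← D.unbend'_bend' P, ← D.unbend'_bend' Q]
  congr 1
  refine irr.hom_ext_sum fun s => ?_
  have := h (D.unbend s)
  rwa [partialTrace_comp_eq, partialTrace_comp_eq, bend_unbend] at this

section

variable {A : Center C} [MonObj A] (K L : Center C) [ModObj A K] [ModObj A L]

/-- The action of `A` on `K`, followed by the half-braiding of `K`. -/
def smulBraid (A K : Center C) [MonObj A] [ModObj A K] (c : C) :
    A.1 ⊗ (K.1 ⊗ c) ⟶ c ⊗ K.1 :=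
  (α_ A.1 K.1 c).inv ≫ smulMap A K ▷ c ≫ (K.2.β c).hom

theorem tubeAct_eq {y c c' : C} (h : y ⟶ K.1) (f : c ⊗ y ⟶ A.1 ⊗ (y ⊗ c')) :
    tubeAct K h f = f ≫ A.1 ◁ (h ▷ c') ≫ smulBraid A K c' := rfl

theorem smulBraid_nat {c d : C} (s : c ⟶ d) :
    A.1 ◁ (K.1 ◁ s) ≫ smulBraid A K d = smulBraid A K c ≫ s ▷ K.1 := by
  unfold smulBraid
  simp only [Category.assoc]
  rw [← K.2.naturality, ← whisker_exchange_assoc (smulMap A K) s]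
  monoidal

theorem smulBraid_unit :
    smulBraid A K (𝟙_ C) = A.1 ◁ (ρ_ K.1).hom ≫ smulMap A K ≫ (λ_ K.1).inv := by
  unfold smulBraid
  rw [K.2.hom_unit]
  monoidal

theorem oneMap_smulBraid (c : C) :
    Tube.oneMap A ▷ (K.1 ⊗ c) ≫ smulBraid A K c = (λ_ (K.1 ⊗ c)).hom ≫ (K.2.β c).hom := by
  unfold smulBraid
  calc
    _ = 𝟙 _ ⊗≫ (Tube.oneMap A ▷ K.1 ≫ smulMap A K) ▷ c ⊗≫ (K.2.β c).hom := by monoidal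
    _ = _ := by rw [one_smulMap]; monoidal

variable {K L}

/-- Compatibility with the action and the half-braiding need only be checked on simple objects. -/
theorem comm_of_comm_obj {irr : SimpleReps C J} {t : K.1 ⟶ L.1}
    (h : ∀ i, smulBraid A K (irr.obj i) ≫ irr.obj i ◁ t =
      A.1 ◁ (t ▷ irr.obj i) ≫ smulBraid A L (irr.obj i)) (c : C) :
    smulBraid A K c ≫ c ◁ t = A.1 ◁ (t ▷ c) ≫ smulBraid A L c := by
  set R := resolution irr c
  have h1 : smulBraid A K c ≫ c ◁ t =
      ∑ k, A.1 ◁ (K.1 ◁ R.b k) ≫ (smulBraid A K _ ≫ _ ◁ t) ≫ R.a k ▷ L.1 := by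
    have : ∀ k, A.1 ◁ (K.1 ◁ R.b k) ≫ (smulBraid A K _ ≫ _ ◁ t) ≫ R.a k ▷ L.1 =
        smulBraid A K c ≫ (R.b k ≫ R.a k) ▷ K.1 ≫ c ◁ t := by
      intro k
      rw [Category.assoc, whisker_exchange, ← Category.assoc, smulBraid_nat, comp_whiskerRight]
      simp only [Category.assoc]
    simp only [this]
    rw [← Preadditive.comp_sum, ← Preadditive.sum_comp, ← sum_whiskerRight, R.complete]
    simp
  have h2 : A.1 ◁ (t ▷ c) ≫ smulBraid A L c =
      ∑ k, A.1 ◁ (K.1 ◁ R.b k) ≫ (A.1 ◁ (t ▷ _) ≫ smulBraid A L _) ≫ R.a k ▷ L.1 := by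
    have : ∀ k, A.1 ◁ (K.1 ◁ R.b k) ≫ (A.1 ◁ (t ▷ _) ≫ smulBraid A L _) ≫ R.a k ▷ L.1 =
        (A.1 ◁ (t ▷ c) ≫ smulBraid A L c) ≫ (R.b k ≫ R.a k) ▷ L.1 := by
      intro k
      rw [Category.assoc, ← MonoidalCategory.whiskerLeft_comp_assoc, whisker_exchange,
        comp_whiskerRight]
      simp only [Category.assoc]
      rw [← reassoc_of% smulBraid_nat L (R.b k), MonoidalCategory.whiskerLeft_comp,
        ← smulBraid_nat]
      simp only [Category.assoc]
    simp only [this]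
    rw [← Preadditive.comp_sum, ← sum_whiskerRight, R.complete]
    simp
  rw [h1, h2]
  simp only [h]

/-- A morphism that commutes with the combined action and half-braiding is a morphism of
modules in the center. -/
theorem exists_center_hom {t : K.1 ⟶ L.1}
    (h : ∀ c, smulBraid A K c ≫ c ◁ t = A.1 ◁ (t ▷ c) ≫ smulBraid A L c) :
    ∃ s : K ⟶ L, s.f = t ∧ smulMap A K ≫ t = A.1 ◁ t ≫ smulMap A L := by
  refine ⟨⟨t, fun c => ?_⟩, rfl, ?_⟩
  · have h1 : (λ_ (K.1 ⊗ c)).hom ≫ t ▷ c ≫ (L.2.β c).hom =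
        Tube.oneMap A ▷ (K.1 ⊗ c) ≫ A.1 ◁ (t ▷ c) ≫ smulBraid A L c := by
      rw [← whisker_exchange_assoc, oneMap_smulBraid]
      simp
    rw [← h, reassoc_of% oneMap_smulBraid K c] at h1
    exact (cancel_epi _).1 h1
  · have h1 := h (𝟙_ C)
    rw [smulBraid_unit, smulBraid_unit] at h1
    have h2 : smulMap A K ≫ t = A.1 ◁ (ρ_ K.1).inv ≫ ((A.1 ◁ (ρ_ K.1).hom ≫ smulMap A K ≫
        (λ_ K.1).inv) ≫ 𝟙_ C ◁ t) ≫ (λ_ L.1).hom := by monoidal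
    rw [h2, h1]
    monoidal

end

namespace Tube.Rep

variable {irr} (dual : ∀ i, BalancedDual (irr.obj i)) {A : Center C} [MonObj A]
  {K L : Center C} [ModObj A K] [ModObj A L]

/-- The functor from modules in the center to representations of the tube algebra is full. Linearity
under `End Y` makes `T` a composition with a morphism of `C`, and linearity under the other tubes,
with the nondegeneracy of the partial trace, makes this a morphism of modules in the center. -/
theorem exists_hom (T : Rep dual A K →ₗ[(Tube irr A)ᵐᵒᵖ] Rep dual A L) :
    ∃ s : K ⟶ L, smulMap A K ≫ s.f = A.1 ◁ s.f ≫ smulMap A L ∧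
      ∀ h : irr.sum ⟶ K.1, T h = (h ≫ s.f : irr.sum ⟶ L.1) := by
  obtain ⟨T', hT'⟩ : ∃ T' : (irr.sum ⟶ K.1) →ₗ[ℂ] (irr.sum ⟶ L.1), ∀ h, T h = T' h :=
    ⟨T.restrictScalars ℂ, fun _ => rfl⟩
  have hT : ∀ (f : Tube irr A) (h : irr.sum ⟶ K.1),
      T' (act dual K h f) = act dual L (T' h) f := by
    intro f h
    have h1 : T (act dual K h f) = act dual L (T h) f := T.map_smul (MulOpposite.op f) h
    exact ((hT' _).symm.trans h1).trans (congrArg (fun x => act dual L x f) (hT' h))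
  obtain ⟨t, ht⟩ := irr.exists_comp_eq T' fun u h => by
    rw [← act_ofEnd (A := A) dual, ← act_ofEnd (A := A) dual, hT]
  have key : ∀ i, smulBraid A K (irr.obj i) ≫ irr.obj i ◁ t =
      A.1 ◁ (t ▷ irr.obj i) ≫ smulBraid A L (irr.obj i) := by
    intro i
    refine (dual i).partialTrace_ext irr fun g => ?_
    set R := resolution irr K.1
    have h0 : g = ∑ k, (g ≫ A.1 ◁ ((R.b k ≫ irr.incl _) ▷ irr.obj i)) ≫
        A.1 ◁ ((irr.proj _ ≫ R.a k) ▷ irr.obj i) := by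
      have : ∀ k, (g ≫ A.1 ◁ ((R.b k ≫ irr.incl _) ▷ irr.obj i)) ≫
          A.1 ◁ ((irr.proj _ ≫ R.a k) ▷ irr.obj i) =
          g ≫ A.1 ◁ ((R.b k ≫ R.a k) ▷ irr.obj i) := by
        intro k
        rw [Category.assoc, ← MonoidalCategory.whiskerLeft_comp, ← comp_whiskerRight,
          Category.assoc, ← Category.assoc (irr.incl _), SimpleReps.incl_proj, Category.id_comp]
      simp only [this]
      rw [← Preadditive.comp_sum, ← whiskerLeft_sum, ← sum_whiskerRight, R.complete]
      simp
    rw [h0, Preadditive.sum_comp, Preadditive.sum_comp, BalancedDual.partialTrace_sum,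
      BalancedDual.partialTrace_sum]
    refine Finset.sum_congr rfl fun k _ => ?_
    set f := g ≫ A.1 ◁ ((R.b k ≫ irr.incl _) ▷ irr.obj i)
    set h := irr.proj _ ≫ R.a k
    have h1 := hT (single i f) h
    rw [ht, ht, act_single, act_single, BalancedDual.partialTrace_comp, tubeAct_eq,
      tubeAct_eq, comp_whiskerRight h t, MonoidalCategory.whiskerLeft_comp] at h1
    simpa only [Category.assoc] using h1
  obtain ⟨s, rfl, hs⟩ := exists_center_hom (comm_of_comm_obj key)
  exact ⟨s, hs, fun h => (hT' h).trans (ht h)⟩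

theorem act_comp (s : K ⟶ L) (hs : smulMap A K ≫ s.f = A.1 ◁ s.f ≫ smulMap A L)
    (h : irr.sum ⟶ K.1) (f : Tube irr A) :
    act dual K h f ≫ s.f = act dual L (h ≫ s.f) f := by
  rw [act_def, act_def, Preadditive.sum_comp]
  refine Finset.sum_congr rfl fun i _ => ?_
  rw [BalancedDual.partialTrace_comp]
  congr 1
  unfold tubeAct
  simp only [Category.assoc]
  rw [← s.comm, ← comp_whiskerRight_assoc, hs]
  monoidal

/-- A module morphism induces a morphism of representations. -/
noncomputable def mapHom (s : K ⟶ L) (hs : smulMap A K ≫ s.f = A.1 ◁ s.f ≫ smulMap A L) :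
    Rep dual A K →ₗ[(Tube irr A)ᵐᵒᵖ] Rep dual A L where
  toFun h := (show irr.sum ⟶ K.1 from h) ≫ s.f
  map_add' _ _ := Preadditive.add_comp _ _ _ _ _ _
  map_smul' f h := act_comp dual s hs h f.unop

/-- The functor from modules in the center to representations of the tube algebra is faithful. -/
theorem mapHom_injective {s s' : K ⟶ L} {hs : smulMap A K ≫ s.f = A.1 ◁ s.f ≫ smulMap A L}
    {hs' : smulMap A K ≫ s'.f = A.1 ◁ s'.f ≫ smulMap A L}
    (h : mapHom dual s hs = mapHom dual s' hs') : s = s' :=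
  Center.ext _ _ (irr.hom_ext_sum fun g => congrArg (fun T => T g) h)

end Tube.Rep

end CategoryTheory

/-! ### Quantum dimensions and the handle slide -/

namespace CategoryTheory

open DaggerCategory

variable {C : Type u} [Category.{v} C] [Abelian C] [Linear ℂ C] [MonoidalCategory C]
  [MonoidalPreadditive C] [MonoidalLinear ℂ C] [RigidCategory C] [DaggerCategory C]
  [UnitaryFusionCategory C]

namespace BalancedDual

section RightBend

variable {c : C} (E : BalancedDual c) {w z : C}

/-- Bending the right string `c` in the source of a morphism to its target. -/
def rightBend (b : z ⊗ c ⟶ w) : z ⟶ w ⊗ E.dual :=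
  𝟙 _ ⊗≫ z ◁ E.coev' ⊗≫ b ▷ E.dual

/-- The inverse of `rightBend`. -/
def rightUnbend (v : z ⟶ w ⊗ E.dual) : z ⊗ c ⟶ w :=
  v ▷ c ⊗≫ w ◁ E.ev' ⊗≫ 𝟙 _

/-- Bending the right string `c` in the target of a morphism to its source. -/
def rightBend' (a : w ⟶ z ⊗ c) : w ⊗ E.dual ⟶ z :=
  a ▷ E.dual ⊗≫ z ◁ E.ev ⊗≫ 𝟙 _

/-- The inverse of `rightBend'`. -/
def rightUnbend' (u : w ⊗ E.dual ⟶ z) : w ⟶ z ⊗ c :=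
  𝟙 _ ⊗≫ w ◁ E.coev ⊗≫ u ▷ c

theorem rightBend_comp_rightBend' {z' : C} (b : z ⊗ c ⟶ w) (a : w ⟶ z' ⊗ c) :
    E.rightBend b ≫ E.rightBend' a = E.rightPartialTrace (b ≫ a) := by
  unfold rightBend rightBend' rightPartialTrace
  monoidal

theorem rightBend_rightUnbend (v : z ⟶ w ⊗ E.dual) : E.rightBend (E.rightUnbend v) = v := by
  unfold rightBend rightUnbend
  calc
    _ = 𝟙 _ ⊗≫ (z ◁ E.coev' ≫ v ▷ (c ⊗ E.dual)) ⊗≫ w ◁ E.ev' ▷ E.dual ⊗≫ 𝟙 _ := by monoidal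
    _ = 𝟙 _ ⊗≫ v ⊗≫ w ◁ (E.dual ◁ E.coev' ⊗≫ E.ev' ▷ E.dual) ⊗≫ 𝟙 _ := by
      rw [whisker_exchange]; monoidal
    _ = _ := by rw [zigzag_dual']; monoidal

theorem rightUnbend_rightBend (b : z ⊗ c ⟶ w) : E.rightUnbend (E.rightBend b) = b := by
  unfold rightBend rightUnbend
  calc
    _ = 𝟙 _ ⊗≫ z ◁ E.coev' ▷ c ⊗≫ (b ▷ (E.dual ⊗ c) ≫ w ◁ E.ev') ⊗≫ 𝟙 _ := by monoidal
    _ = 𝟙 _ ⊗≫ z ◁ (E.coev' ▷ c ⊗≫ c ◁ E.ev') ⊗≫ b ⊗≫ 𝟙 _ := by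
      rw [← whisker_exchange]; monoidal
    _ = _ := by rw [zigzag']; monoidal

theorem rightUnbend'_rightBend' (a : w ⟶ z ⊗ c) : E.rightUnbend' (E.rightBend' a) = a := by
  unfold rightBend' rightUnbend'
  calc
    _ = 𝟙 _ ⊗≫ (w ◁ E.coev ≫ a ▷ (E.dual ⊗ c)) ⊗≫ z ◁ E.ev ▷ c ⊗≫ 𝟙 _ := by monoidal
    _ = 𝟙 _ ⊗≫ a ⊗≫ z ◁ (c ◁ E.coev ⊗≫ E.ev ▷ c) ⊗≫ 𝟙 _ := by
      rw [whisker_exchange]; monoidal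
    _ = _ := by rw [zigzag]; monoidal

theorem rightBend_sum {κ : Type*} (s : Finset κ) (b : κ → (z ⊗ c ⟶ w)) :
    E.rightBend (∑ k ∈ s, b k) = ∑ k ∈ s, E.rightBend (b k) := by
  simp [rightBend, monoidalComp, Preadditive.comp_sum, sum_whiskerRight]

end RightBend

/-- The trace of the identity of a simple object is a positive real number. -/
theorem exists_dim {X : C} (hX : Simple X) (D : BalancedDual X) :
    ∃ r : ℝ, 0 < r ∧ D.leftTrace (𝟙 X) = (r : ℂ) • 𝟙 (𝟙_ C) := by
  have h0 : D.leftTrace (𝟙 X) = D.coev ≫ dag D.coev := by simp [leftTrace, ev']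
  obtain ⟨r, hr, h⟩ := exists_norm_sq D.coev
  refine ⟨r, lt_of_le_of_ne hr fun h1 => ?_, h0.trans h⟩
  rw [← h1, Complex.ofReal_zero, zero_smul] at h
  have h2 := UnitaryFusionCategory.dag_definite _ h
  exact id_nonzero X (D.eq_zero_of_coev (by rw [h2, Limits.zero_comp]))

/-- The quantum dimension of a simple object: the trace of its identity, a positive real number. -/
noncomputable def dim {X : C} (hX : Simple X) (D : BalancedDual X) : ℝ :=
  (D.exists_dim hX).choose

theorem dim_pos {X : C} (hX : Simple X) (D : BalancedDual X) : 0 < D.dim hX :=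
  (D.exists_dim hX).choose_spec.1

theorem leftTrace_id {X : C} (hX : Simple X) (D : BalancedDual X) :
    D.leftTrace (𝟙 X) = (D.dim hX : ℂ) • 𝟙 (𝟙_ C) :=
  (D.exists_dim hX).choose_spec.2

theorem partialTrace_id {X : C} (hX : Simple X) (D : BalancedDual X) (y : C) :
    D.partialTrace (𝟙 (X ⊗ y)) = (D.dim hX : ℂ) • 𝟙 y := by
  have h : D.partialTrace (𝟙 (X ⊗ y)) = (λ_ y).inv ≫ D.leftTrace (𝟙 X) ▷ y ≫ (λ_ y).hom := by
    rw [partialTrace_eq]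
    unfold leftTrace
    monoidal
  rw [h, leftTrace_id hX, MonoidalLinear.smul_whiskerRight, Linear.smul_comp, Linear.comp_smul,
    id_whiskerRight, Category.id_comp, Iso.inv_hom_id]

end BalancedDual

variable {J : Type w} (irr : SimpleReps C J)

namespace SimpleReps

theorem hom_eq_zero {i j : J} (h : i ≠ j) (s : irr.obj i ⟶ irr.obj j) : s = 0 := by
  have := irr.simple i
  have := irr.simple j
  by_contra hs
  have := isIso_of_hom_simple hs
  exact h (irr.eq_of_iso i j ⟨asIso s⟩)

theorem exists_smul_id {i : J} (s : irr.obj i ⟶ irr.obj i) : ∃ r : ℂ, s = r • 𝟙 _ := by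
  have := irr.simple i
  have : FiniteDimensional ℂ (irr.obj i ⟶ irr.obj i) := UnitaryFusionCategory.finite_hom _ _
  obtain ⟨r, hr⟩ := endomorphism_simple_eq_smul_id ℂ s
  exact ⟨r, hr.symm⟩

/-- A resolution of the identity of `c`, sorted by the types of the simple objects. -/
theorem exists_sorted_resolution [Fintype J] (c : C) :
    ∃ (κ : J → Type) (_ : ∀ j, Fintype (κ j)) (a : ∀ j, κ j → (irr.obj j ⟶ c))
      (b : ∀ j, κ j → (c ⟶ irr.obj j)), ∑ j, ∑ k, b j k ≫ a j k = 𝟙 c := by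
  classical
  let R := resolution irr c
  refine ⟨fun j => {k // R.t k = j}, fun j => inferInstance,
    fun j k => eqToHom (congrArg irr.obj k.2.symm) ≫ R.a k.1,
    fun j k => R.b k.1 ≫ eqToHom (congrArg irr.obj k.2), ?_⟩
  rw [← R.complete, ← (Equiv.sigmaFiberEquiv R.t).sum_comp, Fintype.sum_sigma]
  simp
  rfl

end SimpleReps

variable [Fintype J] {irr} (dual : ∀ i, BalancedDual (irr.obj i))

/-- The quantum dimensions of the simple objects, as complex numbers. -/
noncomputable def dimObj (i : J) : ℂ := (dual i).dim (irr.simple i)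

section HandleSlide

variable {c : C} (E : SphericalDual c)

/-- The composite of `a` and `b`, and the composite of their bent versions, are scalars whose
traces are the same closed diagram. -/
theorem rightBend_comp_rightBend'_eq {i j : J} (b : irr.obj i ⊗ c ⟶ irr.obj j)
    (a : irr.obj j ⟶ irr.obj i ⊗ c) {r : ℂ} (h : a ≫ b = r • 𝟙 _) :
    dimObj dual i • (E.rightBend b ≫ E.rightBend' a) = (dimObj dual j * r) • 𝟙 _ := by
  rw [BalancedDual.rightBend_comp_rightBend']
  obtain ⟨s, hs⟩ := irr.exists_smul_id (E.rightPartialTrace (b ≫ a))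
  have h1 := (Tube.sphericalDual dual i).leftTrace_tensor E (b ≫ a)
  rw [← SphericalDual.leftTrace_cyc _ (Tube.sphericalDual dual j), h, hs] at h1
  have h2 : ∀ i, (Tube.sphericalDual dual i).leftTrace (𝟙 _) = dimObj dual i • 𝟙 (𝟙_ C) :=
    fun i => (dual i).leftTrace_id (irr.simple i)
  rw [BalancedDual.leftTrace_smul, BalancedDual.leftTrace_smul, h2, h2, smul_smul, smul_smul] at h1
  have : Simple (𝟙_ C) := UnitaryFusionCategory.simple_unit
  have h3 := smul_left_injective ℂ (id_nonzero (𝟙_ C)) h1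
  rw [hs, smul_smul, mul_comm (dimObj dual i), ← h3, mul_comm]

/-- The identity of `x_j ⊗ c̄`, resolved by the bent morphisms of resolutions of the `x_i ⊗ c`. -/
theorem sum_rightBend'_comp_rightBend {κ : J → J → Type} [∀ i j, Fintype (κ i j)]
    (a : ∀ i j, κ i j → (irr.obj j ⟶ irr.obj i ⊗ c))
    (b : ∀ i j, κ i j → (irr.obj i ⊗ c ⟶ irr.obj j))
    (hab : ∀ i, ∑ j, ∑ k, b i j k ≫ a i j k = 𝟙 _) (j : J) :
    ∑ i, ∑ k, dimObj dual i • (E.rightBend' (a i j k) ≫ E.rightBend (b i j k)) =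
      dimObj dual j • 𝟙 (irr.obj j ⊗ E.dual) := by
  refine irr.hom_ext_obj fun i v => ?_
  rw [Linear.comp_smul, Category.comp_id, Preadditive.comp_sum, Finset.sum_eq_single i]
  · rw [Preadditive.comp_sum]
    set v' := E.rightUnbend v with hv'
    have hv : E.rightBend v' = v := E.rightBend_rightUnbend v
    have h1 : ∀ k, v ≫ (dimObj dual i • (E.rightBend' (a i j k) ≫ E.rightBend (b i j k))) =
        dimObj dual j • E.rightBend (b i j k ≫ a i j k ≫ v') := by
      intro k
      obtain ⟨r, hr⟩ := irr.exists_smul_id (a i j k ≫ v')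
      have h2 := rightBend_comp_rightBend'_eq dual E v' (a i j k) hr
      rw [hr, Linear.comp_smul, ← Category.assoc, ← Linear.smul_comp, ← Linear.comp_smul,
        ← hv, Linear.comp_smul, h2, Linear.smul_comp, Category.id_comp, Linear.comp_smul,
        Category.comp_id]
      have : E.rightBend (r • b i j k) = r • E.rightBend (b i j k) := by
        simp [BalancedDual.rightBend, monoidalComp]
      rw [this, smul_smul]
    simp only [h1]
    rw [← Finset.smul_sum, ← BalancedDual.rightBend_sum]
    congr 1
    have h3 : v' = ∑ k, b i j k ≫ a i j k ≫ v' := by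
      have h4 : v' = ∑ j', ∑ k, b i j' k ≫ a i j' k ≫ v' := by
        simp only [← Category.assoc, ← Preadditive.sum_comp, hab, Category.id_comp]
      rw [Finset.sum_eq_single j] at h4
      · exact h4
      · intro j' _ hj
        simp only [irr.hom_eq_zero hj (_ ≫ v'), Limits.comp_zero, Finset.sum_const_zero]
      · simp
    rw [← h3, hv]
  · intro i' _ hi
    rw [Preadditive.comp_sum]
    refine Finset.sum_eq_zero fun k _ => ?_
    rw [Linear.comp_smul, ← Category.assoc, irr.hom_eq_zero hi.symm (v ≫ _), Limits.zero_comp,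
      smul_zero]
  · simp

/-- The handle slide: a string `c` passes through the sum of all closed strings, weighted by the
quantum dimensions. On one side `x_i ⊗ c` is resolved into simple objects `x_j`; bending `c` turns
the resolving morphisms into a resolution of `x_j ⊗ c̄`, in which the weight of `x_i` becomes that
of `x_j`. -/
theorem handle_slide {c : C} (E : SphericalDual c) {k l : C} (N : ∀ x : C, x ⊗ k ⟶ x ⊗ l)
    (hN : ∀ {x y : C} (s : x ⟶ y), s ▷ k ≫ N y = N x ≫ s ▷ l) :
    ∑ i, dimObj dual i • (dual i).partialTrace
      ((α_ (irr.obj i) c k).inv ≫ N (irr.obj i ⊗ c) ≫ (α_ (irr.obj i) c l).hom) =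
    c ◁ ∑ j, dimObj dual j • (dual j).partialTrace (N (irr.obj j)) := by
  choose κ hκ a b hab using fun i => irr.exists_sorted_resolution (irr.obj i ⊗ c)
  -- The diagram `N` at `x_j`, between a cap and a cup of `c`.
  let Q : ∀ j, (irr.obj j ⊗ E.dual) ⊗ (c ⊗ k) ⟶ (irr.obj j ⊗ E.dual) ⊗ (c ⊗ l) := fun j =>
    𝟙 _ ⊗≫ irr.obj j ◁ E.ev' ▷ k ⊗≫ N (irr.obj j) ⊗≫ irr.obj j ◁ E.coev ▷ l ⊗≫ 𝟙 _
  have h1 : ∀ i, (α_ (irr.obj i) c k).inv ≫ N (irr.obj i ⊗ c) ≫ (α_ (irr.obj i) c l).hom =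
      ∑ j, ∑ m, E.rightBend (b i j m) ▷ (c ⊗ k) ≫ Q j ≫ E.rightBend' (a i j m) ▷ (c ⊗ l) := by
    intro i
    have h2 : ∀ j m, E.rightBend (b i j m) ▷ (c ⊗ k) ≫ Q j ≫ E.rightBend' (a i j m) ▷ (c ⊗ l) =
        (α_ (irr.obj i) c k).inv ≫ ((b i j m ≫ a i j m) ▷ k ≫ N (irr.obj i ⊗ c)) ≫
          (α_ (irr.obj i) c l).hom := by
      intro j m
      have hb := (E.rightUnbend_rightBend (b i j m)).symm
      have ha := (E.rightUnbend'_rightBend' (a i j m)).symm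
      have e : (b i j m ≫ a i j m) ▷ k ≫ N (irr.obj i ⊗ c) =
          b i j m ▷ k ≫ N (irr.obj j) ≫ a i j m ▷ l := by
        rw [comp_whiskerRight, Category.assoc, hN]
      rw [e]
      generalize E.rightBend (b i j m) = b' at hb ⊢
      generalize E.rightBend' (a i j m) = a' at ha ⊢
      rw [hb, ha]
      simp only [Q]
      unfold BalancedDual.rightUnbend BalancedDual.rightUnbend'
      monoidal
    simp only [h2]
    simp only [← Preadditive.comp_sum, ← Preadditive.sum_comp, ← sum_whiskerRight, hab]
    simp
  have h3 : ∀ i j m, (dual i).partialTrace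
      (E.rightBend (b i j m) ▷ (c ⊗ k) ≫ Q j ≫ E.rightBend' (a i j m) ▷ (c ⊗ l)) =
      ((Tube.sphericalDual dual j).tensor E.symm).partialTrace
        (Q j ≫ (E.rightBend' (a i j m) ≫ E.rightBend (b i j m)) ▷ (c ⊗ l)) := by
    intro i j m
    rw [comp_whiskerRight, ← Category.assoc (Q j)]
    exact SphericalDual.partialTrace_cyc _ (Tube.sphericalDual dual i) _ _
  have h4 : ∀ j, ((Tube.sphericalDual dual j).tensor E.symm).partialTrace (Q j) =
      c ◁ (dual j).partialTrace (N (irr.obj j)) := by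
    intro j
    rw [SphericalDual.tensor_partialTrace]
    have h5 : (Tube.sphericalDual dual j).partialTrace
        ((α_ (irr.obj j) E.dual (c ⊗ k)).inv ≫ Q j ≫ (α_ (irr.obj j) E.dual (c ⊗ l)).hom) =
        𝟙 _ ⊗≫ E.ev' ▷ k ⊗≫ (dual j).partialTrace (N (irr.obj j)) ⊗≫ E.coev ▷ l ⊗≫ 𝟙 _ := by
      have h6 : (α_ (irr.obj j) E.dual (c ⊗ k)).inv ≫ Q j ≫ (α_ (irr.obj j) E.dual (c ⊗ l)).hom =
          irr.obj j ◁ (𝟙 _ ⊗≫ E.ev' ▷ k ⊗≫ 𝟙 _) ≫ N (irr.obj j) ≫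
            irr.obj j ◁ (𝟙 _ ⊗≫ E.coev ▷ l ⊗≫ 𝟙 _) := by
        simp only [Q]
        monoidal
      rw [h6, ← BalancedDual.comp_partialTrace, ← BalancedDual.partialTrace_comp]
      change (𝟙 _ ⊗≫ E.ev' ▷ k ⊗≫ 𝟙 _) ≫ (dual j).partialTrace (N (irr.obj j)) ≫ _ = _
      monoidal
    rw [h5]
    generalize (dual j).partialTrace (N (irr.obj j)) = M
    have h7 : ∀ (P : E.dual ⊗ (c ⊗ k) ⟶ E.dual ⊗ (c ⊗ l)), E.symm.partialTrace P =
        (λ_ (c ⊗ k)).inv ≫ E.coev' ▷ (c ⊗ k) ≫ (α_ c E.dual (c ⊗ k)).hom ≫ c ◁ P ≫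
          (α_ c E.dual (c ⊗ l)).inv ≫ E.ev ▷ (c ⊗ l) ≫ (λ_ (c ⊗ l)).hom := by
      intro P
      rw [← E.symm_ev']
      rfl
    rw [h7]
    calc
      _ = 𝟙 _ ⊗≫ (E.coev' ▷ c ⊗≫ c ◁ E.ev') ▷ k ⊗≫ c ◁ M ⊗≫ (c ◁ E.coev ⊗≫ E.ev ▷ c) ▷ l ⊗≫
            𝟙 _ := by monoidal
      _ = _ := by rw [BalancedDual.zigzag', BalancedDual.zigzag]; monoidal
  simp only [h1, BalancedDual.partialTrace_sum, h3, Finset.smul_sum]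
  rw [Finset.sum_comm, whiskerLeft_sum]
  refine Finset.sum_congr rfl fun j _ => ?_
  rw [MonoidalLinear.whiskerLeft_smul, ← h4]
  have h8 := sum_rightBend'_comp_rightBend dual E a b hab j
  have h9 : dimObj dual j • Q j =
      ∑ i, ∑ m, dimObj dual i • (Q j ≫
        (E.rightBend' (a i j m) ≫ E.rightBend (b i j m)) ▷ (c ⊗ l)) := by
    have : dimObj dual j • Q j = Q j ≫ (dimObj dual j • 𝟙 (irr.obj j ⊗ E.dual)) ▷ (c ⊗ l) := by
      simp
    rw [this, ← h8]
    simp only [sum_whiskerRight, MonoidalLinear.smul_whiskerRight, Preadditive.comp_sum,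
      Linear.comp_smul]
  rw [← BalancedDual.partialTrace_smul, h9]
  simp only [BalancedDual.partialTrace_sum, BalancedDual.partialTrace_smul]

end HandleSlide

end CategoryTheory

/-! ### Averaging over the half-braiding -/

namespace CategoryTheory

section Rotation

variable {C : Type u} [Category.{v} C] [MonoidalCategory C]

/-- The inverse of a half-braiding with `c` is the rotated half-braiding with the dual of `c`. -/
theorem HalfBraiding.inv_eq_rotate {K : C} (b : HalfBraiding K) {c d : C} (s : 𝟙_ C ⟶ d ⊗ c)
    (e : c ⊗ d ⟶ 𝟙_ C) (hse : c ◁ s ⊗≫ e ▷ c = ⊗𝟙.hom) :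
    (b.β c).inv = 𝟙 _ ⊗≫ (c ⊗ K) ◁ s ⊗≫ c ◁ (b.β d).hom ▷ c ⊗≫ e ▷ (K ⊗ c) ⊗≫ 𝟙 _ := by
  symm
  calc
    _ = 𝟙 _ ⊗≫ (c ⊗ K) ◁ s ⊗≫ (c ◁ (b.β d).hom ⊗≫ e ▷ K) ▷ c ⊗≫ 𝟙 _ := by monoidal
    _ = 𝟙 _ ⊗≫ ((c ⊗ K) ◁ s ≫ (b.β c).inv ▷ (d ⊗ c)) ⊗≫ K ◁ e ▷ c ⊗≫ 𝟙 _ := by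
      rw [b.cap_slide]; monoidal
    _ = 𝟙 _ ⊗≫ (b.β c).inv ⊗≫ K ◁ (c ◁ s ⊗≫ e ▷ c) ⊗≫ 𝟙 _ := by
      rw [whisker_exchange]; monoidal
    _ = _ := by rw [hse]; monoidal

/-- If the image of `p` is stable under the half-braiding with the dual `d` of `c`, then it is
stable under the inverse of the half-braiding with `c`. -/
theorem HalfBraiding.stable_inv {K : C} (b : HalfBraiding K) {c d : C} (s : 𝟙_ C ⟶ d ⊗ c)
    (e : c ⊗ d ⟶ 𝟙_ C) (hse : c ◁ s ⊗≫ e ▷ c = ⊗𝟙.hom) {p : K ⟶ K}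
    (hp : p ▷ d ≫ (b.β d).hom ≫ d ◁ p = p ▷ d ≫ (b.β d).hom) :
    c ◁ p ≫ (b.β c).inv ≫ p ▷ c = c ◁ p ≫ (b.β c).inv := by
  rw [b.inv_eq_rotate s e hse]
  calc
    _ = 𝟙 _ ⊗≫ ((c ◁ p) ▷ 𝟙_ C ≫ (c ⊗ K) ◁ s) ⊗≫ c ◁ (b.β d).hom ▷ c ⊗≫
          (e ▷ (K ⊗ c) ≫ 𝟙_ C ◁ (p ▷ c)) ⊗≫ 𝟙 _ := by monoidal
    _ = 𝟙 _ ⊗≫ (c ⊗ K) ◁ s ⊗≫ c ◁ (p ▷ d ≫ (b.β d).hom ≫ d ◁ p) ▷ c ⊗≫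
          e ▷ (K ⊗ c) ⊗≫ 𝟙 _ := by
      rw [← whisker_exchange, ← whisker_exchange]
      monoidal
    _ = 𝟙 _ ⊗≫ ((c ⊗ K) ◁ s ≫ (c ◁ p) ▷ (d ⊗ c)) ⊗≫ c ◁ (b.β d).hom ▷ c ⊗≫
          e ▷ (K ⊗ c) ⊗≫ 𝟙 _ := by
      rw [hp]; monoidal
    _ = _ := by rw [whisker_exchange]; monoidal

end Rotation

open DaggerCategory

variable {C : Type u} [Category.{v} C] [Abelian C] [Linear ℂ C] [MonoidalCategory C]
  [MonoidalPreadditive C] [MonoidalLinear ℂ C] [RigidCategory C] [DaggerCategory C]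
  [UnitaryFusionCategory C]

theorem BalancedDual.partialTrace_whiskerRight {x : C} (D : BalancedDual x) {k l : C}
    (M : x ⊗ k ⟶ x ⊗ l) (c : C) :
    D.partialTrace ((α_ x k c).inv ≫ M ▷ c ≫ (α_ x l c).hom) = D.partialTrace M ▷ c := by
  rw [partialTrace_eq, partialTrace_eq]
  monoidal

variable {J : Type w} [Fintype J] {irr : SimpleReps C J} (dual : ∀ i, BalancedDual (irr.obj i))

/-- Natural families of morphisms are determined by their values on simple objects. -/
theorem SimpleReps.natural_ext (irr : SimpleReps C J) {k l : C} {N N' : ∀ x : C, x ⊗ k ⟶ x ⊗ l}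
    (hN : ∀ {x y : C} (s : x ⟶ y), s ▷ k ≫ N y = N x ≫ s ▷ l)
    (hN' : ∀ {x y : C} (s : x ⟶ y), s ▷ k ≫ N' y = N' x ≫ s ▷ l)
    (h : ∀ i, N (irr.obj i) = N' (irr.obj i)) (c : C) : N c = N' c := by
  have h1 : ∀ (P : ∀ x : C, x ⊗ k ⟶ x ⊗ l),
      (∀ {x y : C} (s : x ⟶ y), s ▷ k ≫ P y = P x ≫ s ▷ l) →
      P c = ∑ m, (resolution irr c).b m ▷ k ≫ P _ ≫ (resolution irr c).a m ▷ l := by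
    intro P hP
    simp only [← hP, ← comp_whiskerRight_assoc, ← Preadditive.sum_comp, ← sum_whiskerRight,
      (resolution irr c).complete]
    simp
  rw [h1 N hN, h1 N' hN']
  simp only [h]

/-- The global dimension of `C`, the sum of the squares of the quantum dimensions. -/
noncomputable def globalDim : ℂ := ∑ i, dimObj dual i * dimObj dual i

theorem globalDim_ne_zero : globalDim dual ≠ 0 := by
  have h : globalDim dual =
      ((∑ i, (dual i).dim (irr.simple i) * (dual i).dim (irr.simple i) : ℝ) : ℂ) := by
    simp [globalDim, dimObj]
  rw [h]
  obtain ⟨i, _⟩ := irr.exists_iso (𝟙_ C) UnitaryFusionCategory.simple_unit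
  exact Complex.ofReal_ne_zero.2 (Finset.sum_pos
    (fun i _ => mul_pos ((dual i).dim_pos _) ((dual i).dim_pos _)) ⟨i, Finset.mem_univ i⟩).ne'

section Averaging

variable {K L : Center C}

/-- A morphism of `C` between objects of the center, conjugated by the half-braidings. -/
def conjBraid (f : K.1 ⟶ L.1) (x : C) : x ⊗ K.1 ⟶ x ⊗ L.1 :=
  (K.2.β x).inv ≫ f ▷ x ≫ (L.2.β x).hom

theorem conjBraid_nat (f : K.1 ⟶ L.1) {x y : C} (s : x ⟶ y) :
    s ▷ K.1 ≫ conjBraid f y = conjBraid f x ≫ s ▷ L.1 := by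
  unfold conjBraid
  rw [reassoc_of% K.2.inv_nat s, whisker_exchange_assoc, L.2.naturality]
  simp only [Category.assoc]

theorem conjBraid_tensor (f : K.1 ⟶ L.1) (x c : C) :
    (α_ x c K.1).inv ≫ conjBraid f (x ⊗ c) ≫ (α_ x c L.1).hom = x ◁ (K.2.β c).inv ≫
      ((α_ x K.1 c).inv ≫ conjBraid f x ▷ c ≫ (α_ x L.1 c).hom) ≫ x ◁ (L.2.β c).hom := by
  unfold conjBraid
  rw [K.2.inv_tensor, L.2.monoidal]
  monoidal

/-- The sum of all conjugates of `f`, weighted by the quantum dimensions. -/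
noncomputable def preAverage (f : K.1 ⟶ L.1) : K.1 ⟶ L.1 :=
  ∑ i, dimObj dual i • (dual i).partialTrace (conjBraid f (irr.obj i))

/-- The sum of all conjugates is a morphism of the center, by the handle slide. -/
theorem preAverage_comm (f : K.1 ⟶ L.1) (c : C) :
    preAverage dual f ▷ c ≫ (L.2.β c).hom = (K.2.β c).hom ≫ c ◁ preAverage dual f := by
  rw [← Iso.inv_comp_eq]
  refine irr.natural_ext (N := fun c => conjBraid (preAverage dual f) c)
    (N' := fun c => c ◁ preAverage dual f) (fun s => conjBraid_nat _ s)
    (fun s => (whisker_exchange s _).symm) (fun j => ?_) c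
  refine Eq.trans ?_ (handle_slide dual (Tube.sphericalDual dual j) (conjBraid f)
    (conjBraid_nat f))
  simp only [conjBraid_tensor, ← BalancedDual.comp_partialTrace, ← BalancedDual.partialTrace_comp,
    BalancedDual.partialTrace_whiskerRight]
  simp only [conjBraid, preAverage, sum_whiskerRight, MonoidalLinear.smul_whiskerRight,
    Preadditive.comp_sum, Preadditive.sum_comp, Linear.comp_smul, Linear.smul_comp]

/-- If the image of a projection `p` of `K` is stable under the half-braiding, then `p` can be
replaced by a morphism of the center with the same image. -/
theorem exists_center_projection (dual : ∀ i, BalancedDual (irr.obj i)) {p : K.1 ⟶ K.1}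
    (hp : ∀ c, p ▷ c ≫ (K.2.β c).hom ≫ c ◁ p = p ▷ c ≫ (K.2.β c).hom) :
    ∃ s : K ⟶ K, p ≫ s.f = p ∧ s.f ≫ p = s.f := by
  have h1 : ∀ i, conjBraid p (irr.obj i) ≫ irr.obj i ◁ p = conjBraid p (irr.obj i) := by
    intro i
    unfold conjBraid
    rw [Category.assoc, Category.assoc, hp]
  have h2 : ∀ i, irr.obj i ◁ p ≫ conjBraid p (irr.obj i) = irr.obj i ◁ p := by
    intro i
    unfold conjBraid
    have := K.2.stable_inv (dual i).coev (dual i).ev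
      (dual i).zigzag (hp (dual i).dual)
    rw [reassoc_of% this, Iso.inv_hom_id, Category.comp_id]
  refine ⟨(globalDim dual)⁻¹ • ⟨preAverage dual p, preAverage_comm dual p⟩, ?_, ?_⟩
  · have h3 : p ≫ preAverage dual p = globalDim dual • p := by
      unfold preAverage globalDim
      rw [Preadditive.comp_sum, Finset.sum_smul]
      refine Finset.sum_congr rfl fun i _ => ?_
      rw [Linear.comp_smul, BalancedDual.comp_partialTrace, h2, mul_smul]
      have h4 := (dual i).comp_partialTrace p (𝟙 (irr.obj i ⊗ K.1))
      rw [Category.comp_id] at h4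
      rw [← h4, BalancedDual.partialTrace_id (irr.simple i), Linear.comp_smul, Category.comp_id]
      rfl
    change p ≫ ((globalDim dual)⁻¹ • preAverage dual p) = p
    rw [Linear.comp_smul, h3, smul_smul, inv_mul_cancel₀ (globalDim_ne_zero dual), one_smul]
  · have h3 : preAverage dual p ≫ p = preAverage dual p := by
      unfold preAverage
      rw [Preadditive.sum_comp]
      refine Finset.sum_congr rfl fun i _ => ?_
      rw [Linear.smul_comp, BalancedDual.partialTrace_comp, h1]
    change ((globalDim dual)⁻¹ • preAverage dual p) ≫ p = (globalDim dual)⁻¹ • preAverage dual p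
    rw [Linear.smul_comp, h3]

end Averaging

end CategoryTheory

/-! ### Averaging over a separable algebra, and complete reducibility -/

namespace CategoryTheory

section Separable

variable {C : Type u} [Category.{v} C] [MonoidalCategory C]

/-- An algebra is separable if its multiplication splits as a morphism of bimodules; `s` is the
splitting. -/
def IsSeparableAlgebra (A : C) [MonObj A] : Prop :=
  ∃ s : A ⟶ A ⊗ A, s ≫ μ[A] = 𝟙 A ∧
    μ[A] ≫ s = A ◁ s ≫ (α_ A A A).inv ≫ μ[A] ▷ A ∧
    μ[A] ≫ s = s ▷ A ≫ (α_ A A A).hom ≫ A ◁ μ[A]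

theorem isSeparableAlgebra_unit : IsSeparableAlgebra (𝟙_ C) := by
  refine ⟨(λ_ _).inv, ?_, ?_, ?_⟩
  · change (λ_ _).inv ≫ (λ_ _).hom = _
    simp
  · change (λ_ _).hom ≫ (λ_ _).inv = _ ◁ (λ_ _).inv ≫ _ ≫ (λ_ _).hom ▷ _
    monoidal
  · change (λ_ _).hom ≫ (λ_ _).inv = (λ_ _).inv ▷ _ ≫ _ ≫ _ ◁ (λ_ _).hom
    monoidal

/-- The average of a morphism `t` between modules over a separable algebra: with
`s (i 1) = ∑ a ⊗ a'` it is `k ↦ ∑ a • t (a' • k)`. -/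
def averageAction {A K L : C} (g : A ⊗ K ⟶ K) (g' : A ⊗ L ⟶ L) (i : 𝟙_ C ⟶ A) (s : A ⟶ A ⊗ A)
    (t : K ⟶ L) : K ⟶ L :=
  (λ_ K).inv ≫ i ▷ K ≫ s ▷ K ≫ (α_ A A K).hom ≫ A ◁ g ≫ A ◁ t ≫ g'

/-- The average of a morphism is a morphism of modules. -/
theorem averageAction_comm {A K L : C} {m : A ⊗ A ⟶ A} {i : 𝟙_ C ⟶ A} {s : A ⟶ A ⊗ A}
    {g : A ⊗ K ⟶ K} {g' : A ⊗ L ⟶ L} (hi : i ▷ A ≫ m = (λ_ A).hom) (hi' : A ◁ i ≫ m = (ρ_ A).hom)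
    (hs : m ≫ s = A ◁ s ≫ (α_ A A A).inv ≫ m ▷ A) (hs' : m ≫ s = s ▷ A ≫ (α_ A A A).hom ≫ A ◁ m)
    (hg : m ▷ K ≫ g = (α_ A A K).hom ≫ A ◁ g ≫ g)
    (hg' : m ▷ L ≫ g' = (α_ A A L).hom ≫ A ◁ g' ≫ g') (t : K ⟶ L) :
    g ≫ averageAction g g' i s t = A ◁ averageAction g g' i s t ≫ g' := by
  unfold averageAction
  trans s ▷ K ⊗≫ A ◁ (g ≫ t) ≫ g'
  · calc
      _ = 𝟙 _ ⊗≫ (𝟙_ C ◁ g ≫ (i ≫ s) ▷ K) ⊗≫ A ◁ g ≫ A ◁ t ≫ g' := by monoidal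
      _ = 𝟙 _ ⊗≫ (i ≫ s) ▷ (A ⊗ K) ⊗≫ A ◁ ((α_ A A K).hom ≫ A ◁ g ≫ g) ≫ A ◁ t ≫ g' := by
        rw [whisker_exchange]; monoidal
      _ = 𝟙 _ ⊗≫ (i ▷ A ≫ s ▷ A ≫ (α_ A A A).hom ≫ A ◁ m) ▷ K ⊗≫ A ◁ (g ≫ t) ≫ g' := by
        rw [← hg]; monoidal
      _ = _ := by rw [← hs', reassoc_of% hi]; monoidal
  · symm
    calc
      _ = 𝟙 _ ⊗≫ A ◁ ((i ≫ s) ▷ K) ⊗≫ (A ⊗ A) ◁ (g ≫ t) ⊗≫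
            ((α_ A A L).hom ≫ A ◁ g' ≫ g') := by monoidal
      _ = 𝟙 _ ⊗≫ A ◁ ((i ≫ s) ▷ K) ⊗≫ ((A ⊗ A) ◁ (g ≫ t) ≫ m ▷ L) ≫ g' := by
        rw [← hg']; monoidal
      _ = 𝟙 _ ⊗≫ (A ◁ i ≫ A ◁ s ≫ (α_ A A A).inv ≫ m ▷ A) ▷ K ⊗≫ A ◁ (g ≫ t) ≫ g' := by
        rw [whisker_exchange]; monoidal
      _ = _ := by rw [← hs, reassoc_of% hi']; monoidal

/-- Averaging keeps the property of being the identity on the image of `p`, if that image is stable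
under the action. -/
theorem comp_averageAction {A K : C} {m : A ⊗ A ⟶ A} {i : 𝟙_ C ⟶ A} {s : A ⟶ A ⊗ A}
    {g : A ⊗ K ⟶ K} (hs : s ≫ m = 𝟙 A) (hi : i ▷ K ≫ g = (λ_ K).hom)
    (hg : m ▷ K ≫ g = (α_ A A K).hom ≫ A ◁ g ≫ g) {p t : K ⟶ K}
    (hp : A ◁ p ≫ g ≫ p = A ◁ p ≫ g) (hpt : p ≫ t = p) :
    p ≫ averageAction g g i s t = p := by
  unfold averageAction
  have h1 : A ◁ p ≫ g ≫ t = A ◁ p ≫ g := by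
    rw [← reassoc_of% hp, hpt, hp]
  calc
    _ = 𝟙 _ ⊗≫ (𝟙_ C ◁ p ≫ (i ≫ s) ▷ K) ⊗≫ A ◁ (g ≫ t) ≫ g := by monoidal
    _ = 𝟙 _ ⊗≫ (i ≫ s) ▷ K ⊗≫ A ◁ (A ◁ p ≫ g ≫ t) ≫ g := by
      rw [whisker_exchange]; monoidal
    _ = 𝟙 _ ⊗≫ ((i ≫ s) ▷ K ≫ (A ⊗ A) ◁ p) ⊗≫ ((α_ A A K).hom ≫ A ◁ g ≫ g) := by
      rw [h1]; monoidal
    _ = 𝟙 _ ⊗≫ p ⊗≫ (i ≫ s ≫ m) ▷ K ≫ g := by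
      rw [← whisker_exchange, ← hg]; monoidal
    _ = _ := by rw [hs, Category.comp_id, hi]; monoidal

/-- Averaging keeps the property of having values in the image of `p`, if that image is stable under
the action. -/
theorem averageAction_comp {A K : C} {i : 𝟙_ C ⟶ A} {s : A ⟶ A ⊗ A}
    {g : A ⊗ K ⟶ K} {p t : K ⟶ K}
    (hp : A ◁ p ≫ g ≫ p = A ◁ p ≫ g) (hpt : t ≫ p = t) :
    averageAction g g i s t ≫ p = averageAction g g i s t := by
  unfold averageAction
  have h1 : A ◁ t ≫ g ≫ p = A ◁ t ≫ g := by
    rw [← hpt, MonoidalCategory.whiskerLeft_comp, Category.assoc, hp, Category.assoc]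
  simp only [Category.assoc, h1]

end Separable

open DaggerCategory

variable {C : Type u} [Category.{v} C] [Abelian C] [Linear ℂ C] [MonoidalCategory C]
  [MonoidalPreadditive C] [MonoidalLinear ℂ C] [RigidCategory C] [DaggerCategory C]
  [UnitaryFusionCategory C] {J : Type w} [Fintype J] {irr : SimpleReps C J}

section

variable {A : Center C} [MonObj A] {K : Center C} [ModObj A K]

open scoped MonoidalLeftAction in
/-- A subobject of `K` in `C` which is stable under the action of `A` and the half-braiding is the
image of a projection which is a morphism of modules in the center. -/
theorem exists_module_projection (hA : IsSeparableAlgebra A) (dual : ∀ i, BalancedDual (irr.obj i))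
    {p : K.1 ⟶ K.1} (hp : ∀ c, A.1 ◁ (p ▷ c) ≫ smulBraid A K c ≫ c ◁ p =
      A.1 ◁ (p ▷ c) ≫ smulBraid A K c) :
    ∃ s : K ⟶ K, smulMap A K ≫ s.f = A.1 ◁ s.f ≫ smulMap A K ∧ p ≫ s.f = p ∧ s.f ≫ p = s.f := by
  have h1 : A.1 ◁ p ≫ smulMap A K ≫ p = A.1 ◁ p ≫ smulMap A K := by
    have h := hp (𝟙_ C)
    rw [smulBraid_unit] at h
    have h2 : A.1 ◁ p ≫ smulMap A K ≫ p = A.1 ◁ (ρ_ K.1).inv ≫ (A.1 ◁ (p ▷ 𝟙_ C) ≫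
        (A.1 ◁ (ρ_ K.1).hom ≫ smulMap A K ≫ (λ_ K.1).inv) ≫ 𝟙_ C ◁ p) ≫ (λ_ K.1).hom := by
      monoidal
    rw [h2, h]
    monoidal
  have h2 : ∀ c, p ▷ c ≫ (K.2.β c).hom ≫ c ◁ p = p ▷ c ≫ (K.2.β c).hom := by
    intro c
    have h : Tube.oneMap A ▷ (K.1 ⊗ c) ≫ A.1 ◁ (p ▷ c) ≫ smulBraid A K c ≫ c ◁ p =
        Tube.oneMap A ▷ (K.1 ⊗ c) ≫ A.1 ◁ (p ▷ c) ≫ smulBraid A K c := by rw [hp]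
    rw [← whisker_exchange_assoc, ← whisker_exchange_assoc, reassoc_of% oneMap_smulBraid K c,
      oneMap_smulBraid] at h
    rw [← cancel_epi (λ_ (K.1 ⊗ c)).hom]
    simpa using h
  obtain ⟨t, ht, ht'⟩ := exists_center_projection dual h2
  obtain ⟨s, hs, hs', hs''⟩ := hA
  let a : K ⟶ K := averageAction (show A ⊗ K ⟶ K from γ[A, K]) (show A ⊗ K ⟶ K from γ[A, K])
    η[A] s t
  have ha : a.f = averageAction (smulMap A K) (smulMap A K) (Tube.oneMap A) s.f t.f := by
    have h : a.f = (λ_ K).inv.f ≫ Tube.oneMap A ▷ K.1 ≫ s.f ▷ K.1 ≫ (α_ A.1 A.1 K.1).hom ≫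
        A.1 ◁ smulMap A K ≫ A.1 ◁ t.f ≫ smulMap A K := rfl
    rw [h, Center.leftUnitor_inv_f]
    rfl
  have hs₁ : Tube.mulMap A ≫ s.f =
      A.1 ◁ s.f ≫ (α_ A.1 A.1 A.1).inv ≫ Tube.mulMap A ▷ A.1 := by
    have h : Tube.mulMap A ≫ s.f = A.1 ◁ s.f ≫ (α_ A A A).inv.f ≫ Tube.mulMap A ▷ A.1 :=
      congrArg Center.Hom.f hs'
    rwa [Center.associator_inv_f] at h
  refine ⟨a, ?_, ?_, ?_⟩ <;> rw [ha]
  · exact averageAction_comm Tube.oneMap_mul Tube.mul_oneMap hs₁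
      (congrArg Center.Hom.f hs'') (mul_smulMap K) (mul_smulMap K) t.f
  · exact comp_averageAction (congrArg Center.Hom.f hs) (one_smulMap K) (mul_smulMap K) h1 ht
  · exact averageAction_comp h1 ht'

end

/-- The object `Y` is free of multiplicities, so that its isotypic projections are central in
`End Y`, and endomorphisms of `Y` act on them by scalars. -/
theorem SimpleReps.exists_proj_incl_comp (irr : SimpleReps C J) (u : irr.sum ⟶ irr.sum) (i : J) :
    ∃ r : ℂ, (irr.proj i ≫ irr.incl i) ≫ u = r • (irr.proj i ≫ irr.incl i) ∧
      u ≫ irr.proj i ≫ irr.incl i = r • (irr.proj i ≫ irr.incl i) := by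
  obtain ⟨r, hr⟩ := irr.exists_smul_id (irr.incl i ≫ u ≫ irr.proj i)
  refine ⟨r, ?_, ?_⟩
  · have h : (irr.proj i ≫ irr.incl i) ≫ u =
        ∑ j, irr.proj i ≫ (irr.incl i ≫ u ≫ irr.proj j) ≫ irr.incl j := by
      simp only [Category.assoc, ← Preadditive.comp_sum, irr.sum_proj_incl, Category.comp_id]
    rw [h, Finset.sum_eq_single i]
    · rw [hr, Linear.smul_comp, Linear.comp_smul, Category.id_comp]
    · intro j _ hj
      rw [irr.hom_eq_zero hj.symm (irr.incl i ≫ u ≫ irr.proj j)]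
      simp
    · simp
  · have h : u ≫ irr.proj i ≫ irr.incl i =
        ∑ j, irr.proj j ≫ (irr.incl j ≫ u ≫ irr.proj i) ≫ irr.incl i := by
      have : ∀ j, irr.proj j ≫ (irr.incl j ≫ u ≫ irr.proj i) ≫ irr.incl i =
        (irr.proj j ≫ irr.incl j) ≫ u ≫ irr.proj i ≫ irr.incl i := by simp
      simp only [this, ← Preadditive.sum_comp, irr.sum_proj_incl, Category.id_comp]
    rw [h, Finset.sum_eq_single i]
    · rw [hr, Linear.smul_comp, Linear.comp_smul, Category.id_comp]
    · intro j _ hj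
      rw [irr.hom_eq_zero hj (irr.incl j ≫ u ≫ irr.proj i)]
      simp
    · simp

/-- Natural families of morphisms `a ⊗ (k ⊗ x) ⟶ x ⊗ l` are determined by their values on simple
objects `x`. -/
theorem SimpleReps.natural_ext_tensor (irr : SimpleReps C J) {a k l : C}
    {N N' : ∀ x : C, a ⊗ (k ⊗ x) ⟶ x ⊗ l}
    (hN : ∀ {x y : C} (s : x ⟶ y), a ◁ (k ◁ s) ≫ N y = N x ≫ s ▷ l)
    (hN' : ∀ {x y : C} (s : x ⟶ y), a ◁ (k ◁ s) ≫ N' y = N' x ≫ s ▷ l)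
    (h : ∀ i, N (irr.obj i) = N' (irr.obj i)) (c : C) : N c = N' c := by
  have h1 : ∀ (P : ∀ x : C, a ⊗ (k ⊗ x) ⟶ x ⊗ l),
      (∀ {x y : C} (s : x ⟶ y), a ◁ (k ◁ s) ≫ P y = P x ≫ s ▷ l) →
      P c = ∑ m, a ◁ (k ◁ (resolution irr c).b m) ≫ P _ ≫ (resolution irr c).a m ▷ l := by
    intro P hP
    simp only [← hP, ← MonoidalCategory.whiskerLeft_comp_assoc,
      ← MonoidalCategory.whiskerLeft_comp, ← Preadditive.sum_comp, ← whiskerLeft_sum,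
      (resolution irr c).complete]
    simp
  rw [h1 N hN, h1 N' hN']
  simp only [h]

theorem SimpleReps.hom_ext_whisker (irr : SimpleReps C J) {a k x z : C}
    {P Q : a ⊗ (k ⊗ x) ⟶ z}
    (h : ∀ s : irr.sum ⟶ k, a ◁ (s ▷ x) ≫ P = a ◁ (s ▷ x) ≫ Q) : P = Q := by
  have h1 : 𝟙 (a ⊗ (k ⊗ x)) = ∑ m, a ◁ (((resolution irr k).b m ≫ irr.incl _) ▷ x) ≫
      a ◁ ((irr.proj _ ≫ (resolution irr k).a m) ▷ x) := by
    have : ∀ m, a ◁ (((resolution irr k).b m ≫ irr.incl _) ▷ x) ≫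
        a ◁ ((irr.proj _ ≫ (resolution irr k).a m) ▷ x) =
        a ◁ (((resolution irr k).b m ≫ (resolution irr k).a m) ▷ x) := by
      intro m
      rw [← MonoidalCategory.whiskerLeft_comp, ← comp_whiskerRight,
        Category.assoc, ← Category.assoc (irr.incl _), SimpleReps.incl_proj, Category.id_comp]
    simp only [this, ← whiskerLeft_sum, ← sum_whiskerRight, (resolution irr k).complete]
    simp
  rw [← Category.id_comp P, ← Category.id_comp Q, h1, Preadditive.sum_comp, Preadditive.sum_comp]
  simp only [Category.assoc, h]

/-- Every subspace of `C(Y → c)` stable under `End Y` consists of the morphisms that factor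
through the image of some idempotent. -/
theorem SimpleReps.exists_projection (irr : SimpleReps C J) {c : C}
    (N : Submodule ℂ (irr.sum ⟶ c)) (hN : ∀ (u : irr.sum ⟶ irr.sum), ∀ h ∈ N, u ≫ h ∈ N) :
    ∃ p : c ⟶ c, (∀ h, h ≫ p ∈ N) ∧ ∀ h ∈ N, h ≫ p = h := by
  obtain ⟨g, hg⟩ := LinearMap.exists_leftInverse_of_injective N.subtype N.ker_subtype
  have hg' : ∀ h (hh : h ∈ N), (g h : irr.sum ⟶ c) = h := fun h hh =>
    congrArg Subtype.val (LinearMap.congr_fun hg ⟨h, hh⟩)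
  let e : J → (irr.sum ⟶ irr.sum) := fun i => irr.proj i ≫ irr.incl i
  have he : ∀ i, e i ≫ e i = e i := by
    intro i
    simp only [e, Category.assoc]
    rw [← Category.assoc (irr.incl i), irr.incl_proj, Category.id_comp]
  -- The linear projection `g`, made `End Y`-linear by sandwiching it between the central `e i`.
  let T : (irr.sum ⟶ c) →ₗ[ℂ] (irr.sum ⟶ c) :=
    ∑ i, Linear.leftComp ℂ c (e i) ∘ₗ N.subtype ∘ₗ g ∘ₗ Linear.leftComp ℂ c (e i)
  have hT : ∀ h, T h = ∑ i, e i ≫ (g (e i ≫ h) : irr.sum ⟶ c) := by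
    intro h
    simp [T]
  have hT' : ∀ (u : irr.sum ⟶ irr.sum) h, T (u ≫ h) = u ≫ T h := by
    intro u h
    rw [hT, hT, Preadditive.comp_sum]
    refine Finset.sum_congr rfl fun i _ => ?_
    obtain ⟨r, hr, hr'⟩ := irr.exists_proj_incl_comp u i
    change e i ≫ u = _ at hr
    change u ≫ e i = _ at hr'
    rw [← Category.assoc, ← Category.assoc, hr, hr', Linear.smul_comp, Linear.smul_comp,
      map_smul, Submodule.coe_smul, Linear.comp_smul]
  obtain ⟨p, hp⟩ := irr.exists_comp_eq T hT'
  refine ⟨p, fun h => ?_, fun h hh => ?_⟩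
  · rw [← hp, hT]
    exact N.sum_mem fun i _ => hN _ _ (g _).2
  · rw [← hp, hT]
    have : ∀ i, e i ≫ (g (e i ≫ h) : irr.sum ⟶ c) = e i ≫ h := by
      intro i
      rw [hg' _ (hN _ _ hh), ← Category.assoc, he]
    simp only [this, e, ← Preadditive.sum_comp, irr.sum_proj_incl, Category.id_comp]

namespace Tube.Rep

variable (dual : ∀ i, BalancedDual (irr.obj i)) {A : Center C} [MonObj A] (K : Center C)
  [ModObj A K]

/-- Every submodule of the representation of `K` is the image of an endomorphism of `K`. -/
theorem exists_projection (hA : IsSeparableAlgebra A)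
    (N : Submodule (Tube irr A)ᵐᵒᵖ (Rep dual A K)) :
    ∃ s : K ⟶ K, smulMap A K ≫ s.f = A.1 ◁ s.f ≫ smulMap A K ∧
      (∀ h : irr.sum ⟶ K.1, (show Rep dual A K from h ≫ s.f) ∈ N) ∧
      ∀ h : irr.sum ⟶ K.1, (show Rep dual A K from h) ∈ N → h ≫ s.f = h := by
  have hN : ∀ (f : Tube irr A), ∀ h : irr.sum ⟶ K.1, (show Rep dual A K from h) ∈ N →
      (show Rep dual A K from act dual K h f) ∈ N :=
    fun f h hh => N.smul_mem (MulOpposite.op f) hh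
  let N' : Submodule ℂ (irr.sum ⟶ K.1) :=
    { carrier := {h | (show Rep dual A K from h) ∈ N}
      add_mem' := fun ha hb => N.add_mem ha hb
      zero_mem' := N.zero_mem
      smul_mem' := fun r h hh => by
        have h1 := hN (r • 1) h hh
        rw [act_smul, act_one] at h1
        exact h1 }
  obtain ⟨p, hp, hp'⟩ := irr.exists_projection N' (fun u h hh => by
    have h1 := hN (ofEnd A u) h hh
    rw [act_ofEnd] at h1
    exact h1)
  have h1 : ∀ c, A.1 ◁ (p ▷ c) ≫ smulBraid A K c ≫ c ◁ p = A.1 ◁ (p ▷ c) ≫ smulBraid A K c := by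
    have key : ∀ (i : J) (h : irr.sum ⟶ K.1), A.1 ◁ ((h ≫ p) ▷ irr.obj i) ≫
        smulBraid A K (irr.obj i) ≫ irr.obj i ◁ p =
        A.1 ◁ ((h ≫ p) ▷ irr.obj i) ≫ smulBraid A K (irr.obj i) := by
      intro i h
      refine (dual i).partialTrace_ext irr fun g => ?_
      have h2 : act dual K (h ≫ p) (single i g) ≫ p = act dual K (h ≫ p) (single i g) :=
        hp' _ (hN (single i g) _ (hp h))
      rw [act_single, BalancedDual.partialTrace_comp, tubeAct_eq] at h2
      simpa only [Category.assoc] using h2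
    refine irr.natural_ext_tensor (N := fun c => A.1 ◁ (p ▷ c) ≫ smulBraid A K c ≫ c ◁ p)
      (N' := fun c => A.1 ◁ (p ▷ c) ≫ smulBraid A K c) (fun s => ?_) (fun s => ?_) fun i => ?_
    · simp only [Category.assoc, ← MonoidalCategory.whiskerLeft_comp_assoc, whisker_exchange]
      rw [MonoidalCategory.whiskerLeft_comp, Category.assoc, reassoc_of% smulBraid_nat K s]
    · simp only [Category.assoc, ← MonoidalCategory.whiskerLeft_comp_assoc, whisker_exchange]
      rw [MonoidalCategory.whiskerLeft_comp, Category.assoc, smulBraid_nat]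
    · refine irr.hom_ext_whisker fun h => ?_
      simpa only [comp_whiskerRight, MonoidalCategory.whiskerLeft_comp, Category.assoc]
        using key i h
  obtain ⟨s, hs, hs', hs''⟩ := exists_module_projection hA dual h1
  refine ⟨s, hs, fun h => ?_, fun h hh => ?_⟩
  · rw [← hs'', ← Category.assoc]
    exact hp _
  · have h2 := hp' h hh
    rw [← h2, Category.assoc, hs']

/-- Representations that come from modules over a separable algebra are completely reducible. -/
theorem isSemisimpleModule (hA : IsSeparableAlgebra A) :
    IsSemisimpleModule (Tube irr A)ᵐᵒᵖ (Rep dual A K) := by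
  refine (isSemisimpleModule_iff _ _).2 ⟨fun N => ?_⟩
  obtain ⟨s, hs, hs', hs''⟩ := exists_projection dual K hA N
  exact ⟨_, LinearMap.isCompl_of_proj (f := (mapHom dual s hs).codRestrict N hs')
    fun x => Subtype.ext (hs'' x.1 x.2)⟩

end Tube.Rep

end CategoryTheory

/-! ### Induction to the center -/

namespace CategoryTheory

section Lax

variable {C : Type u} [Category.{v} C] [MonoidalCategory C]

/-- The rotation of a lax half-braiding with the dual `d` of `c`. -/
def rotate {K : C} (β : ∀ c, K ⊗ c ⟶ c ⊗ K) (c d : C) [ExactPairing d c] : c ⊗ K ⟶ K ⊗ c :=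
  𝟙 _ ⊗≫ (c ⊗ K) ◁ η_ d c ⊗≫ c ◁ β d ▷ c ⊗≫ ε_ d c ▷ (K ⊗ c) ⊗≫ 𝟙 _

theorem comp_rotate {K : C} {β : ∀ c, K ⊗ c ⟶ c ⊗ K}
    (hn : ∀ {c d : C} (s : c ⟶ d), K ◁ s ≫ β d = β c ≫ s ▷ K)
    (hu : β (𝟙_ C) = (ρ_ K).hom ≫ (λ_ K).inv)
    (hm : ∀ c d, β (c ⊗ d) = (α_ K c d).inv ≫ β c ▷ d ≫ (α_ c K d).hom ≫ c ◁ β d ≫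
      (α_ c d K).inv) (c d : C) [ExactPairing d c] : β c ≫ rotate β c d = 𝟙 _ := by
  unfold rotate
  have h : β c ▷ d ⊗≫ c ◁ β d ⊗≫ ε_ d c ▷ K = 𝟙 _ ⊗≫ K ◁ ε_ d c ⊗≫ 𝟙 _ := by
    have h1 := hn (ε_ d c)
    rw [hu, hm] at h1
    calc
      _ = 𝟙 _ ⊗≫ (((α_ K c d).inv ≫ β c ▷ d ≫ (α_ c K d).hom ≫ c ◁ β d ≫
        (α_ c d K).inv) ≫ ε_ d c ▷ K) ⊗≫ 𝟙 _ := by monoidal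
      _ = _ := by rw [← h1]; monoidal
  calc
    _ = 𝟙 _ ⊗≫ (β c ▷ 𝟙_ C ≫ (c ⊗ K) ◁ η_ d c) ⊗≫ c ◁ β d ▷ c ⊗≫
          ε_ d c ▷ (K ⊗ c) ⊗≫ 𝟙 _ := by monoidal
    _ = 𝟙 _ ⊗≫ (K ⊗ c) ◁ η_ d c ⊗≫ (β c ▷ d ⊗≫ c ◁ β d ⊗≫ ε_ d c ▷ K) ▷ c ⊗≫
          𝟙 _ := by rw [← whisker_exchange]; monoidal
    _ = 𝟙 _ ⊗≫ K ◁ (c ◁ η_ d c ⊗≫ ε_ d c ▷ c) ⊗≫ 𝟙 _ := by rw [h]; monoidal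
    _ = _ := by rw [ExactPairing.coevaluation_evaluation'']; monoidal

theorem rotate_comp {K : C} {β : ∀ c, K ⊗ c ⟶ c ⊗ K}
    (hn : ∀ {c d : C} (s : c ⟶ d), K ◁ s ≫ β d = β c ≫ s ▷ K)
    (hu : β (𝟙_ C) = (ρ_ K).hom ≫ (λ_ K).inv)
    (hm : ∀ c d, β (c ⊗ d) = (α_ K c d).inv ≫ β c ▷ d ≫ (α_ c K d).hom ≫ c ◁ β d ≫
      (α_ c d K).inv) (c d : C) [ExactPairing d c] : rotate β c d ≫ β c = 𝟙 _ := by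
  unfold rotate
  have h : K ◁ η_ d c ⊗≫ β d ▷ c ⊗≫ d ◁ β c = 𝟙 _ ⊗≫ η_ d c ▷ K ⊗≫ 𝟙 _ := by
    have h1 := hn (η_ d c)
    rw [hu, hm] at h1
    calc
      _ = 𝟙 _ ⊗≫ (K ◁ η_ d c ≫ ((α_ K d c).inv ≫ β d ▷ c ≫ (α_ d K c).hom ≫
        d ◁ β c ≫ (α_ d c K).inv)) ⊗≫ 𝟙 _ := by monoidal
      _ = _ := by rw [h1]; monoidal
  calc
    _ = 𝟙 _ ⊗≫ (c ⊗ K) ◁ η_ d c ⊗≫ c ◁ β d ▷ c ⊗≫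
          (ε_ d c ▷ (K ⊗ c) ≫ 𝟙_ C ◁ β c) ⊗≫ 𝟙 _ := by monoidal
    _ = 𝟙 _ ⊗≫ c ◁ (K ◁ η_ d c ⊗≫ β d ▷ c ⊗≫ d ◁ β c) ⊗≫
          ε_ d c ▷ (c ⊗ K) ⊗≫ 𝟙 _ := by rw [← whisker_exchange]; monoidal
    _ = 𝟙 _ ⊗≫ (c ◁ η_ d c ⊗≫ ε_ d c ▷ c) ▷ K ⊗≫ 𝟙 _ := by rw [h]; monoidal
    _ = _ := by rw [ExactPairing.coevaluation_evaluation'']; monoidal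

/-- In a rigid category, the invertibility of a half-braiding is automatic. -/
noncomputable def HalfBraiding.ofLax [LeftRigidCategory C] {K : C} (β : ∀ c, K ⊗ c ⟶ c ⊗ K)
    (hn : ∀ {c d : C} (s : c ⟶ d), K ◁ s ≫ β d = β c ≫ s ▷ K)
    (hu : β (𝟙_ C) = (ρ_ K).hom ≫ (λ_ K).inv)
    (hm : ∀ c d, β (c ⊗ d) = (α_ K c d).inv ≫ β c ▷ d ≫ (α_ c K d).hom ≫ c ◁ β d ≫
      (α_ c d K).inv) : HalfBraiding K where
  β c := ⟨β c, rotate β c (HasLeftDual.leftDual c), comp_rotate hn hu hm _ _,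
    rotate_comp hn hu hm _ _⟩
  monoidal := hm
  naturality := hn

end Lax

open DaggerCategory

variable {C : Type u} [Category.{v} C] [Abelian C] [Linear ℂ C] [MonoidalCategory C]
  [MonoidalPreadditive C] [MonoidalLinear ℂ C] [RigidCategory C] [DaggerCategory C]
  [UnitaryFusionCategory C] {J : Type w} [Fintype J] {irr : SimpleReps C J}
  (dual : ∀ i, BalancedDual (irr.obj i)) (y : C)

/-- The object of `C` underlying the object of the center induced from `y`: the direct sum of
`x̄ ⊗ (y ⊗ x)` over all simple objects `x`. -/
noncomputable def indObj : C :=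
  haveI := Abelian.hasFiniteBiproducts (C := C)
  ⨁ fun i => (dual i).dual ⊗ (y ⊗ irr.obj i)

namespace indObj

/-- The inclusion of a summand of `indObj`. -/
noncomputable def incl (i : J) : (dual i).dual ⊗ (y ⊗ irr.obj i) ⟶ indObj dual y :=
  haveI := Abelian.hasFiniteBiproducts (C := C)
  Limits.biproduct.ι (fun i => (dual i).dual ⊗ (y ⊗ irr.obj i)) i

/-- The projection onto a summand of `indObj`. -/
noncomputable def proj (i : J) : indObj dual y ⟶ (dual i).dual ⊗ (y ⊗ irr.obj i) :=
  haveI := Abelian.hasFiniteBiproducts (C := C)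
  Limits.biproduct.π (fun i => (dual i).dual ⊗ (y ⊗ irr.obj i)) i

theorem incl_proj (i : J) : incl dual y i ≫ proj dual y i = 𝟙 _ :=
  haveI := Abelian.hasFiniteBiproducts (C := C)
  Limits.biproduct.ι_π_self _ i

theorem incl_proj_ne {i j : J} (h : i ≠ j) : incl dual y i ≫ proj dual y j = 0 :=
  haveI := Abelian.hasFiniteBiproducts (C := C)
  Limits.biproduct.ι_π_ne _ h

theorem sum_proj_incl : ∑ i, proj dual y i ≫ incl dual y i = 𝟙 (indObj dual y) := by
  have := Abelian.hasFiniteBiproducts (C := C)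
  refine Limits.biproduct.hom_ext _ _ fun j => ?_
  change _ ≫ proj dual y j = 𝟙 _ ≫ proj dual y j
  rw [Preadditive.sum_comp, Finset.sum_eq_single j, Category.assoc, incl_proj]
  · simp
  · intro i _ hij
    rw [Category.assoc, incl_proj_ne _ _ hij, Limits.comp_zero]
  · simp

/-- The universal natural family of morphisms `y ⊗ c ⟶ c ⊗ indObj`. On a simple object it is the
inclusion of a summand, with the dual string bent down. -/
noncomputable def θ (c : C) : y ⊗ c ⟶ c ⊗ indObj dual y :=
  ∑ m, y ◁ (resolution irr c).b m ≫ (dual _).unbend' (incl dual y _) ≫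
    (resolution irr c).a m ▷ indObj dual y

theorem unbend'_nat {i j : J} (s : irr.obj i ⟶ irr.obj j) :
    y ◁ s ≫ (dual j).unbend' (incl dual y j) = (dual i).unbend' (incl dual y i) ≫ s ▷ _ := by
  by_cases h : i = j
  · subst h
    obtain ⟨r, rfl⟩ := irr.exists_smul_id s
    simp
  · rw [irr.hom_eq_zero h s]
    simp

theorem θ_nat {c d : C} (s : c ⟶ d) : y ◁ s ≫ θ dual y d = θ dual y c ≫ s ▷ _ := by
  set R := resolution irr c with hR
  set S := resolution irr d with hS
  have h1 : y ◁ s ≫ θ dual y d = ∑ k, ∑ m, y ◁ R.b k ≫ (dual _).unbend' (incl dual y _) ≫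
      (R.a k ≫ s ≫ S.b m) ▷ _ ≫ S.a m ▷ _ := by
    rw [θ, Preadditive.comp_sum, Finset.sum_comm]
    refine Finset.sum_congr rfl fun m _ => ?_
    have h2 : y ◁ s ≫ y ◁ S.b m = ∑ k, y ◁ R.b k ≫ y ◁ (R.a k ≫ s ≫ S.b m) := by
      simp only [← MonoidalCategory.whiskerLeft_comp, ← whiskerLeft_sum]
      simp only [← Category.assoc, ← Preadditive.sum_comp, R.complete, Category.id_comp]
    rw [← Category.assoc, h2, Preadditive.sum_comp]
    refine Finset.sum_congr rfl fun k _ => ?_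
    rw [Category.assoc, reassoc_of% unbend'_nat dual y (R.a k ≫ s ≫ S.b m)]
  rw [h1, θ, Preadditive.sum_comp]
  refine Finset.sum_congr rfl fun k _ => ?_
  simp only [← Preadditive.comp_sum, ← comp_whiskerRight, ← sum_whiskerRight, Category.assoc,
    S.complete, Category.comp_id]
  rfl

theorem θ_obj (i : J) : θ dual y (irr.obj i) = (dual i).unbend' (incl dual y i) := by
  rw [θ]
  simp only [← unbend'_nat, ← Category.assoc, ← Preadditive.sum_comp]
  simp only [← MonoidalCategory.whiskerLeft_comp, ← whiskerLeft_sum,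
    (resolution irr (irr.obj i)).complete, whiskerLeft_id, Category.id_comp]

variable {V W : C}

theorem θ_obj_comp (i : J) (u : indObj dual y ⊗ W ⟶ V) :
    θ dual y (irr.obj i) ▷ W ≫ (α_ _ _ _).hom ≫ irr.obj i ◁ u =
      (α_ _ _ _).hom ≫ (dual i).unbend' ((dual i).dual ◁ (α_ _ _ _).inv ≫
        (α_ _ _ _).inv ≫ incl dual y i ▷ W ≫ u) := by
  rw [θ_obj]
  unfold BalancedDual.unbend'
  monoidal

/-- Morphisms from the induced object are determined by their composites with the universal family.
-/
theorem hom_ext {u u' : indObj dual y ⊗ W ⟶ V}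
    (h : ∀ c, θ dual y c ▷ W ≫ (α_ _ _ _).hom ≫ c ◁ u = θ dual y c ▷ W ≫ (α_ _ _ _).hom ≫ c ◁ u') :
    u = u' := by
  have h1 : ∀ i, incl dual y i ▷ W ≫ u = incl dual y i ▷ W ≫ u' := by
    intro i
    have h2 := h (irr.obj i)
    rw [θ_obj_comp, θ_obj_comp, cancel_epi] at h2
    have h3 := congrArg (dual i).bend' h2
    rw [BalancedDual.bend'_unbend', BalancedDual.bend'_unbend', cancel_epi, cancel_epi] at h3
    exact h3
  have h2 : ∀ u : indObj dual y ⊗ W ⟶ V, u = ∑ i, proj dual y i ▷ W ≫ incl dual y i ▷ W ≫ u := by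
    intro u
    simp only [← comp_whiskerRight_assoc, ← Preadditive.sum_comp, ← sum_whiskerRight, sum_proj_incl,
      id_whiskerRight, Category.id_comp]
  rw [h2 u, h2 u']
  simp only [h1]

/-- Every natural family factors through the universal family. -/
theorem exists_lift (Φ : ∀ c, (y ⊗ c) ⊗ W ⟶ c ⊗ V)
    (hΦ : ∀ {c d : C} (s : c ⟶ d), (y ◁ s) ▷ W ≫ Φ d = Φ c ≫ s ▷ V) :
    ∃ u : indObj dual y ⊗ W ⟶ V, ∀ c, θ dual y c ▷ W ≫ (α_ _ _ _).hom ≫ c ◁ u = Φ c := by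
  let u : indObj dual y ⊗ W ⟶ V := ∑ i, proj dual y i ▷ W ≫ (α_ _ _ _).hom ≫
    (dual i).dual ◁ (α_ _ _ _).hom ≫ (dual i).bend' ((α_ _ _ _).inv ≫ Φ (irr.obj i))
  have hu : ∀ i, θ dual y (irr.obj i) ▷ W ≫ (α_ _ _ _).hom ≫ irr.obj i ◁ u = Φ (irr.obj i) := by
    intro i
    have h1 : incl dual y i ▷ W ≫ u = (α_ _ _ _).hom ≫
        (dual i).dual ◁ (α_ _ _ _).hom ≫ (dual i).bend' ((α_ _ _ _).inv ≫ Φ (irr.obj i)) := by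
      rw [Preadditive.comp_sum, Finset.sum_eq_single i]
      · rw [← comp_whiskerRight_assoc, incl_proj, id_whiskerRight, Category.id_comp]
      · intro j _ hj
        rw [← comp_whiskerRight_assoc, incl_proj_ne _ _ hj.symm,
          MonoidalPreadditive.zero_whiskerRight, Limits.zero_comp]
      · simp
    rw [θ_obj_comp, h1]
    simp only [Iso.inv_hom_id_assoc, ← MonoidalCategory.whiskerLeft_comp_assoc, Iso.inv_hom_id,
      whiskerLeft_id, Category.id_comp, BalancedDual.unbend'_bend', Iso.hom_inv_id_assoc]
  refine ⟨u, fun c => ?_⟩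
  have h1 : ∀ P : ∀ c, (y ⊗ c) ⊗ W ⟶ c ⊗ V,
      (∀ {c d : C} (s : c ⟶ d), (y ◁ s) ▷ W ≫ P d = P c ≫ s ▷ V) →
      P c = ∑ m, (y ◁ (resolution irr c).b m) ▷ W ≫ P _ ≫ (resolution irr c).a m ▷ V := by
    intro P hP
    simp only [← hP, ← comp_whiskerRight_assoc, ← MonoidalCategory.whiskerLeft_comp,
      ← Preadditive.sum_comp, ← sum_whiskerRight, ← whiskerLeft_sum,
      (resolution irr c).complete]
    simp
  rw [h1 Φ hΦ, h1 (fun c => θ dual y c ▷ W ≫ (α_ _ _ _).hom ≫ c ◁ u) ?_]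
  · simp only [hu]
  · intro c d s
    rw [← comp_whiskerRight_assoc, θ_nat]
    calc
      _ = θ dual y c ▷ W ≫ (α_ _ _ _).hom ≫ (s ▷ (_ ⊗ W) ≫ d ◁ u) := by monoidal
      _ = _ := by rw [← whisker_exchange]; monoidal

theorem exists_braid (d : C) : ∃ u : indObj dual y ⊗ d ⟶ d ⊗ indObj dual y,
    ∀ c, θ dual y c ▷ d ≫ (α_ _ _ _).hom ≫ c ◁ u =
      (α_ _ _ _).hom ≫ θ dual y (c ⊗ d) ≫ (α_ _ _ _).hom :=
  exists_lift dual y (fun c => (α_ _ _ _).hom ≫ θ dual y (c ⊗ d) ≫ (α_ _ _ _).hom) fun s => by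
    have h := θ_nat dual y (s ▷ d)
    have h1 : (y ◁ s) ▷ d ≫ (α_ _ _ _).hom = (α_ _ _ _).hom ≫ y ◁ (s ▷ d) := by monoidal
    rw [reassoc_of% h1, reassoc_of% h]
    simp

/-- The half-braiding of the induced object, as a family of morphisms: by universality it is
determined by joining the strings `c` and `d`. -/
noncomputable def braid (d : C) : indObj dual y ⊗ d ⟶ d ⊗ indObj dual y :=
  (exists_braid dual y d).choose

theorem θ_braid (c d : C) : θ dual y c ▷ d ≫ (α_ _ _ _).hom ≫ c ◁ braid dual y d =
    (α_ _ _ _).hom ≫ θ dual y (c ⊗ d) ≫ (α_ _ _ _).hom :=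
  (exists_braid dual y d).choose_spec c

/-- The half-braiding of the induced object. -/
noncomputable def halfBraiding : HalfBraiding (indObj dual y) := by
  refine HalfBraiding.ofLax (braid dual y) (fun {d d'} s => ?_) ?_ fun d d' => ?_
  · refine hom_ext dual y fun c => ?_
    have h := θ_nat dual y (c ◁ s)
    calc
      _ = 𝟙 _ ⊗≫ (θ dual y c ▷ d ≫ (c ⊗ indObj dual y) ◁ s) ⊗≫ c ◁ braid dual y d' := by monoidal
      _ = 𝟙 _ ⊗≫ (y ⊗ c) ◁ s ≫ (θ dual y c ▷ d' ≫ (α_ _ _ _).hom ≫ c ◁ braid dual y d') := by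
        rw [← whisker_exchange]; monoidal
      _ = 𝟙 _ ⊗≫ (y ◁ (c ◁ s) ≫ θ dual y (c ⊗ d')) ⊗≫ 𝟙 _ := by rw [θ_braid]; monoidal
      _ = ((α_ _ _ _).hom ≫ θ dual y (c ⊗ d) ≫ (α_ _ _ _).hom) ≫ c ◁ (s ▷ _) := by
        rw [h]; monoidal
      _ = _ := by rw [← θ_braid]; monoidal
  · refine hom_ext dual y fun c => ?_
    have h := θ_nat dual y (ρ_ c).hom
    rw [θ_braid]
    calc
      _ = (α_ _ _ _).hom ≫ (θ dual y (c ⊗ 𝟙_ C) ≫ (ρ_ c).hom ▷ _) ≫ c ◁ (λ_ _).inv := by monoidal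
      _ = _ := by rw [← h]; monoidal
  · refine hom_ext dual y fun c => ?_
    have h := θ_nat dual y (α_ c d d').hom
    rw [θ_braid]
    symm
    calc
      _ = 𝟙 _ ⊗≫ (θ dual y c ▷ d ≫ (α_ _ _ _).hom ≫ c ◁ braid dual y d) ▷ d' ⊗≫
            (c ⊗ d) ◁ braid dual y d' ⊗≫ 𝟙 _ := by monoidal
      _ = 𝟙 _ ⊗≫ (θ dual y (c ⊗ d) ▷ d' ≫ (α_ _ _ _).hom ≫ (c ⊗ d) ◁ braid dual y d') ⊗≫
            𝟙 _ := by rw [θ_braid]; monoidal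
      _ = 𝟙 _ ⊗≫ (θ dual y ((c ⊗ d) ⊗ d') ≫ (α_ _ _ _).hom ▷ _) ⊗≫ 𝟙 _ := by
        rw [θ_braid]; monoidal
      _ = _ := by rw [← h]; monoidal

end indObj

/-- The object of the center induced from `y`. -/
noncomputable def indCenter : Center C := ⟨indObj dual y, indObj.halfBraiding dual y⟩

end CategoryTheory

/-! ### Semisimplicity of the tube algebra -/

namespace CategoryTheory

open DaggerCategory

variable {C : Type u} [Category.{v} C] [Abelian C] [Linear ℂ C] [MonoidalCategory C]
  [MonoidalPreadditive C] [MonoidalLinear ℂ C] [RigidCategory C] [DaggerCategory C]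
  [UnitaryFusionCategory C] {J : Type w} [Fintype J] {irr : SimpleReps C J}

section FreeModule

variable (A z : Center C) [MonObj A]

theorem smulMap_free : smulMap A (Mod.free A z).X =
    (α_ A.1 A.1 z.1).inv ≫ Tube.mulMap A ▷ z.1 := by
  have h : smulMap A (Mod.free A z).X = (α_ A A z).inv.f ≫ Tube.mulMap A ▷ z.1 := rfl
  rw [h, Center.associator_inv_f]
  rfl

variable {A z}

/-- The morphism to the free module given by a morphism `h : y ⟶ z` and the unit of `A`. -/
noncomputable def freeMap (A : Center C) [MonObj A] {y : C} (h : y ⟶ z.1) :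
    y ⟶ (Mod.free A z).X.1 :=
  (λ_ y).inv ≫ Tube.oneMap A ▷ y ≫ A.1 ◁ h

theorem tubeAct_freeMap {y c c' : C} (h : y ⟶ z.1) (f : c ⊗ y ⟶ A.1 ⊗ (y ⊗ c')) :
    tubeAct (Mod.free A z).X (freeMap A h) f =
      f ≫ A.1 ◁ (h ▷ c' ≫ (z.2.β c').hom) ≫ (α_ A.1 c' z.1).inv ≫ (A.2.β c').hom ▷ z.1 ≫
        (α_ c' A.1 z.1).hom := by
  refine (congrArg (fun g : A.1 ⊗ (A.1 ⊗ z.1) ⟶ A.1 ⊗ z.1 =>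
    f ≫ A.1 ◁ (((λ_ y).inv ≫ Tube.oneMap A ▷ y ≫ A.1 ◁ h) ▷ c') ≫ (α_ A.1 (A.1 ⊗ z.1) c').inv ≫
      g ▷ c' ≫ (α_ A.1 z.1 c').hom ≫ A.1 ◁ (z.2.β c').hom ≫ (α_ A.1 c' z.1).inv ≫
        (A.2.β c').hom ▷ z.1 ≫ (α_ c' A.1 z.1).hom) (smulMap_free A z)).trans ?_
  calc
    _ = f ⊗≫ A.1 ◁ (Tube.oneMap A ▷ y) ▷ c' ⊗≫ ((A.1 ⊗ A.1) ◁ h ≫ Tube.mulMap A ▷ z.1) ▷ c' ⊗≫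
          A.1 ◁ (z.2.β c').hom ⊗≫ (A.2.β c').hom ▷ z.1 ⊗≫ 𝟙 _ := by monoidal
    _ = f ⊗≫ (A.1 ◁ Tube.oneMap A ≫ Tube.mulMap A) ▷ (y ⊗ c') ⊗≫ A.1 ◁ (h ▷ c') ⊗≫
          A.1 ◁ (z.2.β c').hom ⊗≫ (A.2.β c').hom ▷ z.1 ⊗≫ 𝟙 _ := by
      rw [whisker_exchange]; monoidal
    _ = _ := by rw [Tube.mul_oneMap]; monoidal

end FreeModule

variable (dual : ∀ i, BalancedDual (irr.obj i)) (A : Center C) [MonObj A]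

/-- The universal morphism from `y` to the object induced from `y`. -/
noncomputable def indUnit (y : C) : y ⟶ (indCenter dual y).1 :=
  (ρ_ y).inv ≫ indObj.θ dual y (𝟙_ C) ≫ (λ_ _).hom

theorem indUnit_braid (y c : C) : indUnit dual y ▷ c ≫ ((indCenter dual y).2.β c).hom =
    indObj.θ dual y c := by
  have h := indObj.θ_braid dual y (𝟙_ C) c
  have h' := indObj.θ_nat dual y (λ_ c).hom
  refine (cancel_epi (y ◁ (λ_ c).hom)).1 (Eq.trans ?_ h'.symm)
  calc
    _ = (α_ _ _ _).inv ≫ (indObj.θ dual y (𝟙_ C) ▷ c ≫ (α_ _ _ _).hom ≫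
          𝟙_ C ◁ indObj.braid dual y c) ≫ (λ_ _).hom := by
      change y ◁ (λ_ c).hom ≫ ((ρ_ y).inv ≫ indObj.θ dual y (𝟙_ C) ≫ (λ_ _).hom) ▷ c ≫
        indObj.braid dual y c = _
      monoidal
    _ = _ := by rw [h]; monoidal

namespace Tube

/-- The morphism from `Y` to the free module over the induced object which generates a copy of the
regular representation of the tube algebra. -/
noncomputable def generator : irr.sum ⟶ (Mod.free A (indCenter dual irr.sum)).X.1 :=
  freeMap A (indUnit dual irr.sum)

variable {A}

theorem tubeAct_generator {c c' : C} (f : c ⊗ irr.sum ⟶ A.1 ⊗ (irr.sum ⊗ c')) :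
    tubeAct (Mod.free A (indCenter dual irr.sum)).X (generator dual A) f =
      f ≫ A.1 ◁ indObj.θ dual irr.sum c' ≫ (α_ A.1 c' (indObj dual irr.sum)).inv ≫
        (A.2.β c').hom ▷ indObj dual irr.sum ≫ (α_ c' A.1 (indObj dual irr.sum)).hom := by
  refine (tubeAct_freeMap (indUnit dual irr.sum) f).trans ?_
  rw [indUnit_braid]
  rfl

/-- The component at `j` of the action of `f` on the generator is the component of `f` at `j`, with
the string around the tube bent up and moved past `A`. -/
theorem act_generator_proj (f : Tube irr A) (j : J) :
    (show irr.sum ⟶ A.1 ⊗ indObj dual irr.sum from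
      act dual (Mod.free A (indCenter dual irr.sum)).X (generator dual A) f) ≫
        A.1 ◁ indObj.proj dual irr.sum j =
      (dual j).bend (f j) ≫ (α_ _ _ _).inv ≫ (A.2.β (dual j).dual).inv ▷ _ ≫ (α_ _ _ _).hom := by
  have h1 : (show irr.sum ⟶ A.1 ⊗ indObj dual irr.sum from
      act dual (Mod.free A (indCenter dual irr.sum)).X (generator dual A) f) =
      ∑ i, (dual i).partialTrace (f i ≫ A.1 ◁ indObj.θ dual irr.sum (irr.obj i) ≫
        (α_ A.1 (irr.obj i) (indObj dual irr.sum)).inv ≫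
        (A.2.β (irr.obj i)).hom ▷ indObj dual irr.sum ≫
          (α_ (irr.obj i) A.1 (indObj dual irr.sum)).hom) := by
    refine (act_def dual _ _ f).trans (Finset.sum_congr rfl fun i _ => ?_)
    exact congrArg (dual i).partialTrace (tubeAct_generator dual (f i))
  have h2 : ∀ i, (dual i).partialTrace (f i ≫ A.1 ◁ indObj.θ dual irr.sum (irr.obj i) ≫
        (α_ A.1 (irr.obj i) (indObj dual irr.sum)).inv ≫
        (A.2.β (irr.obj i)).hom ▷ indObj dual irr.sum ≫
          (α_ (irr.obj i) A.1 (indObj dual irr.sum)).hom) ≫ A.1 ◁ indObj.proj dual irr.sum j =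
      (dual i).partialTrace (f i ≫ A.1 ◁ (dual i).unbend'
        (indObj.incl dual irr.sum i ≫ indObj.proj dual irr.sum j) ≫
          (α_ A.1 (irr.obj i) _).inv ≫ (A.2.β (irr.obj i)).hom ▷ _ ≫
            (α_ (irr.obj i) A.1 _).hom) := by
    intro i
    rw [BalancedDual.partialTrace_comp, indObj.θ_obj]
    congr 1
    unfold BalancedDual.unbend'
    calc
      _ = f i ≫ A.1 ◁ (dual i).unbend' (indObj.incl dual irr.sum i) ≫ (α_ _ _ _).inv ≫
        ((A.2.β (irr.obj i)).hom ▷ _ ≫ _ ◁ indObj.proj dual irr.sum j) ≫ (α_ _ _ _).hom := by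
          unfold BalancedDual.unbend'
          monoidal
      _ = _ := by
        rw [← whisker_exchange]
        unfold BalancedDual.unbend'
        monoidal
  rw [h1, Preadditive.sum_comp]
  simp only [h2]
  rw [Finset.sum_eq_single j]
  · rw [indObj.incl_proj, BalancedDual.partialTrace_comp_eq]
    congr 1
    rw [A.2.inv_eq_rotate (dual j).coev' (dual j).ev' (dual j).zigzag_dual']
    unfold BalancedDual.bend' BalancedDual.unbend'
    monoidal
  · intro i _ hij
    rw [indObj.incl_proj_ne _ _ hij]
    simp [BalancedDual.unbend', BalancedDual.partialTrace_zero]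
  · simp

/-- The generator has no annihilator, since bending a string is invertible. -/
theorem act_generator_injective {f g : Tube irr A}
    (h : act dual (Mod.free A (indCenter dual irr.sum)).X (generator dual A) f =
      act dual (Mod.free A (indCenter dual irr.sum)).X (generator dual A) g) : f = g := by
  funext j
  have h1 := (act_generator_proj dual f j).symm.trans
    ((congrArg (fun h : irr.sum ⟶ A.1 ⊗ indObj dual irr.sum =>
      h ≫ A.1 ◁ indObj.proj dual irr.sum j) h).trans (act_generator_proj dual g j))
  rw [cancel_mono] at h1
  rw [← (dual j).unbend_bend (f j), h1, (dual j).unbend_bend]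

/-- The tube algebra of a separable algebra is semisimple: its regular representation embeds into
the representation of a free module, which is semisimple. -/
theorem isSemisimpleRing (dual : ∀ i, BalancedDual (irr.obj i)) (hA : IsSeparableAlgebra A) :
    IsSemisimpleRing (Tube irr A)ᵐᵒᵖ := by
  have := Rep.isSemisimpleModule dual (Mod.free A (indCenter dual irr.sum)).X hA
  let g : Rep dual A (Mod.free A (indCenter dual irr.sum)).X := generator dual A
  refine IsSemisimpleModule.of_injective (LinearMap.toSpanSingleton (Tube irr A)ᵐᵒᵖ _ g) ?_
  intro a b h
  exact MulOpposite.unop_injective (act_generator_injective dual h)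

end Tube

end CategoryTheory

/-! ### Splitting of idempotents and simple representations -/

namespace CategoryTheory

section Split

variable {C : Type u} [Category.{v} C] [MonoidalCategory C]

/-- A retract of `X` in `C` whose idempotent is compatible with a half-braiding of `X` inherits
the half-braiding. -/
def HalfBraiding.retract {X Z : C} (b : HalfBraiding X) (i : Z ⟶ X) (p : X ⟶ Z)
    (hip : i ≫ p = 𝟙 Z) (h : ∀ c, (p ≫ i) ▷ c ≫ (b.β c).hom = (b.β c).hom ≫ c ◁ (p ≫ i)) :
    HalfBraiding Z where
  β c := by
    refine ⟨i ▷ c ≫ (b.β c).hom ≫ c ◁ p, c ◁ i ≫ (b.β c).inv ≫ p ▷ c, ?_, ?_⟩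
    · have h1 : (i ▷ c ≫ (b.β c).hom ≫ c ◁ p) ≫ c ◁ i ≫ (b.β c).inv ≫ p ▷ c =
          i ▷ c ≫ ((b.β c).hom ≫ c ◁ (p ≫ i)) ≫ (b.β c).inv ≫ p ▷ c := by simp
      rw [h1, ← h]
      simp only [Category.assoc, Iso.hom_inv_id_assoc, ← comp_whiskerRight, hip, Category.comp_id,
        id_whiskerRight]
    · have h1 : (c ◁ i ≫ (b.β c).inv ≫ p ▷ c) ≫ i ▷ c ≫ (b.β c).hom ≫ c ◁ p =
          c ◁ i ≫ (b.β c).inv ≫ ((p ≫ i) ▷ c ≫ (b.β c).hom) ≫ c ◁ p := by simp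
      rw [h1, h]
      simp only [Category.assoc, Iso.inv_hom_id_assoc, ← MonoidalCategory.whiskerLeft_comp, hip,
        Category.comp_id, whiskerLeft_id]
  monoidal c d := by
    have h2 : i ≫ p ≫ i = i := by rw [← Category.assoc, hip, Category.id_comp]
    change i ▷ (c ⊗ d) ≫ (b.β (c ⊗ d)).hom ≫ (c ⊗ d) ◁ p = (α_ _ _ _).inv ≫
      (i ▷ c ≫ (b.β c).hom ≫ c ◁ p) ▷ d ≫ (α_ _ _ _).hom ≫ c ◁ (i ▷ d ≫ (b.β d).hom ≫ d ◁ p) ≫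
        (α_ _ _ _).inv
    symm
    calc
      _ = (α_ _ _ _).inv ≫ (i ▷ c ≫ ((b.β c).hom ≫ c ◁ (p ≫ i))) ▷ d ≫ (α_ _ _ _).hom ≫
          c ◁ ((b.β d).hom ≫ d ◁ p) ≫ (α_ _ _ _).inv := by monoidal
      _ = _ := by
        rw [← h, ← comp_whiskerRight_assoc, h2, b.monoidal]
        monoidal
  naturality {c d} s := by
    change Z ◁ s ≫ i ▷ d ≫ (b.β d).hom ≫ d ◁ p = (i ▷ c ≫ (b.β c).hom ≫ c ◁ p) ≫ s ▷ Z
    rw [whisker_exchange_assoc, b.naturality_assoc, ← whisker_exchange]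
    simp only [Category.assoc]

/-- An idempotent of the center splits if it splits in `C`. -/
theorem Center.exists_retract {K : Center C} (e : K ⟶ K) {Z : C} (i : Z ⟶ K.1) (p : K.1 ⟶ Z)
    (hip : i ≫ p = 𝟙 Z) (hpi : p ≫ i = e.f) :
    ∃ (L : Center C) (i : L ⟶ K) (p : K ⟶ L), i ≫ p = 𝟙 L ∧ p ≫ i = e := by
  have h : ∀ c, (p ≫ i) ▷ c ≫ (K.2.β c).hom = (K.2.β c).hom ≫ c ◁ (p ≫ i) := by
    intro c
    rw [hpi]
    exact e.comm c
  refine ⟨⟨Z, K.2.retract i p hip h⟩, ⟨i, fun c => ?_⟩, ⟨p, fun c => ?_⟩, Center.ext _ _ hip,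
    Center.ext _ _ hpi⟩
  · change i ▷ c ≫ (K.2.β c).hom = (i ▷ c ≫ (K.2.β c).hom ≫ c ◁ p) ≫ c ◁ i
    have h2 : i ≫ p ≫ i = i := by rw [← Category.assoc, hip, Category.id_comp]
    simp only [Category.assoc, ← MonoidalCategory.whiskerLeft_comp]
    rw [← h, ← comp_whiskerRight_assoc, h2]
  · change p ▷ c ≫ i ▷ c ≫ (K.2.β c).hom ≫ c ◁ p = (K.2.β c).hom ≫ c ◁ p
    have h2 : (p ≫ i) ≫ p = p := by rw [Category.assoc, hip, Category.comp_id]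
    rw [← comp_whiskerRight_assoc, ← Category.assoc, h, Category.assoc,
      ← MonoidalCategory.whiskerLeft_comp, h2]

open scoped MonoidalLeftAction in
/-- An idempotent of the category of modules splits if it splits in `C`. -/
theorem Mod.exists_retract {A : C} [MonObj A] {M : Mod C A} (e : M ⟶ M) {Z : C} (i : Z ⟶ M.X)
    (p : M.X ⟶ Z) (hip : i ≫ p = 𝟙 Z) (hpi : p ≫ i = e.hom) :
    ∃ (L : Mod C A) (i : L ⟶ M) (p : M ⟶ L), i ≫ p = 𝟙 L ∧ p ≫ i = e := by
  let g : A ⊗ M.X ⟶ M.X := γ[A, M.X]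
  have he : g ≫ p ≫ i = A ◁ (p ≫ i) ≫ g := by
    rw [hpi]
    exact IsModHom.smul_hom
  have h1 : A ◁ i ≫ g ≫ p ≫ i = A ◁ i ≫ g := by
    rw [he, ← MonoidalCategory.whiskerLeft_comp_assoc, ← Category.assoc i, hip, Category.id_comp]
  have h2 : A ◁ p ≫ A ◁ i ≫ g ≫ p = g ≫ p := by
    rw [← MonoidalCategory.whiskerLeft_comp_assoc, ← Category.assoc, ← he, Category.assoc,
      Category.assoc, hip, Category.comp_id]
  have hg1 : η[A] ▷ M.X ≫ g = (λ_ M.X).hom := ModObj.one_smul_self A M.X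
  have hg2 : μ[A] ▷ M.X ≫ g = (α_ A A M.X).hom ≫ A ◁ g ≫ g := ModObj.mul_smul_self A M.X
  letI : ModObj A Z :=
    { smul := (A ◁ i ≫ g ≫ p : A ⊗ Z ⟶ Z)
      one_smul := by
        change η[A] ▷ Z ≫ A ◁ i ≫ g ≫ p = (λ_ Z).hom
        rw [← whisker_exchange_assoc, reassoc_of% hg1]
        simp [hip]
      mul_smul := by
        change μ[A] ▷ Z ≫ A ◁ i ≫ g ≫ p =
          (α_ A A Z).hom ≫ A ◁ (A ◁ i ≫ g ≫ p) ≫ A ◁ i ≫ g ≫ p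
        rw [← whisker_exchange_assoc, reassoc_of% hg2,
          ← MonoidalCategory.whiskerLeft_comp_assoc A (A ◁ i ≫ g ≫ p)]
        simp only [Category.assoc, h1]
        simp }
  refine ⟨⟨Z⟩, Mod.Hom.mk' i ?_, Mod.Hom.mk' p ?_, Mod.hom_ext _ _ hip, Mod.hom_ext _ _ hpi⟩
  · change (A ◁ i ≫ g ≫ p) ≫ i = A ◁ i ≫ g
    simpa only [Category.assoc] using h1
  · change g ≫ p = A ◁ p ≫ A ◁ i ≫ g ≫ p
    exact h2.symm

end Split

/-- A split idempotent of a simple object is trivial. -/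
theorem Simple.eq_zero_or_eq_id {E : Type u} [Category.{v} E] [Preadditive E] {X : E}
    (hX : Simple X) (e : X ⟶ X) (h : ∃ (Z : E) (i : Z ⟶ X) (p : X ⟶ Z), i ≫ p = 𝟙 Z ∧ p ≫ i = e) :
    e = 0 ∨ e = 𝟙 X := by
  obtain ⟨Z, i, p, hip, rfl⟩ := h
  by_cases hi : i = 0
  · left
    rw [hi, Limits.comp_zero]
  · right
    have : Mono i := mono_of_mono_fac hip
    have := isIso_of_mono_of_nonzero hi
    rw [← cancel_epi i, ← Category.assoc, hip, Category.id_comp, Category.comp_id]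

open DaggerCategory

variable {C : Type u} [Category.{v} C] [Abelian C] [Linear ℂ C] [MonoidalCategory C]
  [MonoidalPreadditive C] [MonoidalLinear ℂ C] [RigidCategory C] [DaggerCategory C]
  [UnitaryFusionCategory C] {J : Type w} [Fintype J] {irr : SimpleReps C J}

/-- Idempotents of the center split. -/
theorem Center.exists_splitting {K : Center C} (e : K ⟶ K) (he : e ≫ e = e) :
    ∃ (L : Center C) (i : L ⟶ K) (p : K ⟶ L), i ≫ p = 𝟙 L ∧ p ≫ i = e := by
  obtain ⟨Z, i, p, hip, hpi⟩ :=
    IsIdempotentComplete.idempotents_split K.1 e.f (congrArg Center.Hom.f he)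
  exact Center.exists_retract e i p hip hpi

/-- Idempotents of the category of modules split. -/
theorem Mod.exists_splitting {A : Center C} [MonObj A] {M : Mod (Center C) A} (e : M ⟶ M)
    (he : e ≫ e = e) :
    ∃ (L : Mod (Center C) A) (i : L ⟶ M) (p : M ⟶ L), i ≫ p = 𝟙 L ∧ p ≫ i = e := by
  obtain ⟨Z, i, p, hip, hpi⟩ := Center.exists_splitting e.hom (congrArg Mod.Hom.hom he)
  exact Mod.exists_retract e i p hip hpi

namespace Tube.Rep

variable (dual : ∀ i, BalancedDual (irr.obj i)) {A : Center C} [MonObj A]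

/-- If an `A`-module in the center has only trivial idempotent endomorphisms, its representation is
simple. -/
theorem isSimpleModule_of_forall (hA : IsSeparableAlgebra A) (K : Center C) [ModObj A K]
    (h1 : 𝟙 K ≠ 0)
    (h : ∀ s : K ⟶ K, smulMap A K ≫ s.f = A.1 ◁ s.f ≫ smulMap A K → s ≫ s = s → s = 0 ∨ s = 𝟙 K) :
    IsSimpleModule (Tube irr A)ᵐᵒᵖ (Rep dual A K) := by
  have hn : Nontrivial (Rep dual A K) := by
    by_contra hn
    rw [not_nontrivial_iff_subsingleton] at hn
    refine h1 (Center.ext _ _ (irr.hom_ext_sum fun s => ?_))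
    exact Subsingleton.elim (α := Rep dual A K) _ _
  refine (isSimpleModule_iff _ _).2 { eq_bot_or_eq_top := fun N => ?_ }
  obtain ⟨s, hs, hs', hs''⟩ := exists_projection dual K hA N
  have h2 : s ≫ s = s := Center.ext _ _ (irr.hom_ext_sum fun g => by
    have h3 := hs'' _ (hs' g)
    exact (Category.assoc _ _ _).symm.trans h3)
  rcases h s hs h2 with rfl | rfl
  · left
    refine (Submodule.eq_bot_iff _).2 fun x hx => ?_
    exact (hs'' x hx).symm.trans Limits.comp_zero
  · right
    refine (Submodule.eq_top_iff').2 fun x => ?_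
    have h3 := hs' x
    have h4 : (show irr.sum ⟶ K.1 from x) ≫ (𝟙 K : K ⟶ K).f = x := Category.comp_id _
    exact h4 ▸ h3

/-- The representation of a simple module is simple. -/
theorem isSimpleModule (hA : IsSeparableAlgebra A) {M : Mod (Center C) A} (hM : Simple M) :
    IsSimpleModule (Tube irr A)ᵐᵒᵖ (Rep dual A M.X) := by
  refine isSimpleModule_of_forall dual hA M.X (fun h => ?_) fun s hs h => ?_
  · exact id_nonzero M (Mod.hom_ext _ _ h)
  · let e : M ⟶ M := Mod.Hom.mk' s (Center.ext _ _ hs)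
    rcases hM.eq_zero_or_eq_id e (Mod.exists_splitting e (Mod.hom_ext _ _ h)) with h | h
    · exact Or.inl (congrArg Mod.Hom.hom h)
    · exact Or.inr (congrArg Mod.Hom.hom h)

/-- The representation of a simple object of the center is simple. -/
theorem isSimpleModule_center {z : Center C} (hz : Simple z) :
    IsSimpleModule (Tube irr (𝟙_ (Center C)))ᵐᵒᵖ (Rep dual (𝟙_ (Center C)) z) :=
  isSimpleModule_of_forall dual isSeparableAlgebra_unit z (id_nonzero z) fun s _ h =>
    hz.eq_zero_or_eq_id s (Center.exists_splitting s h)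

end Tube.Rep

end CategoryTheory

/-! ### Multiplicities and blocks of semisimple algebras -/

section SemisimpleModules

open MulOpposite

variable {S V V' : Type*} [Ring S] [Algebra ℂ S] [AddCommGroup V] [Module S V] [Module ℂ V]
  [IsScalarTower ℂ S V] [AddCommGroup V'] [Module S V'] [Module ℂ V'] [IsScalarTower ℂ S V']

theorem finite_linearMap_of_finite [Module.Finite ℂ V] [Module.Finite ℂ V'] :
    Module.Finite ℂ (V →ₗ[S] V') :=
  .of_injective (LinearMap.restrictScalarsₗ ℂ S V V' ℂ) (LinearMap.restrictScalars_injective _)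

/-- The multiplicity of a simple module in a semisimple module can be computed by morphisms in
either direction: composition is a nondegenerate pairing. -/
theorem finrank_linearMap_comm [IsSimpleModule S V] [IsSemisimpleModule S V'] [Module.Finite ℂ V]
    [Module.Finite ℂ V'] : Module.finrank ℂ (V →ₗ[S] V') = Module.finrank ℂ (V' →ₗ[S] V) := by
  have : Module.Finite ℂ (V →ₗ[S] V') := finite_linearMap_of_finite
  have : Module.Finite ℂ (V' →ₗ[S] V) := finite_linearMap_of_finite
  have := IsSimpleModule.nontrivial S V
  obtain ⟨v, hv⟩ := exists_ne (0 : V)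
  obtain ⟨l, hl⟩ : ∃ l : Module.Dual ℂ V, l v ≠ 0 := by
    by_contra! h
    exact hv ((Module.forall_dual_apply_eq_zero_iff ℂ v).1 h)
  let B : (V →ₗ[S] V') →ₗ[ℂ] (V' →ₗ[S] V) →ₗ[ℂ] ℂ :=
    LinearMap.mk₂ ℂ (fun f g => l (g (f v))) (by simp) (by simp) (by simp) (by simp)
  have h1 : Function.Injective B := by
    refine (injective_iff_map_eq_zero B).2 fun f hf => ?_
    by_contra h
    obtain ⟨g, hg⟩ := IsSemisimpleModule.extension_property f
      (LinearMap.injective_of_ne_zero h) LinearMap.id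
    refine hl ?_
    rw [← LinearMap.id_apply (R := S) v, ← hg]
    exact LinearMap.congr_fun hf g
  have h2 : Function.Injective B.flip := by
    refine (injective_iff_map_eq_zero B.flip).2 fun g hg => ?_
    by_contra h
    obtain ⟨f, hf⟩ := IsSemisimpleModule.lifting_property g
      (LinearMap.surjective_of_ne_zero h) LinearMap.id
    refine hl ?_
    rw [← LinearMap.id_apply (R := S) v, ← hf]
    exact LinearMap.congr_fun hg f
  refine le_antisymm ?_ ?_
  · exact (LinearMap.finrank_le_finrank_of_injective h1).trans_eq Subspace.dual_finrank_eq
  · exact (LinearMap.finrank_le_finrank_of_injective h2).trans_eq Subspace.dual_finrank_eq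

/-- If the minimal idempotent `q` acts nontrivially on the simple module `V`, then `V` is
isomorphic to the left ideal `S q`, so that morphisms from `V` to `V'` correspond to the elements
of `q V'`. -/
theorem CategoryTheory.IsMinimalIdempotent.finrank_linearMap [IsSemisimpleRing S]
    [IsSimpleModule S V] {q : S}
    (hq : IsMinimalIdempotent q) {v₀ : V} (hv₀ : q • v₀ ≠ 0) :
    Module.finrank ℂ (V →ₗ[S] V') =
      Module.finrank ℂ (LinearMap.range (Algebra.lsmul ℂ ℂ V' q)) := by
  obtain ⟨hqq, hq0, hqm⟩ := hq
  set v := q • v₀ with hv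
  have hqv : q • v = v := by rw [hv, smul_smul, hqq.eq]
  -- No element of `S q` annihilates `v`: the annihilator would be generated by a subidempotent.
  have key : ∀ s : S, s • v = 0 → s * q = 0 := by
    let Q : Submodule S S := Submodule.span S {q}
    let L : Submodule S S := Q ⊓ LinearMap.ker (LinearMap.toSpanSingleton S V v)
    have hQ : ∀ a ∈ Q, a * q = a := by
      intro a ha
      obtain ⟨b, rfl⟩ := Submodule.mem_span_singleton.1 ha
      rw [smul_eq_mul, _root_.mul_assoc, hqq.eq]
    have hqQ : q ∈ Q := Submodule.mem_span_singleton_self q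
    obtain ⟨L', hL'⟩ := exists_isCompl L
    have hmem : q ∈ L ⊔ L' := by rw [hL'.sup_eq_top]; trivial
    obtain ⟨p, hp, p', hp', hpp⟩ := Submodule.mem_sup.1 hmem
    have hdisj : ∀ a ∈ L, a ∈ L' → a = 0 := fun a h h' => by
      have : a ∈ L ⊓ L' := ⟨h, h'⟩
      rwa [hL'.inf_eq_bot, Submodule.mem_bot] at this
    have hpq : p * q = p := hQ p hp.1
    have h1 : p * p' = 0 := by
      refine hdisj _ ?_ (L'.smul_mem p hp')
      have : p * p' = p - p * p := by
        rw [← hpp, mul_add] at hpq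
        rw [eq_sub_iff_add_eq', hpq]
      rw [this]
      exact L.sub_mem hp (L.smul_mem p hp)
    have h2 : p * p = p := by rw [← hpp, mul_add, h1, add_zero] at hpq; exact hpq
    have h3 : p' * p = 0 := by
      refine hdisj _ (L.smul_mem p' hp) ?_
      have h4 : p' * q = p' := by
        refine hQ p' ?_
        rw [← sub_eq_of_eq_add' hpp.symm]
        exact Q.sub_mem hqQ hp.1
      have : p' * p = p' - p' * p' := by rw [← hpp, mul_add] at h4; rw [eq_sub_iff_add_eq]; exact h4
      rw [this]
      exact L'.sub_mem hp' (L'.smul_mem p' hp')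
    have h5 : q * p = p := by rw [← hpp, add_mul, h3, h2, add_zero]
    have h6 : p = 0 := by
      refine (hqm p h2 hpq h5).resolve_right fun h => hv₀ ?_
      have := LinearMap.mem_ker.1 hp.2
      rwa [LinearMap.toSpanSingleton_apply, h, hqv] at this
    rw [h6, zero_add] at hpp
    intro s hs
    refine hdisj _ ⟨Q.smul_mem s hqQ, ?_⟩ ?_
    · refine LinearMap.mem_ker.2 ?_
      rw [LinearMap.toSpanSingleton_apply, SemigroupAction.mul_smul, hqv, hs]
    · rw [← hpp]; exact L'.smul_mem s hp'
  have hsurj := IsSimpleModule.toSpanSingleton_surjective S hv₀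
  have hmem : ∀ f : V →ₗ[S] V', f v ∈ LinearMap.range (Algebra.lsmul ℂ ℂ V' q) := fun f =>
    ⟨f v, (f.map_smul q v).symm.trans (congrArg f hqv)⟩
  let ev : (V →ₗ[S] V') →ₗ[ℂ] LinearMap.range (Algebra.lsmul ℂ ℂ V' q) :=
    { toFun := fun f => ⟨f v, hmem f⟩
      map_add' := fun _ _ => rfl
      map_smul' := fun _ _ => rfl }
  refine (LinearEquiv.ofBijective ev ⟨?_, ?_⟩).finrank_eq
  · intro f g h
    refine LinearMap.ext fun x => ?_
    obtain ⟨s, rfl⟩ := hsurj x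
    have h' : f v = g v := congrArg Subtype.val h
    rw [LinearMap.toSpanSingleton_apply, f.map_smul, g.map_smul, h']
  · rintro ⟨_, w, rfl⟩
    let a : S →ₗ[S] V := LinearMap.toSpanSingleton S V v
    let b : S →ₗ[S] V' := LinearMap.toSpanSingleton S V' (q • w)
    have hab : LinearMap.ker a ≤ LinearMap.ker b := by
      intro s hs
      rw [LinearMap.mem_ker, LinearMap.toSpanSingleton_apply] at hs ⊢
      rw [smul_smul, key s hs, zero_smul]
    let f : V →ₗ[S] V' := (LinearMap.ker a).liftQ b hab ∘ₗ
      (a.quotKerEquivOfSurjective hsurj).symm.toLinearMap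
    have hf : ∀ s : S, f (s • v) = s • q • w := by
      intro s
      have : s • v = a.quotKerEquivOfSurjective hsurj (Submodule.Quotient.mk s) := rfl
      rw [this]
      simp [f, b]
    refine ⟨f, Subtype.ext ?_⟩
    have := hf 1
    rw [one_smul, one_smul] at this
    exact this

end SemisimpleModules

section Blocks

open MulOpposite CategoryTheory

variable {R W : Type*} [Ring R] [Algebra ℂ R] [AddCommGroup W] [Module Rᵐᵒᵖ W] [Module ℂ W]
  [IsScalarTower ℂ Rᵐᵒᵖ W] [IsSimpleModule Rᵐᵒᵖ W]

theorem CategoryTheory.IsMinimalIdempotent.op {q : R} (hq : IsMinimalIdempotent q) :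
    IsMinimalIdempotent (MulOpposite.op q) := by
  refine ⟨congrArg MulOpposite.op hq.1, fun h => hq.2.1 (op_injective h), fun p hp h h' => ?_⟩
  exact (hq.2.2 p.unop (congrArg unop hp) (congrArg unop h') (congrArg unop h)).imp
    (fun h => unop_injective h) (fun h => unop_injective h)

/-- Two minimal central idempotents acting as the identity on the same nonzero module agree: their
product is a nonzero central idempotent below both. -/
theorem CategoryTheory.IsMinimalCentralIdempotent.eq_of_smul_eq {P P' : R}
    (hP : IsMinimalCentralIdempotent P)
    (hP' : IsMinimalCentralIdempotent P') (h : ∀ w : W, op P • w = w)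
    (h' : ∀ w : W, op P' • w = w) : P = P' := by
  have := IsSimpleModule.nontrivial Rᵐᵒᵖ W
  obtain ⟨w, hw⟩ := exists_ne (0 : W)
  have hcomm : P * P' = P' * P := (hP.1.comm P').eq
  have h1 : P * P' ≠ 0 := by
    intro h0
    have : op (P * P') • w = w := by rw [op_mul, mul_smul, h, h']
    rw [h0, op_zero, zero_smul] at this
    exact hw this.symm
  have h2 : P * P' ∈ Set.center R := Set.mul_mem_center hP.1 hP'.1
  have h3 : IsIdempotentElem (P * P') := IsIdempotentElem.mul_of_commute hcomm hP.2.1 hP'.2.1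
  have h4 : P * P' * P = P * P' := by rw [hcomm, _root_.mul_assoc, hP.2.1.eq]
  have h5 : P * P' * P' = P * P' := by rw [_root_.mul_assoc, hP'.2.1.eq]
  rw [← (hP.2.2.2 _ h2 h3 h4).resolve_left h1]
  exact (hP'.2.2.2 _ h2 h3 h5).resolve_left h1

/-- A semisimple algebra over `ℂ` has a block which acts on a given simple module. Its unit is a
minimal central idempotent that acts as the identity, and it is an algebra of matrices. -/
theorem CategoryTheory.exists_isMinimalCentralIdempotent [IsSemisimpleRing R] [Module.Finite ℂ R]
    (W : Type*) [AddCommGroup W] [Module Rᵐᵒᵖ W] [IsSimpleModule Rᵐᵒᵖ W] :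
    ∃ P : R, IsMinimalCentralIdempotent P ∧ (∀ w : W, op P • w = w) ∧
      ∃ (n : ℕ) (φ : R →ₐ[ℂ] Matrix (Fin n) (Fin n) ℂ), IsMatrixBlock P φ := by
  obtain ⟨n, d, hd, ⟨e⟩⟩ := IsSemisimpleRing.exists_algEquiv_pi_matrix_of_isAlgClosed ℂ R
  -- The units of the blocks.
  let E : Fin n → R := fun i => e.symm (Pi.single i 1)
  have heE : ∀ i, e (E i) = Pi.single i 1 := fun i => e.apply_symm_apply _
  have hmul : ∀ i a, e (E i * a) = Pi.single i (e a i) := fun i a => by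
    rw [map_mul, heE]
    ext j : 1
    by_cases h : j = i
    · subst h; simp
    · simp [h]
  have hmul' : ∀ i a, e (a * E i) = Pi.single i (e a i) := fun i a => by
    rw [map_mul, heE]
    ext j : 1
    by_cases h : j = i
    · subst h; simp
    · simp [h]
  have hE : ∀ i, E i ∈ Set.center R := fun i =>
    Semigroup.mem_center_iff.2 fun a => e.injective ((hmul' i a).trans (hmul i a).symm)
  have hsum : ∑ i, E i = 1 := by
    refine e.injective ?_
    rw [map_sum, map_one]
    simp only [heE]
    exact Finset.univ_sum_single (1 : ∀ i, Matrix (Fin (d i)) (Fin (d i)) ℂ)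
  have := IsSimpleModule.nontrivial Rᵐᵒᵖ W
  obtain ⟨w, hw⟩ := exists_ne (0 : W)
  obtain ⟨i, hi⟩ : ∃ i, op (E i) • w ≠ 0 := by
    by_contra! h
    have h1 : op (∑ i, E i) • w = 0 := by
      rw [Finset.op_sum, Finset.sum_smul]
      exact Finset.sum_eq_zero fun i _ => h i
    rw [hsum, op_one, one_smul] at h1
    exact hw h1
  have hEE : E i * E i = E i := e.injective (by rw [hmul, heE, Pi.single_eq_same])
  let f : W →ₗ[Rᵐᵒᵖ] W :=
    { toFun := fun x => op (E i) • x
      map_add' := smul_add _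
      map_smul' := fun a x => by
        rw [smul_smul, RingHom.id_apply, smul_smul]
        congr 1
        exact unop_injective ((Semigroup.mem_center_iff.1 (hE i)) a.unop) }
  have hf : Function.Surjective f :=
    LinearMap.surjective_of_ne_zero fun h => hi (LinearMap.congr_fun h w)
  refine ⟨E i, ⟨hE i, hEE, fun h => hi ?_, fun Q hQ hQQ hQE => ?_⟩, fun x => ?_, d i,
    (Pi.evalAlgHom ℂ _ i).comp e.toAlgHom, fun m => ?_, fun a => ?_⟩
  · rw [h, op_zero, zero_smul]
  · have h1 : e Q = Pi.single i (e Q i) := by rw [← hmul', hQE]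
    have h2 : ∀ m : Matrix (Fin (d i)) (Fin (d i)) ℂ, m * e Q i = e Q i * m := by
      intro m
      have h3 := congrArg e (Semigroup.mem_center_iff.1 hQ (e.symm (Pi.single i m)))
      rw [map_mul, map_mul, AlgEquiv.apply_symm_apply] at h3
      simpa using congrFun h3 i
    obtain ⟨c, hc⟩ := Matrix.mem_range_scalar_of_commute_single
      (M := e Q i) fun j k _ => h2 _
    have h3 : e Q i * e Q i = e Q i := by
      have := congrFun (congrArg e hQQ) i
      rwa [map_mul] at this
    rw [← hc, ← map_mul] at h3
    have := hd i
    have h4 : c * c = c := Matrix.scalar_inj.1 h3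
    rcases IsIdempotentElem.iff_eq_zero_or_one.1 h4 with h | h
    · left
      rw [← map_eq_zero_iff e e.injective, h1, ← hc, h, map_zero, Pi.single_zero]
    · right
      refine e.injective ?_
      rw [h1, ← hc, h, map_one, heE]
  · obtain ⟨x, rfl⟩ := hf x
    change op (E i) • op (E i) • x = op (E i) • x
    rw [smul_smul, ← op_mul, hEE]
  · refine ⟨e.symm (Pi.single i m), ?_⟩
    change e (e.symm _) i = m
    rw [e.apply_symm_apply, Pi.single_eq_same]
  · change e a i = 0 ↔ _
    exact ((map_eq_zero_iff e e.injective).symm.trans (by rw [hmul, Pi.single_eq_zero_iff])).symm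

/-- If the block of `P` is identified with an algebra of matrices, then the simple module of the
block is the module of row vectors, so that the rank of a matrix is the rank of its action on
the module. -/
theorem CategoryTheory.IsMatrixBlock.rank_eq [Module.Finite ℂ W] {P : R}
    (hP : ∀ w : W, op P • w = w) {n : ℕ} {φ : R →ₐ[ℂ] Matrix (Fin n) (Fin n) ℂ}
    (hφ : IsMatrixBlock P φ) (x : R) :
    (φ x).rank = Module.finrank ℂ (LinearMap.range (Algebra.lsmul ℂ ℂ W (op x))) := by
  have hker : ∀ a b : R, φ a = φ b → ∀ w : W, op a • w = op b • w := by
    intro a b h w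
    have h1 : φ (a - b) = 0 := by rw [map_sub, h, sub_self]
    have h2 := (hφ.map_eq_zero_iff _).1 h1
    have h3 : op (P * (a - b)) • w = 0 := by rw [h2, op_zero, zero_smul]
    rw [op_mul, SemigroupAction.mul_smul, hP, MulOpposite.op_sub, sub_smul, sub_eq_zero] at h3
    exact h3
  obtain ⟨g, hg⟩ := φ.toLinearMap.exists_rightInverse_of_surjective
    (LinearMap.range_eq_top.2 hφ.surjective)
  have hg' : ∀ m, φ (g m) = m := fun m => LinearMap.congr_fun hg m
  have := IsSimpleModule.nontrivial Rᵐᵒᵖ W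
  obtain ⟨w₀, hw₀⟩ := exists_ne (0 : W)
  -- A matrix unit `E k k` which does not annihilate `w₀`.
  obtain ⟨k, hk⟩ : ∃ k, op (g (Matrix.single k k 1)) • w₀ ≠ 0 := by
    by_contra! h
    have h1 : op (∑ k, g (Matrix.single k k 1)) • w₀ = 0 := by
      rw [Finset.op_sum, Finset.sum_smul]
      exact Finset.sum_eq_zero fun i _ => h i
    rw [hker _ 1, op_one, one_smul] at h1
    · exact hw₀ h1
    · rw [map_sum, map_one]
      simp only [hg']
      exact Matrix.sum_single_one
  -- The isomorphism from row vectors: `v` is the action of the matrix with `k`-th row `v`.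
  let row : (Fin n → ℂ) →ₗ[ℂ] Matrix (Fin n) (Fin n) ℂ :=
    { toFun := fun v => Matrix.of (Pi.single k v)
      map_add' := fun v v' => by ext; simp [Pi.single_add]
      map_smul' := fun r v => by ext; simp [Pi.single_smul] }
  have hrow : ∀ v m, row v * m = row (Matrix.vecMul v m) := by
    intro v m
    ext i j
    by_cases h : i = k
    · subst h
      simp [row, Matrix.mul_apply, Matrix.vecMul, dotProduct]
    · simp [row, Matrix.mul_apply, h]
  have hrow1 : row (Pi.single k 1) = Matrix.single k k 1 := by
    ext a b
    by_cases ha : a = k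
    · subst ha
      by_cases hb : b = a
      · subst hb; simp [row]
      · simp [row, hb, Ne.symm hb]
    · simp [row, ha, Ne.symm ha]
  let Ψ : (Fin n → ℂ) →ₗ[ℂ] W :=
    { toFun := fun v => op (g (row v)) • w₀
      map_add' := fun v v' => by simp [add_smul]
      map_smul' := fun r v => by simp }
  have hΨ : ∀ v (y : R), op y • Ψ v = Ψ (Matrix.vecMul v (φ y)) := by
    intro v y
    change op y • op (g (row v)) • w₀ = op (g (row _)) • w₀
    rw [smul_smul, ← op_mul]
    refine hker _ _ ?_ _
    rw [map_mul, hg', hg', hrow]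
  have hinj : Function.Injective Ψ := by
    refine (injective_iff_map_eq_zero Ψ).2 fun v hv => ?_
    by_contra h
    obtain ⟨j, hj⟩ := Function.ne_iff.1 h
    refine hk ?_
    have h1 := hΨ v (g (Matrix.single j k (v j)⁻¹))
    rw [hv, smul_zero, hg'] at h1
    have h2 : Matrix.vecMul v (Matrix.single j k (v j)⁻¹) = Pi.single k 1 := by
      ext b
      by_cases hb : b = k
      · subst hb
        simpa [Matrix.vecMul, dotProduct, Matrix.single_apply] using mul_inv_cancel₀ hj
      · simp [Matrix.vecMul, dotProduct, hb, Ne.symm hb]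
    rw [h2] at h1
    rw [← hrow1]
    exact h1.symm
  have hsurj : Function.Surjective Ψ := by
    let N : Submodule Rᵐᵒᵖ W :=
      { carrier := Set.range Ψ
        add_mem' := by rintro _ _ ⟨a, rfl⟩ ⟨b, rfl⟩; exact ⟨a + b, map_add _ _ _⟩
        zero_mem' := ⟨0, map_zero _⟩
        smul_mem' := by
          rintro c _ ⟨a, rfl⟩
          exact ⟨_, (hΨ a c.unop).symm⟩ }
    have hN : N = ⊤ := by
      refine (eq_bot_or_eq_top N).resolve_left fun h => ?_
      have h1 : Ψ (Pi.single k 1) ∈ N := ⟨_, rfl⟩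
      rw [h, Submodule.mem_bot] at h1
      refine hk ?_
      rw [← hrow1]
      exact h1
    intro w
    have : w ∈ N := by rw [hN]; trivial
    exact this
  let e := LinearEquiv.ofBijective Ψ ⟨hinj, hsurj⟩
  have h1 : LinearMap.range (Algebra.lsmul ℂ ℂ W (op x)) =
      (LinearMap.range (Matrix.vecMulLinear (φ x))).map e.toLinearMap := by
    ext w
    simp only [Submodule.mem_map, LinearMap.mem_range]
    constructor
    · rintro ⟨w, rfl⟩
      obtain ⟨v, rfl⟩ := hsurj w
      exact ⟨_, ⟨v, rfl⟩, (hΨ v x).symm⟩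
    · rintro ⟨_, ⟨v, rfl⟩, rfl⟩
      exact ⟨Ψ v, hΨ v x⟩
  rw [h1, LinearEquiv.finrank_map_eq, ← Matrix.rank_transpose, Matrix.rank]
  have h2 : (Matrix.transpose (φ x)).mulVecLin = Matrix.vecMulLinear (φ x) :=
    LinearMap.ext fun v => by
      rw [Matrix.mulVecLin_apply, Matrix.vecMulLinear_apply, Matrix.mulVec_transpose]
  rw [h2]

end Blocks

/-! ### Free modules and the rank formula -/

namespace CategoryTheory

open DaggerCategory MulOpposite

section FreeForgetful

open scoped MonoidalLeftAction

variable {E : Type u} [Category.{v} E] [Preadditive E] [MonoidalCategory E]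
  [MonoidalPreadditive E] [Linear ℂ E] [MonoidalLinear ℂ E] {A : E} [MonObj A]

/-- The free module functor is left adjoint to the forgetful functor: a morphism from the free
module on `z` is determined by its restriction along the unit of `A`. -/
noncomputable def Mod.freeHomEquiv (z : E) (M : Mod E A) :
    (Mod.free A z ⟶ M) ≃ₗ[ℂ] (z ⟶ M.X) :=
  let g : A ⊗ M.X ⟶ M.X := γ[A, M.X]
  have hg1 : η[A] ▷ M.X ≫ g = (λ_ M.X).hom := ModObj.one_smul_self A M.X
  have hg2 : μ[A] ▷ M.X ≫ g = (α_ A A M.X).hom ≫ A ◁ g ≫ g := ModObj.mul_smul_self A M.X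
  { toFun := fun f => (λ_ z).inv ≫ η[A] ▷ z ≫ (f.hom : A ⊗ z ⟶ M.X)
    map_add' := fun f f' => by
      have h : ∀ (a b : A ⊗ z ⟶ M.X), (λ_ z).inv ≫ η[A] ▷ z ≫ (a + b) =
        (λ_ z).inv ≫ η[A] ▷ z ≫ a + (λ_ z).inv ≫ η[A] ▷ z ≫ b := by simp
      exact h f.hom f'.hom
    map_smul' := fun r f => by
      have h : ∀ (a : A ⊗ z ⟶ M.X), (λ_ z).inv ≫ η[A] ▷ z ≫ (r • a) =
        r • ((λ_ z).inv ≫ η[A] ▷ z ≫ a) := by simp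
      exact h f.hom
    invFun := fun t => Mod.Hom.mk' (M := Mod.free A z) (A ◁ t ≫ g : A ⊗ z ⟶ M.X) (by
      change ((α_ A A z).inv ≫ μ[A] ▷ z) ≫ A ◁ t ≫ g = A ◁ (A ◁ t ≫ g) ≫ g
      rw [Category.assoc, ← whisker_exchange_assoc, hg2]
      monoidal)
    left_inv := fun f => by
      have h : ∀ (a : A ⊗ z ⟶ M.X), ((α_ A A z).inv ≫ μ[A] ▷ z) ≫ a = A ◁ a ≫ g →
          A ◁ ((λ_ z).inv ≫ η[A] ▷ z ≫ a) ≫ g = a := by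
        intro a ha
        calc
          _ = A ◁ ((λ_ z).inv ≫ η[A] ▷ z) ≫ A ◁ a ≫ g := by monoidal
          _ = 𝟙 _ ⊗≫ (A ◁ η[A] ≫ μ[A]) ▷ z ⊗≫ a := by rw [← ha]; monoidal
          _ = a := by rw [MonObj.mul_one]; monoidal
      exact Mod.hom_ext _ _ (h f.hom (Mod.homEquiv _ _ f).2)
    right_inv := fun t => by
      change (λ_ z).inv ≫ η[A] ▷ z ≫ A ◁ t ≫ g = t
      rw [← whisker_exchange_assoc, hg1]
      simp }

end FreeForgetful

variable {C : Type u} [Category.{v} C] [Abelian C] [Linear ℂ C] [MonoidalCategory C]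
  [MonoidalPreadditive C] [MonoidalLinear ℂ C] [RigidCategory C] [DaggerCategory C]
  [UnitaryFusionCategory C] {J : Type w} [Fintype J] {irr : SimpleReps C J}

namespace Tube

variable (dual : ∀ i, BalancedDual (irr.obj i)) {A : Center C} [MonObj A]

/-- On an `A`-module, `i_A ⊗ q` acts as `q` does on the underlying object of the center. -/
theorem act_incl (K : Center C) [ModObj A K] (h : irr.sum ⟶ K.1)
    (q : Tube irr (𝟙_ (Center C))) :
    act dual K h (incl A q) = act dual K h q := by
  rw [act_def, act_def]
  refine Finset.sum_congr rfl fun i _ => congrArg (dual i).partialTrace ?_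
  have h1 : smulBraid (𝟙_ (Center C)) K (irr.obj i) =
      (λ_ (K.1 ⊗ irr.obj i)).hom ≫ (K.2.β (irr.obj i)).hom := by
    have h2 : smulBraid (𝟙_ (Center C)) K (irr.obj i) = (α_ (𝟙_ C) K.1 (irr.obj i)).inv ≫
      (λ_ K.1).hom ▷ irr.obj i ≫ (K.2.β (irr.obj i)).hom := rfl
    rw [h2]
    monoidal
  have h2 : oneMap A ▷ (irr.sum ⊗ irr.obj i) ≫ A.1 ◁ (h ▷ irr.obj i) ≫
      smulBraid A K (irr.obj i) = 𝟙_ C ◁ (h ▷ irr.obj i) ≫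
        (λ_ (K.1 ⊗ irr.obj i)).hom ≫ (K.2.β (irr.obj i)).hom := by
    rw [← oneMap_smulBraid (A := A), whisker_exchange_assoc]
  rw [tubeAct_eq, tubeAct_eq, h1]
  exact (Category.assoc _ _ _).trans (congrArg (q i ≫ ·) h2)

namespace Rep

theorem smulMap_comp_hom {M N : Mod (Center C) A} (f : M ⟶ N) :
    smulMap A M.X ≫ f.hom.f = A.1 ◁ f.hom.f ≫ smulMap A N.X :=
  congrArg Center.Hom.f (Mod.homEquiv M N f).2

theorem smulMap_unit_comp {z K : Center C} (f : z ⟶ K) :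
    smulMap (𝟙_ (Center C)) z ≫ f.f =
      (𝟙_ (Center C)).1 ◁ f.f ≫ smulMap (𝟙_ (Center C)) K :=
  congrArg Center.Hom.f (leftUnitor_naturality f).symm

/-- The morphism of representations induced by a module morphism, as a linear map. -/
noncomputable def homMap (M N : Mod (Center C) A) :
    (M ⟶ N) →ₗ[ℂ] (Rep dual A M.X →ₗ[(Tube irr A)ᵐᵒᵖ] Rep dual A N.X) where
  toFun f := mapHom dual f.hom (smulMap_comp_hom f)
  map_add' f g := LinearMap.ext fun h => Preadditive.comp_add _ _ _ h f.hom.f g.hom.f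
  map_smul' r f := LinearMap.ext fun h => Linear.comp_smul _ _ _ h r f.hom.f

/-- Module morphisms correspond to morphisms of representations of the tube algebra. -/
noncomputable def homEquiv (M N : Mod (Center C) A) :
    (M ⟶ N) ≃ₗ[ℂ] (Rep dual A M.X →ₗ[(Tube irr A)ᵐᵒᵖ] Rep dual A N.X) :=
  LinearEquiv.ofBijective (homMap dual M N)
    ⟨fun f g h => Mod.hom_ext _ _ (mapHom_injective dual (hs := smulMap_comp_hom f)
      (hs' := smulMap_comp_hom g) h), fun T => by
      obtain ⟨s, hs, h⟩ := exists_hom dual T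
      exact ⟨Mod.Hom.mk' s (Center.ext _ _ hs), LinearMap.ext fun x => (h x).symm⟩⟩

/-- The morphism of representations induced by a morphism of the center, as a linear map. -/
noncomputable def centerHomMap (z K : Center C) :
    (z ⟶ K) →ₗ[ℂ] (Rep dual (𝟙_ (Center C)) z →ₗ[(Tube irr (𝟙_ (Center C)))ᵐᵒᵖ]
      Rep dual (𝟙_ (Center C)) K) where
  toFun f := mapHom dual f (smulMap_unit_comp f)
  map_add' f g := LinearMap.ext fun h => Preadditive.comp_add _ _ _ h f.f g.f
  map_smul' r f := LinearMap.ext fun h => Linear.comp_smul _ _ _ h r f.f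

/-- Morphisms of the center correspond to morphisms of representations of the tube algebra. -/
noncomputable def centerHomEquiv (z K : Center C) :
    (z ⟶ K) ≃ₗ[ℂ] (Rep dual (𝟙_ (Center C)) z →ₗ[(Tube irr (𝟙_ (Center C)))ᵐᵒᵖ]
      Rep dual (𝟙_ (Center C)) K) :=
  LinearEquiv.ofBijective (centerHomMap dual z K)
    ⟨fun f g h => mapHom_injective dual (hs := smulMap_unit_comp f)
      (hs' := smulMap_unit_comp g) h, fun T => by
      obtain ⟨s, hs, h⟩ := exists_hom dual T
      exact ⟨s, LinearMap.ext fun x => (h x).symm⟩⟩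

end Rep

end Tube

end CategoryTheory

open CategoryTheory MonoidalCategory MulOpposite in
/-- The rank of the action of `i_A ⊗ q` on the representation of a simple module `M` is the
multiplicity of `M` in the free module on `z`. It is the dimension of the space of morphisms of
representations from `C(Y → z)` to `C(Y → M)`, hence of `Z(C)(z → M)` and of `Z(C)_A(Az → M)`. -/
theorem CategoryTheory.Tube.finrank_range_incl {C : Type u} [Category.{v} C] [Abelian C]
    [Linear ℂ C] [MonoidalCategory C] [MonoidalPreadditive C] [MonoidalLinear ℂ C] [RigidCategory C]
    [DaggerCategory C] [UnitaryFusionCategory C]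
    {J : Type w} [Fintype J] (irr : SimpleReps C J)
    (dual : ∀ i, BalancedDual (irr.obj i))
    (A : Center C) [MonObj A] (hA : IsSeparableAlgebra A)
    (z : Center C) (hz : Simple z)
    (q : Tube irr (𝟙_ (Center C))) (hq : IsMinimalIdempotent q)
    (hqz : ∃ h : irr.sum ⟶ z.1, Tube.act dual z h q ≠ 0)
    (M : Mod (Center C) A) (hM : Simple M) :
    Module.finrank ℂ (LinearMap.range (Algebra.lsmul ℂ ℂ (Tube.Rep dual A M.X)
      (op (Tube.incl A q)))) = Module.finrank ℂ (M ⟶ Mod.free A z) := by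
  have := Tube.isSemisimpleRing dual (isSeparableAlgebra_unit (C := Center C))
  have := Tube.Rep.isSimpleModule dual hA hM
  have := Tube.Rep.isSimpleModule_center dual hz
  have := Tube.Rep.isSemisimpleModule dual (Mod.free A z).X hA
  obtain ⟨h, hh⟩ := hqz
  have h1 := IsMinimalIdempotent.finrank_linearMap hq.op (V := Tube.Rep dual (𝟙_ (Center C)) z)
    (V' := Tube.Rep dual (𝟙_ (Center C)) M.X) (v₀ := h) hh
  rw [(Tube.Rep.homEquiv dual M (Mod.free A z)).finrank_eq, finrank_linearMap_comm,
    ← (Tube.Rep.homEquiv dual (Mod.free A z) M).finrank_eq, (Mod.freeHomEquiv z M).finrank_eq,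
    (Tube.Rep.centerHomEquiv dual z M.X).finrank_eq, h1]
  have h2 : ∀ x : irr.sum ⟶ M.X.1, Tube.act dual M.X x (Tube.incl A q) = Tube.act dual M.X x q :=
    fun x => Tube.act_incl dual M.X x q
  have h3 : ∀ (T T' : (irr.sum ⟶ M.X.1) →ₗ[ℂ] (irr.sum ⟶ M.X.1)), (∀ x, T x = T' x) →
      Module.finrank ℂ (LinearMap.range T) = Module.finrank ℂ (LinearMap.range T') := by
    intro T T' h
    rw [LinearMap.ext h]
  exact h3 _ _ h2

theorem mainTheorem4 {C : Type u} [Category.{v} C] [Abelian C] [Linear ℂ C]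
    [MonoidalCategory C] [MonoidalPreadditive C] [MonoidalLinear ℂ C] [RigidCategory C]
    [DaggerCategory C] [UnitaryFusionCategory C]
    {J : Type w} [Fintype J] (irr : SimpleReps C J)
    (dual : ∀ i, BalancedDual (irr.obj i))
    (A : Center C) [MonObj A] (hA : IsConnectedEtale A)
    (z : Center C) (hz : Simple z)
    (q : Tube irr (𝟙_ (Center C))) (hq : IsMinimalIdempotent q)
    (hqz : ∃ h : irr.sum ⟶ z.1, Tube.act dual z h q ≠ 0)
    (M : Mod (Center C) A) (hM : Simple M) :
    (∃! P : Tube irr A, IsMinimalCentralIdempotent P ∧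
      ∀ h : irr.sum ⟶ M.X.1, Tube.act dual M.X h P = h) ∧
    ∀ P : Tube irr A, IsMinimalCentralIdempotent P →
      (∀ h : irr.sum ⟶ M.X.1, Tube.act dual M.X h P = h) →
      (∃ (n : ℕ) (φ : Tube irr A →ₐ[ℂ] Matrix (Fin n) (Fin n) ℂ), IsMatrixBlock P φ) ∧
      ∀ (n : ℕ) (φ : Tube irr A →ₐ[ℂ] Matrix (Fin n) (Fin n) ℂ), IsMatrixBlock P φ →
        (φ (P * Tube.incl A q)).rank = Module.finrank ℂ (M ⟶ Mod.free A z) := by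
  have hA' : IsSeparableAlgebra A := hA.separable
  have := Tube.isSemisimpleRing dual hA'
  have : IsSemisimpleRing (Tube irr A) := isSemisimpleRing_mulOpposite_iff.1 this
  have := Tube.Rep.isSimpleModule dual hA' hM
  obtain ⟨P, hP, hPM, n, φ, hφ⟩ :=
    exists_isMinimalCentralIdempotent (R := Tube irr A) (Tube.Rep dual A M.X)
  have huniq : ∀ Q : Tube irr A, IsMinimalCentralIdempotent Q →
      (∀ h : irr.sum ⟶ M.X.1, Tube.act dual M.X h Q = h) → Q = P := fun Q hQ hQM =>
    hQ.eq_of_smul_eq (W := Tube.Rep dual A M.X) hP hQM hPM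
  refine ⟨⟨P, ⟨hP, hPM⟩, fun Q hQ => huniq Q hQ.1 hQ.2⟩, fun Q hQ hQM => ?_⟩
  obtain rfl := huniq Q hQ hQM
  refine ⟨⟨n, φ, hφ⟩, fun n φ hφ => ?_⟩
  -- The kernel of `φ` is annihilated by `Q`.
  have h1 : φ (Q * Tube.incl A q) = φ (Tube.incl A q) := by
    rw [← sub_eq_zero, ← map_sub, hφ.map_eq_zero_iff, mul_sub, ← _root_.mul_assoc, hQ.2.1.eq,
      sub_self]
  have h2 : ∀ w : Tube.Rep dual A M.X, MulOpposite.op Q • w = w := hQM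
  rw [h1, IsMatrixBlock.rank_eq h2 hφ]
  exact Tube.finrank_range_incl irr dual A hA' z hz q hq hqz M hM
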